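/- Let $1<\alpha\le 2$. A finite family $X=(X_1,\dots,X_n)$ of complex random variables is jointly symmetric $\alpha$-stable (S$\alpha$S) if there is a finite symmetric measure $\Gamma_X$ on the unit sphere of $\mathbb C^n$ with $E\exp(i\,\mathrm{Re}\sum_k\bar t_kX_k)=\exp\bigl(-\int|\mathrm{Re}\sum_k\bar t_kx_k|^\alpha d\Gamma_X(x)\bigr)$ for all $t\in\mathbb C^n$; a process is S$\alpha$S if its finite subfamilies are jointly S$\alpha$S. Write $z^{<\beta>}=|z|^{\beta-1}\bar z$ (with $0^{<\beta>}=0$), $[X,Y]_\alpha=\int x\,y^{<\alpha-1>}d\Gamma_{(X,Y)}(x,y)$ and $\|X\|_\alpha=[X,X]_\alpha^{1/\alpha}$. A complex S$\alpha$S sequence $\{\xi_n\}_{n\in\mathbb Z}$ is harmonizable with spectral process $Z^\xi$ and spectral measure $\mu$ if $Z^\xi=\{Z^\xi(\theta),\theta\in[-\pi,\pi]\}$ is a complex S$\alpha$S process with independent increments, $\mu$ is a finite measure on $(-\pi,\pi]$ with $\mu((s,t])=\|Z^\xi(t)-Z^\xi(s)\|_\alpha^\alpha$, $\xi_n=\int_{-\pi}^{\pi}e^{in\theta}dZ^\xi(\theta)$,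 and $[\xi_n,\xi_m]_\alpha=\int e^{i(n-m)\theta}d\mu(\theta)$. Here, for a process $Z$ with spectral measure $\mu$ and $\varphi\in L^\alpha(\mu)$, $\int\varphi\,dZ$ is the $\|\cdot\|_\alpha$-limit of the integrals of step functions converging to $\varphi$ in $L^\alpha(\mu)$. Let $\{\xi_n\}_{n\in\mathbb Z}$ and $\{\eta_n\}_{n\in\mathbb Z}$ be mutually independent harmonizable S$\alpha$S sequences with spectral processes $Z^\xi,Z^\eta$ and absolutely continuous spectral measures $f(\theta)d\theta$, $g(\theta)d\theta$, where $f,g>0$ almost everywhere on $(-\pi,\pi]$ and $$\int_{-\pi}^{\pi}(f(\theta)+g(\theta))^{-1/(\alpha-1)}d\theta<\infty .$$ Let $(a_j)_{j\ge0}$ be complex numbers with $\sum_j|a_j|<\infty$ and put $A(e^{i\theta})=\sum_{j\ge0}a_je^{ij\theta}$. Then the series $A\xi=\sum_{j\ge0}a_j\xi_j$ converges in $\|\cdot\|_\alpha$. Let $H^-$ be the $\|\cdot\|_\alpha$-closed complex linear span of $\xi_k+\eta_k$, $k\le-1$. There is an almost surely unique $\hat A\xi\in H^-$ that minimizes $\|A\xi-\zeta\|_\alpha$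 over $\zeta\in H^-$ (the optimal linear estimate), and $$\hat A\xi=\int_{-\pi}^{\pi}h(\theta)\,\bigl(dZ^\xi(\theta)+dZ^\eta(\theta)\bigr),$$ where $h$ lies in the closed linear span of $e^{ik\theta}$, $k\le-1$, in $L^\alpha(f+g)$. There are coefficients $(c_j)_{j\ge0}$ and $C\in L^1(-\pi,\pi]$ with Fourier series $C(e^{i\theta})\sim\sum_{j\ge0}c_je^{ij\theta}$ such that $$\bigl(A(e^{i\theta})-h(\theta)\bigr)^{<\alpha-1>}f(\theta)-h(\theta)^{<\alpha-1>}g(\theta)=\overline{C(e^{i\theta})}\ \text{ for almost every }\theta,\qquad \int_{-\pi}^{\pi}e^{-ik\theta}h(\theta)\,d\theta=0,\quad k=0,1,2,\dots,$$ and these equations determine $h$ and $(c_j)$: if $h'\in L^\alpha(f+g)$ and $(c_j')$ satisfy them as well, then $h'=h$ almost everywhere and $c'_j=c_j$ for all $j$. The error of the estimate is finite and equals $$\|A\xi-\hat A\xi\|_\alpha^\alpha=\int_{-\pi}^{\pi}|A(e^{i\theta})-h(\theta)|^\alpha f(\theta)\,d\theta+\int_{-\pi}^{\pi}|h(\theta)|^\alpha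 g(\theta)\,d\theta .$$ -/

import Mathlib

open MeasureTheory ProbabilityTheory Filter Topology

noncomputable section

/-- The signed power `z^{<β>} = |z|^(β-1) * conj z`  (equal to `0` at `z = 0`). -/
def signedPow (β : ℝ) (z : ℂ) : ℂ :=
  ((‖z‖ ^ (β - 1) : ℝ) : ℂ) * (starRingEnd ℂ) z

section Stable

variable {Ω : Type*} [MeasurableSpace Ω]

/-- `Γ` is a spectral measure of the finite family `X` of complex random variables: a finite
symmetric measure on the unit sphere of `ℂ^ι` (the real unit sphere of dimension `2|ι| - 1`) with
`E exp(i ⟨t, X⟩) = exp(-∫ |⟨t, x⟩|^α dΓ(x))`.  The real pairing of `t` and `x` over all real and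
imaginary parts is written as `Re ∑ conj (t i) * x i`. -/
structure IsStableSpectralMeasure (α : ℝ) (P : Measure Ω) {ι : Type*} [Fintype ι]
    (X : ι → Ω → ℂ) (Γ : Measure (EuclideanSpace ℂ ι)) : Prop where
  finite : IsFiniteMeasure Γ
  sphere : Γ (Metric.sphere 0 1)ᶜ = 0
  symm : Γ.map (fun x => -x) = Γ
  charFun_eq : ∀ t : ι → ℂ,
    ∫ ω, Complex.exp (Complex.I * ((∑ i, (starRingEnd ℂ) (t i) * X i ω).re : ℂ)) ∂P
      = ((Real.exp (-∫ x, |(∑ i, (starRingEnd ℂ) (t i) * x i).re| ^ α ∂Γ) : ℝ) : ℂ)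

/-- The finite family `X` of complex random variables is jointly symmetric `α`-stable. -/
def JointlySaS (α : ℝ) (P : Measure Ω) {ι : Type*} [Fintype ι] (X : ι → Ω → ℂ) : Prop :=
  (∀ i, AEMeasurable (X i) P) ∧ ∃ Γ, IsStableSpectralMeasure α P X Γ

/-- A single complex symmetric `α`-stable random variable. -/
def IsSaS (α : ℝ) (P : Measure Ω) (X : Ω → ℂ) : Prop :=
  JointlySaS α P (fun _ : Fin 1 => X)

/-- The complex process `X`, with times in `T`, is symmetric `α`-stable: its finite subfamilies
are jointly symmetric `α`-stable. -/
def IsSaSProcess (α : ℝ) (P : Measure Ω) {κ : Type*} (T : Set κ) (X : κ → Ω → ℂ) : Prop :=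
  ∀ (n : ℕ) (t : Fin n → κ), (∀ i, t i ∈ T) → JointlySaS α P (fun i => X (t i))

open Classical in
/-- The covariation `[X, Y]_α = ∫ x * y^{<α-1>} dΓ(x, y)`, where `Γ` is a spectral measure of
the pair `(X, Y)` (the integral does not depend on which one); `0` if `X, Y` are not jointly
symmetric `α`-stable. -/
def covariation (α : ℝ) (P : Measure Ω) (X Y : Ω → ℂ) : ℂ :=
  if h : ∃ Γ, IsStableSpectralMeasure α P ![X, Y] Γ then
    ∫ z : EuclideanSpace ℂ (Fin 2), z 0 * signedPow (α - 1) (z 1) ∂h.choose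
  else 0

/-- `‖X‖_α = [X, X]_α^(1/α)`, for a symmetric `α`-stable `X`. -/
def saSNorm (α : ℝ) (P : Measure Ω) (X : Ω → ℂ) : ℝ :=
  (covariation α P X X).re ^ (1 / α)

/-- `X n → Y` in the norm `‖·‖_α`. -/
def TendstoSaS (α : ℝ) (P : Measure Ω) (X : ℕ → Ω → ℂ) (Y : Ω → ℂ) : Prop :=
  (∀ n, IsSaS α P (X n - Y)) ∧ Tendsto (fun n => saSNorm α P (X n - Y)) atTop (𝓝 0)

/-- `Z = {Z(θ), θ ∈ [-π, π]}` is a complex symmetric `α`-stable process with independent increments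
and finite spectral measure `μ`, that is, `μ (s, t] = ‖Z t - Z s‖_α^α`. -/
structure IsIndepIncrementSaS (α : ℝ) (P : Measure Ω) (Z : ℝ → Ω → ℂ) (μ : Measure ℝ) :
    Prop where
  sas : IsSaSProcess α P (Set.Icc (-Real.pi) Real.pi) Z
  indep : HasIndepIncrements (fun t : Set.Icc (-Real.pi) Real.pi => Z t) P
  finite : IsFiniteMeasure μ
  supp : μ (Set.Ioc (-Real.pi) Real.pi)ᶜ = 0
  spectral : ∀ s t : ℝ, -Real.pi ≤ s → s ≤ t → t ≤ Real.pi →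
    μ (Set.Ioc s t) = ENNReal.ofReal (saSNorm α P (Z t - Z s) ^ α)

/-- A step function `∑ j, c j * 1_{(s j, t j]}` on `(-π, π]`, given by its data. -/
structure StepData where
  n : ℕ
  coef : Fin n → ℂ
  left : Fin n → ℝ
  right : Fin n → ℝ
  neg_pi_le : ∀ j, -Real.pi ≤ left j
  le : ∀ j, left j ≤ right j
  le_pi : ∀ j, right j ≤ Real.pi

/-- The step function itself. -/
def StepData.toFun (φ : StepData) (θ : ℝ) : ℂ :=
  ∑ j, (Set.Ioc (φ.left j) (φ.right j)).indicator (fun _ => φ.coef j) θ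

/-- Its integral `∑ j, c j * (Z (t j) - Z (s j))`. -/
def StepData.integral (φ : StepData) (Z : ℝ → Ω → ℂ) : Ω → ℂ :=
  fun ω => ∑ j, φ.coef j * (Z (φ.right j) ω - Z (φ.left j) ω)

/-- `Y = ∫ f dZ` for `f ∈ L^α(μ)`, where `μ` is the spectral measure of `Z`: the limit in `‖·‖_α`
of the integrals of step functions that converge to `f` in `L^α(μ)`. -/
def HasStableIntegral (α : ℝ) (P : Measure Ω) (Z : ℝ → Ω → ℂ) (μ : Measure ℝ)
    (f : ℝ → ℂ) (Y : Ω → ℂ) : Prop :=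
  MemLp f (ENNReal.ofReal α) μ ∧
  ∃ φ : ℕ → StepData,
    Tendsto (fun n => eLpNorm ((φ n).toFun - f) (ENNReal.ofReal α) μ) atTop (𝓝 0) ∧
    TendstoSaS α P (fun n => (φ n).integral Z) Y

/-- The function `θ ↦ e^{inθ}`. -/
def expi (n : ℤ) (θ : ℝ) : ℂ := Complex.exp (Complex.I * n * θ)

/-- `ξ` is a harmonizable symmetric `α`-stable sequence, with spectral process `Z` and spectral
measure `μ`. -/
structure IsHarmonizable (α : ℝ) (P : Measure Ω) (ξ : ℤ → Ω → ℂ) (Z : ℝ → Ω → ℂ)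
    (μ : Measure ℝ) : Prop where
  sas : IsSaSProcess α P Set.univ ξ
  process : IsIndepIncrementSaS α P Z μ
  spectral : ∀ n : ℤ, HasStableIntegral α P Z μ (expi n) (ξ n)
  covariation_eq : ∀ n m : ℤ, covariation α P (ξ n) (ξ m) = ∫ θ, expi (n - m) θ ∂μ

/-- The absolutely continuous measure on `(-π, π]` with density `f`. -/
def densityMeasure (f : ℝ → ℝ) : Measure ℝ :=
  (volume.restrict (Set.Ioc (-Real.pi) Real.pi)).withDensity (fun θ => ENNReal.ofReal (f θ))

/-- `H⁻(ζ)`: the closure in `‖·‖_α` of the complex linear span of `ζ k`, `k ≤ -1`. -/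
def pastSpace (α : ℝ) (P : Measure Ω) (ζ : ℤ → Ω → ℂ) : Set (Ω → ℂ) :=
  {Y | ∃ X : ℕ → Ω → ℂ,
    (∀ n, X n ∈ Submodule.span ℂ (ζ '' Set.Iic (-1))) ∧ TendstoSaS α P X Y}

/-- `Y` is the optimal linear estimate of `U` from `ζ k`, `k ≤ -1`: a best approximation of `U`
in `H⁻(ζ)` with respect to `‖·‖_α`. -/
def IsOptimalEstimate (α : ℝ) (P : Measure Ω) (ζ : ℤ → Ω → ℂ) (U Y : Ω → ℂ) : Prop :=
  Y ∈ pastSpace α P ζ ∧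
    ∀ W ∈ pastSpace α P ζ, saSNorm α P (U - Y) ≤ saSNorm α P (U - W)

/-- `U = ∑_{j ≥ 0} a j * ξ j`, the series converging in `‖·‖_α`. -/
def IsFunctional (α : ℝ) (P : Measure Ω) (a : ℕ → ℂ) (ξ : ℤ → Ω → ℂ) (U : Ω → ℂ) : Prop :=
  TendstoSaS α P (fun N => fun ω => ∑ j ∈ Finset.range N, a j * ξ j ω) U

end Stable

/-- `L^α_-(μ)`: the closure in `L^α(μ)` of the linear span of `e^{ikθ}`, `k ≤ -1`. -/
def pastFunctions (α : ℝ) (μ : Measure ℝ) : Set (ℝ → ℂ) :=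
  {h | MemLp h (ENNReal.ofReal α) μ ∧ ∃ p : ℕ → ℝ → ℂ,
    (∀ n, p n ∈ Submodule.span ℂ (expi '' Set.Iic (-1))) ∧
    Tendsto (fun n => eLpNorm (p n - h) (ENNReal.ofReal α) μ) atTop (𝓝 0)}

/-- `A(e^{iθ}) = ∑_{j ≥ 0} a j * e^{ijθ}`, used for absolutely summable `a`. -/
def symbolA (a : ℕ → ℂ) (θ : ℝ) : ℂ := ∑' j : ℕ, a j * expi j θ

/-- `C ∈ L¹(-π, π]` has the Fourier series `∑_{j ≥ 0} c j * e^{ijθ}`. -/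
def HasAnalyticFourierSeries (C : ℝ → ℂ) (c : ℕ → ℂ) : Prop :=
  IntegrableOn C (Set.Ioc (-Real.pi) Real.pi) ∧
  (∀ j : ℕ, (2 * Real.pi : ℂ)⁻¹ * ∫ θ in Set.Ioc (-Real.pi) Real.pi, expi (-j) θ * C θ = c j) ∧
  ∀ k : ℤ, k < 0 → ∫ θ in Set.Ioc (-Real.pi) Real.pi, expi (-k) θ * C θ = 0

/-- The equations for the spectral characteristic `h` and the coefficients `c`:
`(A - h)^{<α-1>} f - h^{<α-1>} g = conj C` almost everywhere, with `C = ∑_{j ≥ 0} c j e^{ijθ}`, and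
`∫ e^{-ikθ} h(θ) dθ = 0` for `k ≥ 0`. -/
def SolvesSystem (α : ℝ) (f g : ℝ → ℝ) (a : ℕ → ℂ) (h : ℝ → ℂ) (c : ℕ → ℂ) : Prop :=
  (∃ C : ℝ → ℂ, HasAnalyticFourierSeries C c ∧
    ∀ᵐ θ ∂volume.restrict (Set.Ioc (-Real.pi) Real.pi),
      signedPow (α - 1) (symbolA a θ - h θ) * (f θ : ℂ) - signedPow (α - 1) (h θ) * (g θ : ℂ)
        = (starRingEnd ℂ) (C θ)) ∧
  IntegrableOn h (Set.Ioc (-Real.pi) Real.pi) ∧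
  ∀ k : ℕ, ∫ θ in Set.Ioc (-Real.pi) Real.pi, expi (-k) θ * h θ = 0

end

/-!
The proof moves the prediction problem from the random variables to functions on the circle.

A complex symmetric `α`-stable variable `X` is recorded by its scale `‖X‖_α ^ α` (`HasScale`): the
characteristic function is `exp (-∫ |Re (conj t * x)| ^ α dΓ)` with `Γ` of total mass the scale.  For
such variables `‖X‖_α` is equivalent to the norm of `L¹(P)` (`HasScale.norm_le`,
`HasScale.rpow_le_norm`), and variables with prescribed scales form a closed set in `L¹(P)`.
Independent increments therefore make `φ ↦ ∫ φ dZ` a bounded linear map `L^α(μ) → L¹(P)` under which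
`∫ φ dZ` has scale `∫ ‖φ‖ ^ α dμ` (`IsIndepIncrementSaS.exists_integral`).  Since the two sequences are
independent and trigonometric polynomials are dense, scales of `∫ φ dZξ + ∫ ψ dZη` add
(`hasScale_add_of_indep`).  Hence `H⁻` is the image of the closed span of `e^{ikθ}`, `k ≤ -1`, in
`L^α((f + g) dθ)` (`mem_pastSpace_iff`), and the error of `∫ h (dZξ + dZη)` is
`∫ |A - h| ^ α f + ∫ |h| ^ α g`.

This functional has a unique minimizer on a closed subspace, by uniform convexity of `L^α`
(`exists_unique_minimizer`).  Its first order condition (`dualPairing_eq_of_minimizer`) says that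
`(A - h)^{<α-1>} f - h^{<α-1>} g` is orthogonal to the past, that is, conjugate to a function with
an analytic Fourier series; the vanishing of the coefficients of `h` follows from Hölder's
inequality and the integrability of `(f + g)^{-1/(α-1)}` (`exists_solvesSystem`).

The remaining point is uniqueness for the system (`SolvesSystem.unique`).  If `(h, C)` and
`(h', C')` are solutions, then `(C - C') * conj (h - h')` is integrable, and minus its real part is a
sum of two terms that are nonnegative because `z ↦ conj (z^{<α-1>})` is monotone.  So it is enough
that its integral vanishes.  The Fourier coefficients of the first factor live on the indices `≥ 0`, those
of the second on the indices `≥ 1`; but both factors are only in `L¹`, so the series cannot simply be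
multiplied.  The theorem `IsAnalyticFrom.integral_mul_eq_zero` replaces factorization theory in the
Hardy space `H¹`: for a weight `W = 1 + ε (|F| + |G|)`, the residual `p` of the projection of `1` onto
the span of `e^{ikθ}`, `k ≥ 1`, in `L²(W dθ)` satisfies `|p|² W = const` (`exists_isSzegoFactor`).  So
`p² F` and `p² G` are bounded and still analytic, Parseval's identity gives `∫ p⁴ F G = 0`, and `p → 1`
boundedly as `ε → 0`.
-/

open MeasureTheory ProbabilityTheory Filter Topology
open scoped ComplexConjugate ENNReal

/-! ### Symmetric stable laws and their scale -/

section StableLaws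

noncomputable instance : MeasurableSpace Circle := borel Circle

instance : BorelSpace Circle := ⟨rfl⟩

variable {Ω : Type*} [MeasurableSpace Ω] {P : Measure Ω} {α : ℝ}

/-- The characteristic function `E exp(i Re(conj t * X))` of a complex random variable. -/
noncomputable def chf (P : Measure Ω) (X : Ω → ℂ) (t : ℂ) : ℂ :=
  ∫ ω, Complex.exp (Complex.I * ((conj t * X ω).re : ℂ)) ∂P

/-- `X` is symmetric `α`-stable with `‖X‖_α ^ α = N`.  The spectral measure is taken on the unit
circle `Circle`, is not required to be symmetric, and has total mass `N`. -/
structure HasScale (α : ℝ) (P : Measure Ω) (X : Ω → ℂ) (N : ℝ) : Prop where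
  aemeasurable : AEMeasurable X P
  exists_measure : ∃ Γ : Measure Circle, IsFiniteMeasure Γ ∧ Γ.real Set.univ = N ∧
    ∀ t, chf P X t = ((Real.exp (-∫ z : Circle, |(conj t * (z : ℂ)).re| ^ α ∂Γ) : ℝ) : ℂ)

lemma chf_congr {X Y : Ω → ℂ} (h : X =ᵐ[P] Y) (t : ℂ) : chf P X t = chf P Y t := by
  unfold chf
  apply integral_congr_ae
  filter_upwards [h] with ω hω
  rw [hω]

lemma HasScale.congr {X Y : Ω → ℂ} {N : ℝ} (hX : HasScale α P X N) (h : X =ᵐ[P] Y) :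
    HasScale α P Y N := by
  refine ⟨hX.aemeasurable.congr h, ?_⟩
  obtain ⟨Γ, h1, h2, h3⟩ := hX.exists_measure
  exact ⟨Γ, h1, h2, fun t => by rw [← chf_congr h, h3]⟩

lemma HasScale.nonneg {X : Ω → ℂ} {N : ℝ} (hX : HasScale α P X N) : 0 ≤ N := by
  obtain ⟨Γ, h1, h2, h3⟩ := hX.exists_measure
  rw [← h2]; positivity

lemma norm_mul_circle_exp_arg (z : ℂ) : (‖z‖ : ℂ) * (Circle.exp (Complex.arg z) : ℂ) = z := by
  rw [Circle.coe_exp]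
  exact Complex.norm_mul_exp_arg_mul_I z

lemma norm_re_conj_mul_le (t z : ℂ) : |(conj t * z).re| ≤ ‖t‖ * ‖z‖ := by
  refine (Complex.abs_re_le_norm _).trans ?_
  rw [norm_mul, RCLike.norm_conj]

/-- Radial projection: a representation of the characteristic function by any finite measure and
any `α`-integrable function `v` can be moved to the unit circle, with total mass `∫ ‖v‖ ^ α`. -/
lemma HasScale.of_integral {S : Type*} [MeasurableSpace S] (m : Measure S) {v : S → ℂ}
    (hv : Measurable v) (hα : 0 < α) (hint : Integrable (fun s => ‖v s‖ ^ α) m) {X : Ω → ℂ}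
    (hX : AEMeasurable X P)
    (h : ∀ t, chf P X t = ((Real.exp (-∫ s, |(conj t * v s).re| ^ α ∂m) : ℝ) : ℂ)) :
    HasScale α P X (∫ s, ‖v s‖ ^ α ∂m) := by
  have hpos : ∀ s, 0 ≤ ‖v s‖ ^ α := fun s => by positivity
  have hmeas : Measurable (fun s => ENNReal.ofReal (‖v s‖ ^ α)) := by fun_prop
  have hphase : Measurable (fun s => Circle.exp (Complex.arg (v s))) :=
    Circle.exp.continuous.measurable.comp (Complex.measurable_arg.comp hv)
  refine ⟨hX, (m.withDensity fun s => ENNReal.ofReal (‖v s‖ ^ α)).map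
    (fun s => Circle.exp (Complex.arg (v s))), ?_, ?_, ?_⟩
  · have := isFiniteMeasure_withDensity_ofReal hint.2
    infer_instance
  · rw [measureReal_def, Measure.map_apply hphase MeasurableSet.univ, Set.preimage_univ,
      withDensity_apply _ MeasurableSet.univ, Measure.restrict_univ,
      integral_eq_lintegral_of_nonneg_ae (ae_of_all _ hpos) hint.aestronglyMeasurable]
  · intro t
    rw [h t, integral_map hphase.aemeasurable, integral_withDensity_eq_integral_toReal_smul hmeas]
    · congr 4
      ext s
      rw [ENNReal.toReal_ofReal (hpos s), smul_eq_mul, ← Real.mul_rpow (norm_nonneg _) (abs_nonneg _)]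
      congr 1
      conv_lhs => rw [← norm_mul_circle_exp_arg (v s)]
      rw [mul_left_comm, Complex.re_ofReal_mul, abs_mul, abs_norm]
    · exact ae_of_all _ fun s => ENNReal.ofReal_lt_top
    · apply Continuous.aestronglyMeasurable
      have : Continuous fun z : Circle => |(conj t * (z : ℂ)).re| := by fun_prop
      exact this.rpow_const fun _ => Or.inr hα.le

/-- The constant `∫_0^{2π} |cos φ| ^ α dφ`. -/
noncomputable def cosMoment (α : ℝ) : ℝ := ∫ φ in (0 : ℝ)..(2 * Real.pi), |Real.cos φ| ^ α

lemma continuous_abs_cos_rpow (hα : 0 < α) : Continuous fun φ : ℝ => |Real.cos φ| ^ α :=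
  (Real.continuous_cos.abs).rpow_const fun _ => Or.inr hα.le

lemma cosMoment_pos (hα : 0 < α) : 0 < cosMoment α := by
  apply intervalIntegral.integral_pos (by positivity) (continuous_abs_cos_rpow hα).continuousOn
  · intro x _; positivity
  · exact ⟨0, ⟨le_rfl, by positivity⟩, by simp⟩

lemma re_conj_exp_mul (φ : ℝ) (z : ℂ) :
    (conj (Complex.exp (φ * Complex.I)) * z).re = ‖z‖ * Real.cos (φ - Complex.arg z) := by
  rw [← Complex.exp_conj]
  conv_lhs => rw [← Complex.norm_mul_exp_arg_mul_I z]
  rw [mul_left_comm, ← Complex.exp_add, Complex.re_ofReal_mul]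
  congr 1
  have : conj (φ * Complex.I) + (Complex.arg z) * Complex.I
      = ((-(φ - Complex.arg z) : ℝ) : ℂ) * Complex.I := by
    simp; ring
  rw [this, Complex.exp_ofReal_mul_I_re, Real.cos_neg]

lemma integral_re_conj_exp_rpow (z : ℂ) :
    ∫ φ in (0 : ℝ)..(2 * Real.pi), |(conj (Complex.exp (φ * Complex.I)) * z).re| ^ α
      = cosMoment α * ‖z‖ ^ α := by
  have h1 : ∀ φ : ℝ, |(conj (Complex.exp (φ * Complex.I)) * z).re| ^ α
      = |Real.cos (φ - Complex.arg z)| ^ α * ‖z‖ ^ α := fun φ => by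
    rw [re_conj_exp_mul, abs_mul, abs_norm, Real.mul_rpow (norm_nonneg _) (abs_nonneg _), mul_comm]
  simp_rw [h1]
  rw [intervalIntegral.integral_mul_const,
    intervalIntegral.integral_comp_sub_right (fun φ => |Real.cos φ| ^ α)]
  congr 1
  have hper : Function.Periodic (fun φ : ℝ => |Real.cos φ| ^ α) (2 * Real.pi) := fun φ => by
    simp [Real.cos_add_two_pi]
  have := hper.intervalIntegral_add_eq (0 - Complex.arg z) 0
  rw [zero_add] at this
  rw [show 2 * Real.pi - Complex.arg z = 0 - Complex.arg z + 2 * Real.pi by ring, this, cosMoment]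

/-- The scale is determined by the law: it is an average of `-log` of the characteristic function
over the unit circle. -/
lemma HasScale.cosMoment_mul (hα : 0 < α) {X : Ω → ℂ} {N : ℝ} (hX : HasScale α P X N) :
    cosMoment α * N = ∫ φ in (0 : ℝ)..(2 * Real.pi),
      -Real.log (chf P X (Complex.exp (φ * Complex.I))).re := by
  obtain ⟨Γ, h1, h2, h3⟩ := hX.exists_measure
  simp_rw [h3, Complex.ofReal_re, Real.log_exp, neg_neg]
  rw [intervalIntegral.integral_of_le (by positivity)]
  have hcont : Continuous (fun x : ℝ × Circle =>
      |(conj (Complex.exp (x.1 * Complex.I)) * (x.2 : ℂ)).re| ^ α) := by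
    have : Continuous (fun x : ℝ × Circle =>
      |(conj (Complex.exp (x.1 * Complex.I)) * (x.2 : ℂ)).re|) := by fun_prop
    exact this.rpow_const fun _ => Or.inr hα.le
  rw [integral_integral_swap]
  · have : ∀ z : Circle, ∫ φ in Set.Ioc 0 (2 * Real.pi),
        |(conj (Complex.exp (φ * Complex.I)) * (z : ℂ)).re| ^ α = cosMoment α := fun z => by
      rw [← intervalIntegral.integral_of_le (by positivity), integral_re_conj_exp_rpow,
        Circle.norm_coe, Real.one_rpow, mul_one]
    simp_rw [this]
    rw [integral_const, h2, smul_eq_mul, mul_comm]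
  · refine Integrable.of_bound hcont.aestronglyMeasurable 1 (ae_of_all _ fun x => ?_)
    rw [Function.uncurry, Real.norm_of_nonneg (by positivity)]
    refine Real.rpow_le_one (abs_nonneg _) ?_ hα.le
    refine (norm_re_conj_mul_le _ _).trans ?_
    rw [Complex.norm_exp_ofReal_mul_I, Circle.norm_coe, one_mul]

lemma HasScale.unique (hα : 0 < α) {X : Ω → ℂ} {N N' : ℝ} (h : HasScale α P X N)
    (h' : HasScale α P X N') : N = N' :=
  mul_left_cancel₀ (cosMoment_pos hα).ne' ((h.cosMoment_mul hα).trans (h'.cosMoment_mul hα).symm)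

lemma integrable_of_sphere {ι : Type*} [Fintype ι] {Γ : Measure (EuclideanSpace ℂ ι)}
    [IsFiniteMeasure Γ] (hs : Γ (Metric.sphere 0 1)ᶜ = 0) {F : EuclideanSpace ℂ ι → ℝ}
    (hF : Continuous F) : Integrable F Γ := by
  obtain ⟨C, hC⟩ := (isCompact_sphere (0 : EuclideanSpace ℂ ι) 1).exists_bound_of_continuousOn
    hF.continuousOn
  refine Integrable.of_bound hF.aestronglyMeasurable C ?_
  have : ∀ᵐ x ∂Γ, x ∈ Metric.sphere (0 : EuclideanSpace ℂ ι) 1 := by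
    rw [ae_iff]; exact hs
  filter_upwards [this] with x hx using hC x hx

lemma JointlySaS.exists_hasScale (hα : 0 < α) {ι : Type*} [Fintype ι] {X : ι → Ω → ℂ}
    (hX : JointlySaS α P X) (c : ι → ℂ) : ∃ N, HasScale α P (fun ω => ∑ i, c i * X i ω) N := by
  obtain ⟨hm, Γ, hΓ⟩ := hX
  have := hΓ.finite
  have hc : Continuous (fun x : EuclideanSpace ℂ ι => ∑ i, c i * x i) := by fun_prop
  refine ⟨_, HasScale.of_integral Γ hc.measurable hα
    (integrable_of_sphere hΓ.sphere (hc.norm.rpow_const fun _ => Or.inr hα.le)) (by fun_prop) ?_⟩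
  intro t
  have := hΓ.charFun_eq (fun i => conj (c i) * t)
  simp only [map_mul, Complex.conj_conj] at this
  have h1 : ∀ y : ι → ℂ, ∑ i, c i * conj t * y i = conj t * ∑ i, c i * y i := fun y => by
    rw [Finset.mul_sum]; exact Finset.sum_congr rfl fun i _ => by ring
  simp only [h1] at this
  exact this

/-- A variable repeated along an index type has a spectral measure in the sense of
`IsStableSpectralMeasure`: move the one on the circle to the diagonal and symmetrize it. -/
lemma HasScale.exists_spectralMeasure (hα : 0 < α) {X : Ω → ℂ} {N : ℝ} (hX : HasScale α P X N)
    (ι : Type*) [Fintype ι] [Nonempty ι] :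
    ∃ Γ, IsStableSpectralMeasure α P (fun _ : ι => X) Γ := by
  obtain ⟨Γ, h1, h2, h3⟩ := hX.exists_measure
  set r : ℝ := Real.sqrt (Fintype.card ι) with hr
  have hr0 : 0 < r := Real.sqrt_pos.2 (by exact_mod_cast Fintype.card_pos)
  let e : Circle → EuclideanSpace ℂ ι := fun z => WithLp.toLp 2 (fun _ => (r⁻¹ : ℂ) * (z : ℂ))
  have he : Continuous e := by fun_prop
  have hen : ∀ z, ‖e z‖ = 1 := fun z => by
    rw [EuclideanSpace.norm_eq]
    simp only [e, norm_mul, Circle.norm_coe, mul_one, norm_inv, Complex.norm_real, Finset.sum_const,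
      Finset.card_univ, nsmul_eq_mul]
    rw [Real.norm_of_nonneg hr0.le, inv_pow, hr, Real.sq_sqrt (by positivity),
      mul_inv_cancel₀ (by exact_mod_cast Fintype.card_ne_zero), Real.sqrt_one]
  let ρ : Measure (EuclideanSpace ℂ ι) := ENNReal.ofReal (r ^ α / 2) • Γ.map e
  have hρ : IsFiniteMeasure ρ := by
    have : IsFiniteMeasure (Γ.map e) := by infer_instance
    exact Measure.smul_finite _ ENNReal.ofReal_ne_top
  have hneg : Measurable (fun x : EuclideanSpace ℂ ι => -x) := measurable_neg
  refine ⟨ρ + ρ.map (fun x => -x), inferInstance, ?_, ?_, ?_⟩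
  · have hms : MeasurableSet (Metric.sphere (0 : EuclideanSpace ℂ ι) 1)ᶜ :=
      Metric.isClosed_sphere.measurableSet.compl
    have h0 : ρ (Metric.sphere (0 : EuclideanSpace ℂ ι) 1)ᶜ = 0 := by
      simp only [ρ, Measure.smul_apply, smul_eq_mul, mul_eq_zero]
      right
      rw [Measure.map_apply he.measurable hms]
      convert measure_empty (μ := Γ)
      ext z; simp [hen]
    rw [Measure.add_apply, h0, zero_add, Measure.map_apply hneg hms]
    convert h0 using 2
    ext x; simp
  · rw [Measure.map_add _ _ hneg, Measure.map_map hneg hneg, add_comm]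
    congr 1
    convert Measure.map_id
    ext1 x; simp
  · intro t
    have h4 := h3 (∑ i, t i)
    rw [chf] at h4
    have hcont : Continuous fun x : EuclideanSpace ℂ ι => |(∑ i, conj (t i) * x i).re| ^ α := by
      have : Continuous fun x : EuclideanSpace ℂ ι => |(∑ i, conj (t i) * x i).re| := by fun_prop
      exact this.rpow_const fun _ => Or.inr hα.le
    have hcirc : Continuous fun z : Circle => |(conj (∑ i, t i) * (z : ℂ)).re| ^ α := by
      have : Continuous fun z : Circle => |(conj (∑ i, t i) * (z : ℂ)).re| := by fun_prop
      exact this.rpow_const fun _ => Or.inr hα.le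
    have hval : ∀ z, |(∑ i, conj (t i) * (e z) i).re| ^ α
        = (r ^ α)⁻¹ * |(conj (∑ i, t i) * (z : ℂ)).re| ^ α := fun z => by
      have : ∑ i, conj (t i) * (e z) i = ((r⁻¹ : ℝ) : ℂ) * (conj (∑ i, t i) * (z : ℂ)) := by
        simp only [e, map_sum, Finset.sum_mul, Finset.mul_sum, Complex.ofReal_inv]
        congr! 1 with i; ring
      rw [this, Complex.re_ofReal_mul, abs_mul, Real.mul_rpow (abs_nonneg _) (abs_nonneg _),
        abs_of_pos (inv_pos.2 hr0), Real.inv_rpow hr0.le]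
    have hint : Integrable (fun x => |(∑ i, conj (t i) * x i).re| ^ α) ρ := by
      refine ((integrable_map_measure hcont.aestronglyMeasurable he.measurable.aemeasurable).2
        ?_).smul_measure ENNReal.ofReal_ne_top
      change Integrable (fun z : Circle => |(∑ i, conj (t i) * (e z) i).re| ^ α) Γ
      simp_rw [hval]
      exact (hcirc.integrable_of_hasCompactSupport
        (HasCompactSupport.of_compactSpace _)).const_mul _
    have hρi : ∫ x, |(∑ i, conj (t i) * x i).re| ^ α ∂ρ
        = 2⁻¹ * ∫ z : Circle, |(conj (∑ i, t i) * (z : ℂ)).re| ^ α ∂Γ := by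
      rw [integral_smul_measure, integral_map he.measurable.aemeasurable
        hcont.aestronglyMeasurable]
      simp_rw [hval]
      rw [integral_const_mul, smul_eq_mul, ENNReal.toReal_ofReal (by positivity)]
      have : r ^ α ≠ 0 := by positivity
      field_simp
    have hρi' : ∫ x, |(∑ i, conj (t i) * x i).re| ^ α ∂(ρ.map (fun x => -x))
        = ∫ x, |(∑ i, conj (t i) * x i).re| ^ α ∂ρ := by
      rw [integral_map hneg.aemeasurable hcont.aestronglyMeasurable]
      congr! 2 with x
      simp [Finset.sum_neg_distrib]
    rw [integral_add_measure, hρi', hρi, ← add_mul]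
    · rw [show (2⁻¹ + 2⁻¹ : ℝ) = 1 by norm_num, one_mul, ← h4]
      simp only [map_sum, Finset.sum_mul]
    · exact hint
    · rw [integrable_map_measure hcont.aestronglyMeasurable hneg.aemeasurable]
      refine hint.congr (ae_of_all _ fun x => ?_)
      simp only [Function.comp, PiLp.neg_apply, mul_neg, Finset.sum_neg_distrib, Complex.neg_re,
        abs_neg]

lemma HasScale.isSaS (hα : 0 < α) {X : Ω → ℂ} {N : ℝ} (hX : HasScale α P X N) : IsSaS α P X :=
  ⟨fun _ => hX.aemeasurable, hX.exists_spectralMeasure hα (Fin 1)⟩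

lemma mul_signedPow_self (hα : 1 < α) (z : ℂ) : z * signedPow (α - 1) z = ((‖z‖ ^ α : ℝ) : ℂ) := by
  rw [signedPow, mul_left_comm, Complex.mul_conj, ← Complex.ofReal_mul, Complex.normSq_eq_norm_sq]
  congr 1
  rcases eq_or_ne z 0 with rfl | hz
  · simp [Real.zero_rpow (by linarith : α ≠ 0)]
  · have : 0 < ‖z‖ := norm_pos_iff.2 hz
    rw [← Real.rpow_natCast, ← Real.rpow_add this]
    congr 1; push_cast; ring

/-- A linear relation between the variables holds almost everywhere for a spectral measure. -/
lemma IsStableSpectralMeasure.ae_re_eq_zero [IsProbabilityMeasure P] {ι : Type*} [Fintype ι] (hα : 0 < α)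
    {X : ι → Ω → ℂ} {Γ : Measure (EuclideanSpace ℂ ι)} (hΓ : IsStableSpectralMeasure α P X Γ)
    (t : ι → ℂ) (ht : ∀ ω, ∑ i, conj (t i) * X i ω = 0) :
    ∀ᵐ x ∂Γ, (∑ i, conj (t i) * x i).re = 0 := by
  have := hΓ.finite
  have h := hΓ.charFun_eq t
  simp only [ht, Complex.zero_re, Complex.ofReal_zero, mul_zero, Complex.exp_zero, integral_const,
    probReal_univ, one_smul] at h
  have h1 : Real.exp (-∫ x, |(∑ i, conj (t i) * x i).re| ^ α ∂Γ) = 1 := by exact_mod_cast h.symm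
  rw [Real.exp_eq_one_iff, neg_eq_zero, integral_eq_zero_iff_of_nonneg] at h1
  · filter_upwards [h1] with x hx
    have := (Real.rpow_eq_zero (abs_nonneg _) hα.ne').1 hx
    exact abs_eq_zero.1 this
  · intro x; positivity
  · have : Continuous fun x : EuclideanSpace ℂ ι => |(∑ i, conj (t i) * x i).re| := by fun_prop
    exact integrable_of_sphere hΓ.sphere (this.rpow_const fun _ => Or.inr hα.le)

lemma IsStableSpectralMeasure.hasScale_fst (hα : 0 < α) {X Y : Ω → ℂ} (hX : AEMeasurable X P)
    {Γ : Measure (EuclideanSpace ℂ (Fin 2))} (hΓ : IsStableSpectralMeasure α P ![X, Y] Γ) :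
    HasScale α P X (∫ z : EuclideanSpace ℂ (Fin 2), ‖z 0‖ ^ α ∂Γ) := by
  have := hΓ.finite
  have hc : Continuous (fun x : EuclideanSpace ℂ (Fin 2) => x 0) := by fun_prop
  refine HasScale.of_integral Γ hc.measurable hα
    (integrable_of_sphere hΓ.sphere (hc.norm.rpow_const fun _ => Or.inr hα.le)) hX fun t => ?_
  have := hΓ.charFun_eq ![t, 0]
  simpa [Fin.sum_univ_two, chf] using this

/-- Any spectral measure of the pair `(X, X)` lives on the diagonal, so that the covariation of `X`
with itself is its scale. -/
lemma HasScale.covariation_self [IsProbabilityMeasure P] (hα : 1 < α) {X : Ω → ℂ} {N : ℝ}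
    (hX : HasScale α P X N) : covariation α P X X = N := by
  have hα0 : 0 < α := by linarith
  have hex : ∃ Γ, IsStableSpectralMeasure α P ![X, X] Γ := by
    obtain ⟨Γ, hΓ⟩ := hX.exists_spectralMeasure hα0 (Fin 2)
    refine ⟨Γ, ?_⟩
    convert hΓ using 1
    ext i; fin_cases i <;> rfl
  rw [covariation, dif_pos hex]
  have hΓ := hex.choose_spec
  set Γ := hex.choose
  have h1 := IsStableSpectralMeasure.ae_re_eq_zero hα0 hΓ ![1, -1] (fun ω => by simp [Fin.sum_univ_two])
  have h2 := IsStableSpectralMeasure.ae_re_eq_zero hα0 hΓ ![Complex.I, -Complex.I]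
    (fun ω => by simp [Fin.sum_univ_two])
  have h3 : ∀ᵐ x ∂Γ, x 0 * signedPow (α - 1) (x 1) = ((‖x 0‖ ^ α : ℝ) : ℂ) := by
    filter_upwards [h1, h2] with x hx1 hx2
    have : x 1 = x 0 := by
      simp [Fin.sum_univ_two] at hx1 hx2
      apply Complex.ext <;> linarith
    rw [this, mul_signedPow_self hα]
  rw [integral_congr_ae h3, integral_complex_ofReal,
    hX.unique hα0 (hΓ.hasScale_fst hα0 hX.aemeasurable)]

lemma HasScale.saSNorm_eq [IsProbabilityMeasure P] (hα : 1 < α) {X : Ω → ℂ} {N : ℝ}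
    (hX : HasScale α P X N) : saSNorm α P X = N ^ (1 / α) := by
  rw [saSNorm, hX.covariation_self hα, Complex.ofReal_re]

lemma HasScale.saSNorm_rpow [IsProbabilityMeasure P] (hα : 1 < α) {X : Ω → ℂ} {N : ℝ}
    (hX : HasScale α P X N) : saSNorm α P X ^ α = N := by
  rw [hX.saSNorm_eq hα, ← Real.rpow_mul hX.nonneg, one_div_mul_cancel (by linarith), Real.rpow_one]

lemma IsSaS.hasScale [IsProbabilityMeasure P] (hα : 1 < α) {X : Ω → ℂ} (hX : IsSaS α P X) :
    HasScale α P X (saSNorm α P X ^ α) := by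
  obtain ⟨N, hN⟩ := JointlySaS.exists_hasScale (by linarith) hX (fun _ => 1)
  have hN' : HasScale α P X N := by simpa using hN
  rwa [hN'.saSNorm_rpow hα]

end StableLaws

/-! ### Linear combinations and first moments of stable variables -/

section StableLaws

variable {Ω : Type*} [MeasurableSpace Ω] {P : Measure Ω} {α : ℝ}

lemma continuous_circle_rpow (hα : 0 < α) (t : ℂ) :
    Continuous fun z : Circle => |(conj t * (z : ℂ)).re| ^ α := by
  have : Continuous fun z : Circle => |(conj t * (z : ℂ)).re| := by fun_prop
  exact this.rpow_const fun _ => Or.inr hα.le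

lemma integrable_circle_rpow (hα : 0 < α) (t : ℂ) (Γ : Measure Circle) [IsFiniteMeasure Γ] :
    Integrable (fun z : Circle => |(conj t * (z : ℂ)).re| ^ α) Γ :=
  (continuous_circle_rpow hα t).integrable_of_hasCompactSupport (HasCompactSupport.of_compactSpace _)

lemma HasScale.const_mul (hα : 0 < α) {X : Ω → ℂ} {N : ℝ} (hX : HasScale α P X N) (c : ℂ) :
    HasScale α P (fun ω => c * X ω) (‖c‖ ^ α * N) := by
  obtain ⟨Γ, h1, h2, h3⟩ := hX.exists_measure
  have hn : ∀ z : Circle, ‖c * (z : ℂ)‖ ^ α = ‖c‖ ^ α := fun z => by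
    rw [norm_mul, Circle.norm_coe, mul_one]
  have h := HasScale.of_integral (P := P) (α := α) Γ (v := fun z : Circle => c * (z : ℂ))
    (X := fun ω => c * X ω) (by fun_prop) hα (by simp only [hn]; exact integrable_const _)
    (hX.aemeasurable.const_mul c) fun t => ?_
  · simp only [hn] at h
    rwa [integral_const, h2, smul_eq_mul, mul_comm] at h
  · have := h3 (conj c * t)
    have e : ∀ x : ℂ, c * conj t * x = conj t * (c * x) := fun x => by ring
    simp only [chf, map_mul, Complex.conj_conj, e] at this ⊢
    exact this

/-- A finite product of symmetric stable characteristic functions is of the same kind, the scales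
being added. -/
lemma exists_measure_prod (hα : 0 < α) {ι : Type*} (s : Finset ι) (φ : ι → ℂ → ℂ) (N : ι → ℝ)
    (h : ∀ i ∈ s, ∃ Γ : Measure Circle, IsFiniteMeasure Γ ∧ Γ.real Set.univ = N i ∧
      ∀ t, φ i t = ((Real.exp (-∫ z : Circle, |(conj t * (z : ℂ)).re| ^ α ∂Γ) : ℝ) : ℂ)) :
    ∃ Γ : Measure Circle, IsFiniteMeasure Γ ∧ Γ.real Set.univ = ∑ i ∈ s, N i ∧
      ∀ t, ∏ i ∈ s, φ i t
        = ((Real.exp (-∫ z : Circle, |(conj t * (z : ℂ)).re| ^ α ∂Γ) : ℝ) : ℂ) := by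
  classical
  induction s using Finset.induction_on with
  | empty => exact ⟨0, inferInstance, by simp, by simp⟩
  | insert i s hi ih =>
    obtain ⟨Γ, h1, h2, h3⟩ := h i (Finset.mem_insert_self _ _)
    obtain ⟨Γ', h1', h2', h3'⟩ := ih fun j hj => h j (Finset.mem_insert_of_mem hj)
    refine ⟨Γ + Γ', inferInstance, ?_, fun t => ?_⟩
    · rw [Finset.sum_insert hi, measureReal_add_apply, h2, h2']
    · rw [Finset.prod_insert hi, h3, h3', ← Complex.ofReal_mul, ← Real.exp_add,
        integral_add_measure (integrable_circle_rpow hα t Γ) (integrable_circle_rpow hα t Γ'),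
        neg_add]

lemma HasScale.sum_of_iIndepFun [IsProbabilityMeasure P] (hα : 0 < α) {ι : Type*} [Fintype ι]
    {X : ι → Ω → ℂ} {N : ι → ℝ} (hX : ∀ i, HasScale α P (X i) (N i)) (hind : iIndepFun X P) :
    HasScale α P (fun ω => ∑ i, X i ω) (∑ i, N i) := by
  refine ⟨Finset.aemeasurable_fun_sum _ fun i _ => (hX i).aemeasurable, ?_⟩
  obtain ⟨Γ, h1, h2, h3⟩ := exists_measure_prod hα Finset.univ (fun i => chf P (X i)) N
    fun i _ => (hX i).exists_measure
  refine ⟨Γ, h1, h2, fun t => ?_⟩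
  rw [← h3]
  simp only [chf]
  rw [← hind.integral_fun_prod_comp (f := fun _ x => Complex.exp (Complex.I * ((conj t * x).re : ℂ)))
    (fun i => (hX i).aemeasurable)
    (fun i => Continuous.aestronglyMeasurable (by fun_prop))]
  congr 1; ext ω
  rw [← Complex.exp_sum, Finset.mul_sum, Complex.re_sum, Complex.ofReal_sum, Finset.mul_sum]

lemma HasScale.add_of_indepFun [IsProbabilityMeasure P] (hα : 0 < α) {X Y : Ω → ℂ} {N M : ℝ}
    (hX : HasScale α P X N) (hY : HasScale α P Y M) (hind : IndepFun X Y P) :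
    HasScale α P (X + Y) (N + M) := by
  refine ⟨hX.aemeasurable.add hY.aemeasurable, ?_⟩
  obtain ⟨Γ, h1, h2, h3⟩ := hX.exists_measure
  obtain ⟨Γ', h1', h2', h3'⟩ := hY.exists_measure
  refine ⟨Γ + Γ', inferInstance, by rw [measureReal_add_apply, h2, h2'], fun t => ?_⟩
  rw [integral_add_measure (integrable_circle_rpow hα t Γ) (integrable_circle_rpow hα t Γ'),
    neg_add, Real.exp_add, Complex.ofReal_mul, ← h3, ← h3']
  simp only [chf]
  have hc : Continuous fun x : ℂ => Complex.exp (Complex.I * ((conj t * x).re : ℂ)) := by fun_prop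
  rw [← hind.integral_fun_comp_mul_comp hX.aemeasurable hY.aemeasurable
    hc.aestronglyMeasurable hc.aestronglyMeasurable]
  congr 1; ext ω
  rw [← Complex.exp_add, Pi.add_apply, mul_add, Complex.add_re, Complex.ofReal_add, mul_add]

/-- The integral `∫_0^∞ (1 - cos (s r)) / s² ds` dominates a multiple of `|r|`; the part of it with
`1 ≤ s |r| ≤ 2` suffices. -/
lemma mul_enorm_le_lintegral (r : ℝ) :
    ENNReal.ofReal ((1 - Real.cos 1) / 4) * ‖r‖ₑ
      ≤ ∫⁻ s in Set.Ioi (0 : ℝ), ENNReal.ofReal ((1 - Real.cos (s * r)) / s ^ 2) := by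
  rcases eq_or_ne r 0 with rfl | hr
  · simp
  have hr' : 0 < |r| := abs_pos.2 hr
  calc ENNReal.ofReal ((1 - Real.cos 1) / 4) * ‖r‖ₑ
      = ∫⁻ s in Set.Icc (1 / |r|) (2 / |r|), ENNReal.ofReal ((1 - Real.cos 1) / 4 * |r| ^ 2) := by
        rw [setLIntegral_const, Real.volume_Icc, ← ENNReal.ofReal_mul (by
          have := Real.cos_le_one 1
          exact mul_nonneg (by linarith) (by positivity)), Real.enorm_eq_ofReal_abs,
          ← ENNReal.ofReal_mul (by have := Real.cos_le_one 1; linarith)]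
        congr 1
        field_simp; ring
    _ ≤ ∫⁻ s in Set.Icc (1 / |r|) (2 / |r|), ENNReal.ofReal ((1 - Real.cos (s * r)) / s ^ 2) := by
        apply setLIntegral_mono' measurableSet_Icc
        intro s hs
        apply ENNReal.ofReal_le_ofReal
        have hs0 : 0 < s := lt_of_lt_of_le (by positivity) hs.1
        have h1 : 1 ≤ s * |r| := (div_le_iff₀ hr').1 hs.1
        have h2 : s * |r| ≤ 2 := (le_div_iff₀ hr').1 hs.2
        have h3 : Real.cos (s * r) ≤ Real.cos 1 := by
          rw [← Real.cos_abs (s * r), abs_mul, abs_of_pos hs0]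
          exact Real.cos_le_cos_of_nonneg_of_le_pi (by norm_num)
            (h2.trans (by linarith [Real.pi_gt_three])) h1
        rw [le_div_iff₀ (by positivity)]
        have h4 : (s * |r|) ^ 2 ≤ 4 := by nlinarith
        nlinarith [Real.cos_le_one 1]
    _ ≤ _ := lintegral_mono_set fun s hs => lt_of_lt_of_le (by positivity : 0 < 1 / |r|) hs.1

/-- A constant `K` with `E |X| ≤ K ‖X‖_α`, for real `X`. -/
noncomputable def momentConst (α : ℝ) : ℝ := (1 / (α - 1) + 2) / ((1 - Real.cos 1) / 4)

lemma one_sub_cos_one_pos : 0 < (1 - Real.cos 1) / 4 := by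
  have := Real.cos_one_le
  linarith

lemma momentConst_pos (hα : 1 < α) : 0 < momentConst α := by
  have : 0 < α - 1 := by linarith
  have := one_sub_cos_one_pos
  unfold momentConst; positivity

lemma lintegral_min_rpow_le (hα : 1 < α) {N : ℝ} (hN : 0 < N) :
    ∫⁻ s in Set.Ioi (0 : ℝ), ENNReal.ofReal (min (N * s ^ α) 2 / s ^ 2)
      ≤ ENNReal.ofReal ((1 / (α - 1) + 2) * N ^ (1 / α)) := by
  have hα1 : 0 < α - 1 := by linarith
  set s₀ : ℝ := N ^ (-(1 / α)) with hs
  have hs0 : 0 < s₀ := Real.rpow_pos_of_pos hN _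
  have e1 : N * s₀ ^ (α - 1) = N ^ (1 / α) := by
    rw [hs, ← Real.rpow_mul hN.le]
    nth_rewrite 1 [← Real.rpow_one N]
    rw [← Real.rpow_add hN]
    congr 1; field_simp; ring
  have e2 : s₀⁻¹ = N ^ (1 / α) := by rw [hs, Real.rpow_neg hN.le, inv_inv]
  rw [← Set.Ioc_union_Ioi_eq_Ioi hs0.le, lintegral_union measurableSet_Ioi
    (Set.Ioc_disjoint_Ioi le_rfl), add_mul, ENNReal.ofReal_add (by positivity) (by positivity)]
  gcongr
  · calc ∫⁻ s in Set.Ioc 0 s₀, ENNReal.ofReal (min (N * s ^ α) 2 / s ^ 2)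
        ≤ ∫⁻ s in Set.Ioc 0 s₀, ENNReal.ofReal (N * s ^ (α - 2)) := by
          apply setLIntegral_mono' measurableSet_Ioc
          intro s hs
          apply ENNReal.ofReal_le_ofReal
          rw [Real.rpow_sub hs.1, ← mul_div_assoc, Real.rpow_two]
          gcongr
          exact min_le_left _ _
      _ = ENNReal.ofReal (∫ s in Set.Ioc 0 s₀, N * s ^ (α - 2)) := by
          rw [ofReal_integral_eq_lintegral_ofReal]
          · have := (intervalIntegral.intervalIntegrable_rpow' (a := 0) (b := s₀)
              (by linarith : -1 < α - 2)).const_mul N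
            exact (intervalIntegrable_iff_integrableOn_Ioc_of_le hs0.le).1 this
          · filter_upwards [ae_restrict_mem measurableSet_Ioc] with s hs
            have := hs.1
            simp only [Pi.zero_apply]; positivity
      _ = _ := by
          rw [← intervalIntegral.integral_of_le hs0.le, intervalIntegral.integral_const_mul,
            integral_rpow (Or.inl (by linarith)), show α - 2 + 1 = α - 1 by ring,
            Real.zero_rpow hα1.ne', sub_zero, ← mul_div_assoc, e1]
          congr 1; ring
  · calc ∫⁻ s in Set.Ioi s₀, ENNReal.ofReal (min (N * s ^ α) 2 / s ^ 2)
        ≤ ∫⁻ s in Set.Ioi s₀, ENNReal.ofReal (2 * s ^ (-2 : ℝ)) := by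
          apply setLIntegral_mono' measurableSet_Ioi
          intro s hs
          have hs' : 0 < s := hs0.trans hs
          apply ENNReal.ofReal_le_ofReal
          rw [Real.rpow_neg hs'.le, Real.rpow_two, ← div_eq_mul_inv]
          gcongr
          exact min_le_right _ _
      _ = ENNReal.ofReal (∫ s in Set.Ioi s₀, 2 * s ^ (-2 : ℝ)) := by
          rw [ofReal_integral_eq_lintegral_ofReal]
          · exact (integrableOn_Ioi_rpow_of_lt (by norm_num) hs0).const_mul 2
          · filter_upwards [ae_restrict_mem measurableSet_Ioi] with s hs
            have := hs0.trans hs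
            simp only [Pi.zero_apply]; positivity
      _ ≤ _ := by
          rw [integral_const_mul, integral_Ioi_rpow_of_lt (by norm_num) hs0, ← e2]
          norm_num [Real.rpow_neg_one]

/-- The first moment of a real variable in terms of its characteristic function: integrate the
formula of `mul_enorm_le_lintegral` and use `1 - E cos (s R) ≤ min (N s ^ α) 2`. -/
lemma lintegral_enorm_le_of_cos [IsProbabilityMeasure P] (hα : 1 < α) {R : Ω → ℝ}
    (hR : AEMeasurable R P) {N : ℝ} (hN : 0 < N)
    (h : ∀ s : ℝ, 0 < s → 1 - ∫ ω, Real.cos (s * R ω) ∂P ≤ N * s ^ α) :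
    ∫⁻ ω, ‖R ω‖ₑ ∂P ≤ ENNReal.ofReal (momentConst α * N ^ (1 / α)) := by
  have hc0 := one_sub_cos_one_pos
  have key : ENNReal.ofReal ((1 - Real.cos 1) / 4) * ∫⁻ ω, ‖R ω‖ₑ ∂P
      ≤ ENNReal.ofReal ((1 / (α - 1) + 2) * N ^ (1 / α)) := by
    calc ENNReal.ofReal ((1 - Real.cos 1) / 4) * ∫⁻ ω, ‖R ω‖ₑ ∂P
        = ∫⁻ ω, ENNReal.ofReal ((1 - Real.cos 1) / 4) * ‖R ω‖ₑ ∂P := by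
          rw [lintegral_const_mul' _ _ ENNReal.ofReal_ne_top]
      _ ≤ ∫⁻ ω, (∫⁻ s in Set.Ioi (0 : ℝ), ENNReal.ofReal ((1 - Real.cos (s * R ω)) / s ^ 2)) ∂P :=
          lintegral_mono fun ω => mul_enorm_le_lintegral _
      _ = ∫⁻ s in Set.Ioi (0 : ℝ), ∫⁻ ω, ENNReal.ofReal ((1 - Real.cos (s * R ω)) / s ^ 2) ∂P := by
          apply lintegral_lintegral_swap
          have h1 : AEMeasurable (fun x : Ω × ℝ => R x.1)
            (P.prod (volume.restrict (Set.Ioi (0 : ℝ)))) := hR.comp_fst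
          have h2 : AEMeasurable (fun x : Ω × ℝ => x.2)
            (P.prod (volume.restrict (Set.Ioi (0 : ℝ)))) := measurable_snd.aemeasurable
          have h3 := Real.measurable_cos.comp_aemeasurable (h2.mul h1)
          exact ((h3.const_sub 1).div (h2.pow_const 2)).ennreal_ofReal
      _ ≤ ∫⁻ s in Set.Ioi (0 : ℝ), ENNReal.ofReal (min (N * s ^ α) 2 / s ^ 2) := by
          apply setLIntegral_mono' measurableSet_Ioi
          intro s hs
          have hs' : (0 : ℝ) < s := hs
          have hi : Integrable (fun ω => Real.cos (s * R ω)) P :=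
            Integrable.of_bound (Real.measurable_cos.comp_aemeasurable
              (hR.const_mul s)).aestronglyMeasurable 1 (ae_of_all _ fun ω => Real.abs_cos_le_one _)
          have hi' : Integrable (fun ω => (1 - Real.cos (s * R ω)) / s ^ 2) P :=
            ((integrable_const 1).sub hi).div_const _
          rw [← ofReal_integral_eq_lintegral_ofReal hi' (ae_of_all _ fun ω =>
            div_nonneg (by linarith [Real.cos_le_one (s * R ω)]) (by positivity))]
          apply ENNReal.ofReal_le_ofReal
          rw [integral_div, integral_sub (integrable_const 1) hi]
          simp only [integral_const, probReal_univ, one_smul]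
          gcongr
          refine le_min (h s hs) ?_
          have : -1 ≤ ∫ ω, Real.cos (s * R ω) ∂P := by
            have := integral_mono (μ := P) (integrable_const (-1 : ℝ)) hi
              fun ω => Real.neg_one_le_cos _
            simpa using this
          linarith
      _ ≤ _ := lintegral_min_rpow_le hα hN
  have h1 : (1 / (α - 1) + 2) * N ^ (1 / α)
      = ((1 - Real.cos 1) / 4) * (momentConst α * N ^ (1 / α)) := by
    rw [momentConst, ← mul_assoc, mul_div_cancel₀ _ hc0.ne']
  rw [h1, ENNReal.ofReal_mul hc0.le] at key
  exact (ENNReal.mul_le_mul_iff_right (by simpa using hc0) ENNReal.ofReal_ne_top).1 key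

lemma HasScale.lintegral_enorm_re_le [IsProbabilityMeasure P] (hα : 1 < α) {X : Ω → ℂ} {N : ℝ}
    (hX : HasScale α P X N) {u : ℂ} (hu : ‖u‖ = 1) :
    ∫⁻ ω, ‖(conj u * X ω).re‖ₑ ∂P ≤ ENNReal.ofReal (momentConst α * N ^ (1 / α)) := by
  have hα0 : 0 < α := by linarith
  have hN := hX.nonneg
  obtain ⟨Γ, h1, h2, h3⟩ := hX.exists_measure
  have hR : AEMeasurable (fun ω => (conj u * X ω).re) P :=
    Complex.measurable_re.comp_aemeasurable (hX.aemeasurable.const_mul _)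
  have hcos : ∀ s : ℝ, 0 < s → 1 - ∫ ω, Real.cos (s * (conj u * X ω).re) ∂P ≤ N * s ^ α := by
    intro s hs
    have h4 := h3 (s * u)
    have hre : ∀ ω, Complex.exp (Complex.I * ((conj (s * u) * X ω).re : ℂ))
        = Complex.exp (((s * (conj u * X ω).re : ℝ) : ℂ) * Complex.I) := fun ω => by
      rw [map_mul, Complex.conj_ofReal, mul_assoc, Complex.re_ofReal_mul, mul_comm]
    simp only [chf, hre] at h4
    have hint : Integrable (fun ω =>
        Complex.exp (((s * (conj u * X ω).re : ℝ) : ℂ) * Complex.I)) P := by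
      refine Integrable.of_bound ?_ 1 (ae_of_all _ fun ω => (Complex.norm_exp_ofReal_mul_I _).le)
      have : Continuous fun x : ℝ => Complex.exp ((x : ℂ) * Complex.I) := by fun_prop
      exact (this.measurable.comp_aemeasurable (hR.const_mul s)).aestronglyMeasurable
    have h5 := congrArg Complex.re h4
    rw [← Complex.reCLM_apply, ← ContinuousLinearMap.integral_comp_comm _ hint] at h5
    simp only [Complex.reCLM_apply, Complex.exp_ofReal_mul_I_re, Complex.ofReal_re] at h5
    rw [h5]
    have h6 : ∫ z : Circle, |(conj (s * u) * (z : ℂ)).re| ^ α ∂Γ ≤ N * s ^ α := by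
      calc ∫ z : Circle, |(conj (s * u) * (z : ℂ)).re| ^ α ∂Γ ≤ ∫ z : Circle, s ^ α ∂Γ := by
            apply integral_mono (integrable_circle_rpow hα0 _ Γ) (integrable_const _)
            intro z
            apply Real.rpow_le_rpow (abs_nonneg _) _ hα0.le
            refine (norm_re_conj_mul_le _ _).trans ?_
            rw [norm_mul, hu, Circle.norm_coe, Complex.norm_of_nonneg hs.le, mul_one, mul_one]
        _ = N * s ^ α := by rw [integral_const, h2, smul_eq_mul]
    have := Real.add_one_le_exp (-∫ z : Circle, |(conj (s * u) * (z : ℂ)).re| ^ α ∂Γ)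
    linarith
  have hlim : Tendsto (fun M : ℝ => ENNReal.ofReal (momentConst α * M ^ (1 / α))) (𝓝[>] N)
      (𝓝 (ENNReal.ofReal (momentConst α * N ^ (1 / α)))) := by
    have : Continuous fun M : ℝ => ENNReal.ofReal (momentConst α * M ^ (1 / α)) :=
      ENNReal.continuous_ofReal.comp (continuous_const.mul
        (Real.continuous_rpow_const (by positivity)))
    exact this.continuousWithinAt
  refine ge_of_tendsto hlim ?_
  filter_upwards [self_mem_nhdsWithin] with M hM
  have hM' : N < M := hM
  refine lintegral_enorm_le_of_cos hα hR (hN.trans_lt hM') fun s hs => (hcos s hs).trans ?_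
  gcongr

/-- First moments are controlled by the scale; this needs `1 < α`. -/
lemma HasScale.lintegral_enorm_le [IsProbabilityMeasure P] (hα : 1 < α) {X : Ω → ℂ} {N : ℝ}
    (hX : HasScale α P X N) :
    ∫⁻ ω, ‖X ω‖ₑ ∂P ≤ ENNReal.ofReal (2 * momentConst α * N ^ (1 / α)) := by
  have hN := hX.nonneg
  have hK := momentConst_pos hα
  have h1 := hX.lintegral_enorm_re_le hα (u := 1) (by simp)
  have h2 := hX.lintegral_enorm_re_le hα (u := Complex.I) (by simp)
  calc ∫⁻ ω, ‖X ω‖ₑ ∂P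
      ≤ ∫⁻ ω, (‖(conj 1 * X ω).re‖ₑ + ‖(conj Complex.I * X ω).re‖ₑ) ∂P := by
        apply lintegral_mono fun ω => ?_
        rw [← ofReal_norm, ← ofReal_norm, ← ofReal_norm,
          ← ENNReal.ofReal_add (norm_nonneg _) (norm_nonneg _)]
        apply ENNReal.ofReal_le_ofReal
        simpa using Complex.norm_le_abs_re_add_abs_im (X ω)
    _ = ∫⁻ ω, ‖(conj 1 * X ω).re‖ₑ ∂P + ∫⁻ ω, ‖(conj Complex.I * X ω).re‖ₑ ∂P :=
        lintegral_add_left' ((Complex.measurable_re.comp_aemeasurable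
          (hX.aemeasurable.const_mul _)).enorm) _
    _ ≤ _ := by
        refine (add_le_add h1 h2).trans ?_
        rw [← ENNReal.ofReal_add (by positivity) (by positivity)]
        apply le_of_eq; congr 1; ring

lemma HasScale.memLp_one [IsProbabilityMeasure P] (hα : 1 < α) {X : Ω → ℂ} {N : ℝ}
    (hX : HasScale α P X N) : MemLp X 1 P :=
  memLp_one_iff_integrable.2 ⟨hX.aemeasurable.aestronglyMeasurable,
    (hX.lintegral_enorm_le hα).trans_lt ENNReal.ofReal_lt_top⟩

lemma enorm_chf_sub_le {X Y : Ω → ℂ} [IsFiniteMeasure P] (hX : AEMeasurable X P)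
    (hY : AEMeasurable Y P) (t : ℂ) :
    ‖chf P X t - chf P Y t‖ₑ ≤ ‖t‖ₑ * ∫⁻ ω, ‖X ω - Y ω‖ₑ ∂P := by
  have hc : Continuous fun x : ℂ => Complex.exp (Complex.I * ((conj t * x).re : ℂ)) := by fun_prop
  have hi : ∀ Z : Ω → ℂ, AEMeasurable Z P →
      Integrable (fun ω => Complex.exp (Complex.I * ((conj t * Z ω).re : ℂ))) P := fun Z hZ => by
    refine Integrable.of_bound (hc.measurable.comp_aemeasurable hZ).aestronglyMeasurable 1
      (ae_of_all _ fun ω => ?_)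
    rw [mul_comm, Complex.norm_exp_ofReal_mul_I]
  rw [chf, chf, ← integral_sub (hi X hX) (hi Y hY), ← lintegral_const_mul' _ _ enorm_ne_top]
  refine (enorm_integral_le_lintegral_enorm _).trans (lintegral_mono fun ω => ?_)
  rw [← ofReal_norm, ← ofReal_norm, ← ofReal_norm,
    ← ENNReal.ofReal_mul (norm_nonneg _)]
  apply ENNReal.ofReal_le_ofReal
  have h1 : Complex.exp (Complex.I * ((conj t * X ω).re : ℂ))
      - Complex.exp (Complex.I * ((conj t * Y ω).re : ℂ))
      = Complex.exp (Complex.I * ((conj t * Y ω).re : ℂ))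
        * (Complex.exp (Complex.I * ((conj t * (X ω - Y ω)).re : ℂ)) - 1) := by
    rw [mul_sub, ← Complex.exp_add, mul_one, mul_sub (conj t), Complex.sub_re]
    congr 2; push_cast; ring
  rw [h1, norm_mul, mul_comm Complex.I, Complex.norm_exp_ofReal_mul_I, one_mul]
  refine (Real.norm_exp_I_mul_ofReal_sub_one_le).trans ?_
  rw [Real.norm_eq_abs]
  exact norm_re_conj_mul_le _ _

end StableLaws

/-! ### Closedness of stable laws under convergence in mean -/

section StableLaws

variable {Ω : Type*} [MeasurableSpace Ω] {P : Measure Ω} {α : ℝ}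

/-- A bound on the scale of `X` in terms of the first moment: where the characteristic function
stays above `1 / 2`, its logarithm is bounded. -/
lemma HasScale.le_of_lintegral_lt [IsProbabilityMeasure P] (hα : 0 < α) {X : Ω → ℂ} {N : ℝ}
    (hX : HasScale α P X N) {E : ℝ} (hE : 0 < E) (h : ∫⁻ ω, ‖X ω‖ₑ ∂P ≤ ENNReal.ofReal E) :
    N ≤ 2 * Real.pi * Real.log 2 / cosMoment α * (2 * E) ^ α := by
  set r : ℝ := (2 * E)⁻¹ with hr
  have hr0 : 0 < r := by positivity
  have h1 := (hX.const_mul hα r).cosMoment_mul hα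
  rw [Complex.norm_of_nonneg hr0.le] at h1
  have h2 : ∀ t : ℂ, ‖t‖ = 1 → -Real.log (chf P (fun ω => r * X ω) t).re ≤ Real.log 2 := by
    intro t ht
    have h3 := enorm_chf_sub_le (P := P) (X := fun ω => r * X ω) (Y := fun _ => 0)
      (hX.aemeasurable.const_mul _) aemeasurable_const t
    have h0 : chf P (fun _ => 0) t = 1 := by simp [chf]
    have h4 : ‖chf P (fun ω => r * X ω) t - 1‖ₑ ≤ ENNReal.ofReal (1 / 2) := by
      rw [h0] at h3
      refine h3.trans ?_
      simp only [sub_zero, enorm_mul]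
      rw [lintegral_const_mul' _ _ enorm_ne_top, ← ofReal_norm t, ht, ENNReal.ofReal_one, one_mul,
        ← ofReal_norm (r : ℂ), Complex.norm_of_nonneg hr0.le]
      calc ENNReal.ofReal r * ∫⁻ ω, ‖X ω‖ₑ ∂P ≤ ENNReal.ofReal r * ENNReal.ofReal E := by gcongr
        _ = ENNReal.ofReal (1 / 2) := by
          rw [← ENNReal.ofReal_mul hr0.le]; congr 1; rw [hr]; field_simp
    have h5 : ‖chf P (fun ω => r * X ω) t - 1‖ ≤ 1 / 2 := by
      rw [← ofReal_norm] at h4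
      exact (ENNReal.ofReal_le_ofReal_iff (by norm_num)).1 h4
    have h6 : 1 / 2 ≤ (chf P (fun ω => r * X ω) t).re := by
      have := (Complex.abs_re_le_norm _).trans h5
      rw [Complex.sub_re, Complex.one_re, abs_le] at this
      linarith [this.1]
    have h7 := Real.log_le_log (by norm_num) h6
    rw [one_div, Real.log_inv] at h7
    linarith
  have h3 : cosMoment α * (r ^ α * N) ≤ 2 * Real.pi * Real.log 2 := by
    rw [h1]
    refine (le_abs_self _).trans ?_
    obtain ⟨Γ, g1, g2, g3⟩ := (hX.const_mul hα r).exists_measure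
    have := intervalIntegral.norm_integral_le_of_norm_le_const (a := 0) (b := 2 * Real.pi)
      (C := Real.log 2)
      (f := fun φ : ℝ => -Real.log (chf P (fun ω => r * X ω) (Complex.exp (φ * Complex.I))).re)
      (fun φ _ => by
        have hle := h2 _ (Complex.norm_exp_ofReal_mul_I φ)
        rw [g3, Complex.ofReal_re, Real.log_exp, neg_neg] at hle ⊢
        rw [Real.norm_of_nonneg (integral_nonneg fun z => by positivity)]
        exact hle)
    rw [sub_zero, abs_of_pos (by positivity : 0 < 2 * Real.pi)] at this
    rw [Real.norm_eq_abs] at this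
    linarith
  have hc := cosMoment_pos hα
  have h4 : r ^ α = ((2 * E) ^ α)⁻¹ := by rw [hr, Real.inv_rpow (by positivity)]
  rw [h4] at h3
  have h5 : 0 < (2 * E) ^ α := by positivity
  rw [div_mul_eq_mul_div, le_div_iff₀ hc]
  calc N * cosMoment α = cosMoment α * (((2 * E) ^ α)⁻¹ * N) * (2 * E) ^ α := by field_simp
    _ ≤ _ := by gcongr

/-- A constant `K` with `‖X‖_α ≤ K E |X|`. -/
noncomputable def scaleConst (α : ℝ) : ℝ :=
  (2 * Real.pi * Real.log 2 / cosMoment α) ^ (1 / α) * 2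

lemma scaleConst_pos (hα : 0 < α) : 0 < scaleConst α := by
  have := cosMoment_pos hα
  have := Real.log_pos one_lt_two
  unfold scaleConst; positivity

/-- The scale is controlled by the first moment. -/
lemma HasScale.rpow_le [IsProbabilityMeasure P] (hα : 0 < α) {X : Ω → ℂ} {N : ℝ}
    (hX : HasScale α P X N) {E : ℝ} (hE : 0 ≤ E) (h : ∫⁻ ω, ‖X ω‖ₑ ∂P ≤ ENNReal.ofReal E) :
    N ^ (1 / α) ≤ scaleConst α * E := by
  have hc := cosMoment_pos hα
  have hl := Real.log_pos one_lt_two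
  have key : ∀ E' > E, N ^ (1 / α) ≤ scaleConst α * E' := by
    intro E' hE'
    have hE0 : 0 < E' := hE.trans_lt hE'
    have h1 := hX.le_of_lintegral_lt hα hE0 (h.trans (ENNReal.ofReal_le_ofReal hE'.le))
    have h2 := Real.rpow_le_rpow hX.nonneg h1 (by positivity : 0 ≤ 1 / α)
    rwa [Real.mul_rpow (by positivity) (by positivity), ← Real.rpow_mul (by positivity),
      mul_one_div_cancel hα.ne', Real.rpow_one, ← mul_assoc] at h2
  have hlim : Tendsto (fun E' => scaleConst α * E') (𝓝[>] E) (𝓝 (scaleConst α * E)) :=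
    (continuous_const.mul continuous_id).continuousWithinAt
  exact ge_of_tendsto hlim (by filter_upwards [self_mem_nhdsWithin] with x hx using key x hx)

/-- The spectral measure divided by its total mass; for `N = 0` any probability measure will do. -/
lemma HasScale.exists_probabilityMeasure {X : Ω → ℂ} {N : ℝ} (hX : HasScale α P X N) :
    ∃ Q : ProbabilityMeasure Circle, ∀ t, chf P X t
      = ((Real.exp (-(N * ∫ z : Circle, |(conj t * (z : ℂ)).re| ^ α ∂(Q : Measure Circle))) : ℝ) : ℂ) := by
  have hN := hX.nonneg
  obtain ⟨Γ, h1, h2, h3⟩ := hX.exists_measure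
  rcases hN.eq_or_lt with h0 | hpos
  · refine ⟨⟨Measure.dirac 1, inferInstance⟩, fun t => ?_⟩
    have : Γ = 0 := by
      rw [← h0, measureReal_eq_zero_iff] at h2
      exact Measure.measure_univ_eq_zero.1 h2
    rw [h3, this, ← h0]; simp
  · refine ⟨⟨ENNReal.ofReal N⁻¹ • Γ, ⟨?_⟩⟩, fun t => ?_⟩
    · rw [Measure.smul_apply, ← ofReal_measureReal, h2, smul_eq_mul,
        ← ENNReal.ofReal_mul (by positivity), inv_mul_cancel₀ hpos.ne', ENNReal.ofReal_one]
    · rw [h3]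
      simp only [ProbabilityMeasure.coe_mk]
      rw [integral_smul_measure, ENNReal.toReal_ofReal (by positivity), smul_eq_mul, ← mul_assoc,
        mul_inv_cancel₀ hpos.ne', one_mul]

/-- `L¹`-limits of symmetric stable variables are symmetric stable: by compactness of the circle
the normalized spectral measures have a cluster point. -/
lemma HasScale.of_tendsto [IsProbabilityMeasure P] (hα : 0 < α) {X : ℕ → Ω → ℂ} {Y : Ω → ℂ}
    {N : ℕ → ℝ} {M : ℝ} (hX : ∀ n, HasScale α P (X n) (N n)) (hY : AEMeasurable Y P)
    (hXY : Tendsto (fun n => ∫⁻ ω, ‖X n ω - Y ω‖ₑ ∂P) atTop (𝓝 0))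
    (hN : Tendsto N atTop (𝓝 M)) : HasScale α P Y M := by
  have hM : 0 ≤ M := ge_of_tendsto' hN fun n => (hX n).nonneg
  have hchf : ∀ t, Tendsto (fun n => chf P (X n) t) atTop (𝓝 (chf P Y t)) := by
    intro t
    rw [tendsto_iff_edist_tendsto_0]
    have h0 : Tendsto (fun n => ‖t‖ₑ * ∫⁻ ω, ‖X n ω - Y ω‖ₑ ∂P) atTop (𝓝 0) := by
      have := ENNReal.Tendsto.const_mul (a := ‖t‖ₑ) hXY (Or.inr enorm_ne_top)
      rwa [mul_zero] at this
    refine tendsto_of_tendsto_of_tendsto_of_le_of_le tendsto_const_nhds h0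
      (fun n => zero_le) fun n => ?_
    rw [edist_eq_enorm_sub]
    exact enorm_chf_sub_le (hX n).aemeasurable hY t
  choose Q hQ using fun n => (hX n).exists_probabilityMeasure
  obtain ⟨Q', -, hQ'⟩ := isCompact_univ.ultrafilter_le_nhds
    ((hyperfilter ℕ : Ultrafilter ℕ).map Q) (by simp)
  have hle : (hyperfilter ℕ : Filter ℕ) ≤ atTop := Nat.hyperfilter_le_atTop
  have hQlim : Tendsto Q (hyperfilter ℕ : Filter ℕ) (𝓝 Q') := hQ'
  rw [ProbabilityMeasure.tendsto_iff_forall_integral_tendsto] at hQlim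
  refine ⟨hY, ENNReal.ofReal M • (Q' : Measure Circle),
    Measure.smul_finite _ ENNReal.ofReal_ne_top, ?_, fun t => ?_⟩
  · rw [measureReal_ennreal_smul_apply, ENNReal.toReal_ofReal hM]; simp
  · rw [integral_smul_measure, ENNReal.toReal_ofReal hM, smul_eq_mul]
    refine tendsto_nhds_unique ((hchf t).mono_left hle) ?_
    simp_rw [hQ]
    have := hQlim (BoundedContinuousFunction.mkOfCompact ⟨_, continuous_circle_rpow hα t⟩)
    simp only [BoundedContinuousFunction.mkOfCompact_apply, ContinuousMap.coe_mk] at this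
    exact (Complex.continuous_ofReal.tendsto _).comp ((Real.continuous_exp.tendsto _).comp
      (((hN.mono_left hle).mul this).neg))

end StableLaws

/-! ### Density of trigonometric polynomials and of step functions -/

section Density

lemma coeFn_linearCombination_toLp {ι S : Type*} [MeasurableSpace S] {m : Measure S} {p : ℝ≥0∞}
    {F : ι → S → ℂ} (hF : ∀ i, MemLp (F i) p m) (c : ι →₀ ℂ) :
    Finsupp.linearCombination ℂ (fun i => (hF i).toLp (F i)) c
      =ᵐ[m] fun x => c.sum fun i a => a * F i x := by
  induction c using Finsupp.induction_linear with
  | zero =>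
    rw [map_zero]
    exact Lp.coeFn_zero ℂ p m
  | add c d hc hd =>
    rw [map_add]
    filter_upwards [Lp.coeFn_add (Finsupp.linearCombination ℂ (fun i => (hF i).toLp (F i)) c)
      (Finsupp.linearCombination ℂ (fun i => (hF i).toLp (F i)) d), hc, hd] with x h1 h2 h3
    rw [h1, Pi.add_apply, h2, h3, Finsupp.sum_add_index'] <;> intros <;> ring
  | single i a =>
    rw [Finsupp.linearCombination_single]
    filter_upwards [Lp.coeFn_smul a ((hF i).toLp (F i)), (hF i).coeFn_toLp] with x h1 h2
    rw [h1, Pi.smul_apply, h2, Finsupp.sum_single_index (by simp), smul_eq_mul]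

lemma norm_toLp_rpow {S : Type*} [MeasurableSpace S] {m : Measure S} {α : ℝ} (hα : 0 < α)
    {F : S → ℂ} (hF : MemLp F (ENNReal.ofReal α) m) :
    ‖hF.toLp F‖ ^ α = ∫ x, ‖F x‖ ^ α ∂m := by
  have h0 : 0 ≤ ∫ x, ‖F x‖ ^ α ∂m := integral_nonneg fun x => by positivity
  rw [Lp.norm_toLp, hF.eLpNorm_eq_integral_rpow_norm (by simpa using hα) ENNReal.ofReal_ne_top,
    ENNReal.toReal_ofReal hα.le, ENNReal.toReal_ofReal (by positivity), ← Real.rpow_mul h0,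
    inv_mul_cancel₀ hα.ne', Real.rpow_one]

lemma expi_eq_fourier (n : ℤ) (θ : ℝ) :
    expi n θ = fourier (T := 2 * Real.pi) n (θ : AddCircle (2 * Real.pi)) := by
  rw [fourier_coe_apply, expi]
  congr 1
  have : (Real.pi : ℂ) ≠ 0 := by exact_mod_cast Real.pi_ne_zero
  push_cast; field_simp

lemma continuous_expi (n : ℤ) : Continuous (expi n) := by unfold expi; fun_prop

lemma norm_expi (n : ℤ) (θ : ℝ) : ‖expi n θ‖ = 1 := by
  have : Complex.I * n * θ = ((n * θ : ℝ) : ℂ) * Complex.I := by push_cast; ring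
  rw [expi, this, Complex.norm_exp_ofReal_mul_I]

lemma expi_add (n m : ℤ) (θ : ℝ) : expi (n + m) θ = expi n θ * expi m θ := by
  rw [expi, expi, expi, ← Complex.exp_add]; congr 1; push_cast; ring

lemma conj_expi (n : ℤ) (θ : ℝ) : conj (expi n θ) = expi (-n) θ := by
  rw [expi, expi, ← Complex.exp_conj]; congr 1; simp

lemma expi_zero (θ : ℝ) : expi 0 θ = 1 := by simp [expi]

lemma norm_expi_sub_le (n : ℤ) (θ φ : ℝ) : ‖expi n θ - expi n φ‖ ≤ |(n : ℝ)| * |θ - φ| := by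
  have h1 : expi n θ - expi n φ
      = expi n φ * (Complex.exp (Complex.I * ((n * (θ - φ) : ℝ) : ℂ)) - 1) := by
    rw [mul_sub, mul_one, expi, expi, ← Complex.exp_add]
    congr 2; push_cast; ring
  rw [h1, norm_mul, norm_expi, one_mul, ← abs_mul]
  exact Real.norm_exp_I_mul_ofReal_sub_one_le

lemma memLp_expi (μ : Measure ℝ) [IsFiniteMeasure μ] (p : ℝ≥0∞) (n : ℤ) : MemLp (expi n) p μ :=
  MemLp.of_bound (continuous_expi n).aestronglyMeasurable 1 (ae_of_all _ fun θ => (norm_expi n θ).le)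

/-- The trigonometric polynomial `∑ c n e^{inθ}` as an element of `L^p(μ)`. -/
noncomputable def trigLp (μ : Measure ℝ) [IsFiniteMeasure μ] (p : ℝ≥0∞) :
    (ℤ →₀ ℂ) →ₗ[ℂ] Lp ℂ p μ :=
  Finsupp.linearCombination ℂ fun n => (memLp_expi μ p n).toLp (expi n)

instance : Fact (0 < 2 * Real.pi) := ⟨Real.two_pi_pos⟩

/-- Trigonometric polynomials are dense in `L^p(μ)`, for every finite measure on `(-π, π]`: the
interval is identified with the circle, where continuous functions are dense. -/
lemma denseRange_trigLp (μ : Measure ℝ) [IsFiniteMeasure μ]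
    (hμ : μ (Set.Ioc (-Real.pi) Real.pi)ᶜ = 0) (p : ℝ≥0∞) [Fact (1 ≤ p)] (hp : p ≠ ∞) :
    DenseRange (trigLp μ p) := by
  let q : ℝ → AddCircle (2 * Real.pi) := fun θ => (θ : AddCircle (2 * Real.pi))
  have hq : Measurable q := AddCircle.measurable_mk'
  let ν : Measure (AddCircle (2 * Real.pi)) := μ.map q
  have hmp : MeasurePreserving q μ ν := ⟨hq, rfl⟩
  have hd := (ContinuousMap.toLp_denseRange ℂ ν ℂ hp).topologicalClosure_map_submodule
    (span_fourier_closure_eq_top (T := 2 * Real.pi))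
  let L := Lp.compMeasurePreservingₗᵢ (E := ℂ) (p := p) ℂ q hmp
  have hL : Function.Surjective L := by
    intro φ
    let r : AddCircle (2 * Real.pi) → ℝ := fun x => AddCircle.equivIoc (2 * Real.pi) (-Real.pi) x
    have hr : Measurable r :=
      measurable_subtype_coe.comp (AddCircle.measurableEquivIoc (2 * Real.pi) (-Real.pi)).measurable
    have hrq : ∀ᵐ θ ∂μ, r (q θ) = θ := by
      have : ∀ᵐ θ ∂μ, θ ∈ Set.Ioc (-Real.pi) Real.pi := by rw [ae_iff]; exact hμ
      filter_upwards [this] with θ hθ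
      have hθ' : θ ∈ Set.Ioc (-Real.pi) (-Real.pi + 2 * Real.pi) := by
        convert hθ using 2; ring
      exact AddCircle.equivIoc_coe_of_mem (p := 2 * Real.pi) (a := -Real.pi) hθ'
    have hsm : StronglyMeasurable (φ : ℝ → ℂ) := Lp.stronglyMeasurable φ
    have hmem : MemLp ((φ : ℝ → ℂ) ∘ r) p ν := by
      have h1 : AEStronglyMeasurable ((φ : ℝ → ℂ) ∘ r) ν :=
        (hsm.comp_measurable hr).aestronglyMeasurable
      rw [memLp_map_measure_iff h1 hq.aemeasurable]
      refine (memLp_congr_ae ?_).1 (Lp.memLp φ)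
      filter_upwards [hrq] with θ hθ
      simp [hθ]
    refine ⟨hmem.toLp _, ?_⟩
    apply Lp.ext
    refine (Lp.coeFn_compMeasurePreserving _ hmp).trans ?_
    have h2 := hmp.quasiMeasurePreserving.ae_eq_comp (MemLp.coeFn_toLp hmem)
    refine h2.trans ?_
    filter_upwards [hrq] with θ hθ
    simp [hθ]
  have hd2 := (hL.denseRange).topologicalClosure_map_submodule (f := L.toContinuousLinearMap) hd
  rw [Submodule.map_span, Submodule.map_span, ← Set.range_comp, ← Set.range_comp] at hd2
  have hrange : LinearMap.range (trigLp μ p) = Submodule.span ℂ (Set.range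
      ((L.toContinuousLinearMap : _ → _) ∘ (ContinuousMap.toLp p ν ℂ : _ → _) ∘
        (fourier (T := 2 * Real.pi)))) := by
    rw [trigLp, Finsupp.range_linearCombination]
    congr 2
    ext1 n
    apply Lp.ext
    refine (MemLp.coeFn_toLp _).trans ?_
    symm
    refine (Lp.coeFn_compMeasurePreserving _ hmp).trans ?_
    refine (hmp.quasiMeasurePreserving.ae_eq_comp (ContinuousMap.coeFn_toLp ν _)).trans ?_
    exact ae_of_all _ fun θ => (expi_eq_fourier n θ).symm
  rw [DenseRange, ← LinearMap.coe_range, hrange, Submodule.dense_iff_topologicalClosure_eq_top]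
  exact hd2

/-- The time interval `[-π, π]`. -/
abbrev TimeSet : Type := Set.Icc (-Real.pi) Real.pi

/-- The left endpoint `-π` of the time interval. -/
noncomputable def timeBot : TimeSet := ⟨-Real.pi, le_rfl, by linarith [Real.pi_pos]⟩

/-- The indicator of `(-π, t]`. -/
noncomputable def initialInd (t : TimeSet) : ℝ → ℂ :=
  (Set.Ioc (-Real.pi) (t : ℝ)).indicator fun _ => 1

lemma initialInd_timeBot : initialInd timeBot = 0 := by
  ext θ; simp [initialInd, timeBot]

lemma initialInd_sub {s t : TimeSet} (h : s ≤ t) :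
    initialInd t - initialInd s = (Set.Ioc (s : ℝ) (t : ℝ)).indicator fun _ => 1 := by
  have h' : (s : ℝ) ≤ t := h
  have h1 : -Real.pi ≤ s := s.2.1
  ext θ
  simp only [initialInd, Pi.sub_apply, Set.indicator_apply, Set.mem_Ioc]
  by_cases a : -Real.pi < θ <;> by_cases b : θ ≤ s <;> by_cases c : θ ≤ t <;>
    simp [a, b, c] <;> grind

lemma memLp_initialInd (μ : Measure ℝ) [IsFiniteMeasure μ] (p : ℝ≥0∞) (t : TimeSet) :
    MemLp (initialInd t) p μ :=
  (memLp_const 1).indicator measurableSet_Ioc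

/-- The step function `∑ c t 1_{(-π, t]}` as an element of `L^p(μ)`. -/
noncomputable def stepLp (μ : Measure ℝ) [IsFiniteMeasure μ] (p : ℝ≥0∞) :
    (TimeSet →₀ ℂ) →ₗ[ℂ] Lp ℂ p μ :=
  Finsupp.linearCombination ℂ fun t => (memLp_initialInd μ p t).toLp (initialInd t)

/-- The points dividing `[-π, π]` into `m` equal parts. -/
noncomputable def gridPoint (m : ℕ) (k : ℕ) : ℝ := -Real.pi + 2 * Real.pi * (min (k : ℝ) m / m)

lemma gridPoint_mono (m : ℕ) : Monotone (gridPoint m) := by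
  intro k l h
  unfold gridPoint
  gcongr

lemma gridPoint_mem (m k : ℕ) : gridPoint m k ∈ Set.Icc (-Real.pi) Real.pi := by
  unfold gridPoint
  have h1 : min (k : ℝ) m / m ≤ 1 := div_le_one_of_le₀ (min_le_right _ _) (by positivity)
  have h2 : 0 ≤ min (k : ℝ) m / m := by positivity
  constructor <;> nlinarith [Real.pi_pos]

lemma gridPoint_succ_sub_le (m k : ℕ) : gridPoint m (k + 1) - gridPoint m k ≤ 2 * Real.pi / m := by
  unfold gridPoint
  have : (min ((k + 1 : ℕ) : ℝ) m : ℝ) ≤ min (k : ℝ) m + 1 := by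
    rw [← min_add_add_right]; push_cast
    exact min_le_min le_rfl (by linarith)
  calc _ = 2 * Real.pi * ((min ((k + 1 : ℕ) : ℝ) m - min (k : ℝ) m) / m) := by ring
    _ ≤ 2 * Real.pi * (1 / m) := by gcongr; linarith
    _ = _ := by ring

/-- The step function on the grid with `m` parts that interpolates `e^{inθ}` at right endpoints. -/
noncomputable def gridStep (n : ℤ) (m : ℕ) : TimeSet →₀ ℂ :=
  ∑ k ∈ Finset.range m, expi n (gridPoint m (k + 1)) •
    (Finsupp.single ⟨_, gridPoint_mem m (k + 1)⟩ 1 - Finsupp.single ⟨_, gridPoint_mem m k⟩ 1)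

/-- The value of a step function given by its coefficients. -/
noncomputable def stepVal (c : TimeSet →₀ ℂ) (θ : ℝ) : ℂ := c.sum fun t a => a * initialInd t θ

lemma coeFn_stepLp (μ : Measure ℝ) [IsFiniteMeasure μ] (p : ℝ≥0∞) (c : TimeSet →₀ ℂ) :
    stepLp μ p c =ᵐ[μ] stepVal c := coeFn_linearCombination_toLp _ c

lemma stepVal_eq (c : TimeSet →₀ ℂ) (θ : ℝ) :
    stepVal c θ = Finsupp.linearCombination ℂ (fun t => initialInd t θ) c := rfl

lemma norm_stepVal_gridStep_sub_le (n : ℤ) {m : ℕ} (hm : m ≠ 0) {θ : ℝ}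
    (hθ : θ ∈ Set.Ioc (-Real.pi) Real.pi) :
    ‖stepVal (gridStep n m) θ - expi n θ‖ ≤ |(n : ℝ)| * (2 * Real.pi / m) := by
  let I : ℕ → ℝ := fun k => (Set.Ioc (gridPoint m k) (gridPoint m (k + 1))).indicator (fun _ => 1) θ
  have hI : ∀ k, initialInd ⟨_, gridPoint_mem m (k + 1)⟩ θ - initialInd ⟨_, gridPoint_mem m k⟩ θ
      = (I k : ℂ) := fun k => by
    have := congrFun (initialInd_sub (s := ⟨_, gridPoint_mem m k⟩)
      (t := ⟨_, gridPoint_mem m (k + 1)⟩) (gridPoint_mono m k.le_succ)) θ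
    rw [Pi.sub_apply] at this
    rw [this]
    simp only [I, Set.indicator_apply]; split_ifs <;> simp
  have hsum : ∑ k ∈ Finset.range m, (I k : ℂ) = 1 := by
    simp_rw [← hI]
    rw [Finset.sum_range_sub fun k => initialInd ⟨_, gridPoint_mem m k⟩ θ]
    have h0 : gridPoint m 0 = -Real.pi := by simp [gridPoint]
    have h1 : gridPoint m m = Real.pi := by
      have : (m : ℝ) ≠ 0 := by exact_mod_cast hm
      simp [gridPoint, this]; ring
    simp only [initialInd, h0, h1]
    simp [hθ.1, hθ.2]
  have hval : stepVal (gridStep n m) θ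
      = ∑ k ∈ Finset.range m, expi n (gridPoint m (k + 1)) * (I k : ℂ) := by
    rw [stepVal_eq, gridStep, map_sum]
    refine Finset.sum_congr rfl fun k _ => ?_
    rw [map_smul, map_sub, Finsupp.linearCombination_single, Finsupp.linearCombination_single,
      one_smul, one_smul, hI, smul_eq_mul]
  have hI0 : ∀ k, 0 ≤ I k := fun k => Set.indicator_nonneg (fun _ _ => zero_le_one) _
  calc ‖stepVal (gridStep n m) θ - expi n θ‖
      = ‖∑ k ∈ Finset.range m, (expi n (gridPoint m (k + 1)) - expi n θ) * (I k : ℂ)‖ := by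
        rw [hval]
        simp_rw [sub_mul]
        rw [Finset.sum_sub_distrib, ← Finset.mul_sum, hsum, mul_one]
    _ ≤ ∑ k ∈ Finset.range m, |(n : ℝ)| * (2 * Real.pi / m) * I k := by
        refine norm_sum_le_of_le _ fun k _ => ?_
        rw [norm_mul, Complex.norm_of_nonneg (hI0 k)]
        by_cases hk : θ ∈ Set.Ioc (gridPoint m k) (gridPoint m (k + 1))
        · refine mul_le_mul_of_nonneg_right ((norm_expi_sub_le _ _ _).trans ?_) (hI0 k)
          gcongr
          rw [abs_of_nonneg (by linarith [hk.2])]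
          linarith [hk.1, gridPoint_succ_sub_le m k]
        · simp [I, hk]
    _ = |(n : ℝ)| * (2 * Real.pi / m) := by
        rw [← Finset.mul_sum]
        have : ∑ k ∈ Finset.range m, I k = 1 := by exact_mod_cast hsum
        rw [this, mul_one]

/-- Step functions are dense in `L^p(μ)`: they approximate every exponential uniformly. -/
lemma denseRange_stepLp (μ : Measure ℝ) [IsFiniteMeasure μ]
    (hμ : μ (Set.Ioc (-Real.pi) Real.pi)ᶜ = 0) (p : ℝ≥0∞) [Fact (1 ≤ p)] (hp : p ≠ ∞) :
    DenseRange (stepLp μ p) := by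
  have hae : ∀ᵐ θ ∂μ, θ ∈ Set.Ioc (-Real.pi) Real.pi := by rw [ae_iff]; exact hμ
  have key : ∀ n, (memLp_expi μ p n).toLp (expi n)
      ∈ (LinearMap.range (stepLp μ p)).topologicalClosure := by
    intro n
    apply mem_closure_of_tendsto (f := fun m => stepLp μ p (gridStep n m)) (b := atTop) _
      (Eventually.of_forall fun m => LinearMap.mem_range_self _ _)
    rw [tendsto_iff_norm_sub_tendsto_zero]
    have hlim : Tendsto (fun m : ℕ => μ.real Set.univ ^ p.toReal⁻¹ *
        (|(n : ℝ)| * (2 * Real.pi / m))) atTop (𝓝 0) := by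
      have := (tendsto_const_div_atTop_nhds_zero_nat (2 * Real.pi)).const_mul
        (μ.real Set.univ ^ p.toReal⁻¹ * |(n : ℝ)|)
      rw [mul_zero] at this
      exact this.congr fun m => by ring
    refine squeeze_zero' (Eventually.of_forall fun m => norm_nonneg _) ?_ hlim
    filter_upwards [eventually_ne_atTop 0] with m hm
    refine (Lp.norm_le_of_ae_bound (C := |(n : ℝ)| * (2 * Real.pi / m)) (by positivity) ?_).trans_eq
      rfl
    filter_upwards [Lp.coeFn_sub (stepLp μ p (gridStep n m)) ((memLp_expi μ p n).toLp (expi n)),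
      coeFn_stepLp μ p (gridStep n m), (memLp_expi μ p n).coeFn_toLp, hae] with θ h1 h2 h3 h4
    rw [h1, Pi.sub_apply, h2, h3]
    exact norm_stepVal_gridStep_sub_le n hm h4
  have hle : LinearMap.range (trigLp μ p) ≤ (LinearMap.range (stepLp μ p)).topologicalClosure := by
    rw [trigLp, Finsupp.range_linearCombination, Submodule.span_le]
    rintro _ ⟨n, rfl⟩
    exact key n
  rw [DenseRange, ← LinearMap.coe_range, ← dense_closure]
  exact (denseRange_trigLp μ hμ p hp).mono (by exact_mod_cast hle)

end Density

/-! ### Stochastic integration as a map from `L^α(μ)` to `L¹(P)` -/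

section StableIntegral

variable {Ω : Type*} [MeasurableSpace Ω] {P : Measure Ω} [IsProbabilityMeasure P] {α : ℝ}

lemma IsIndepIncrementSaS.hasScale_increment (hα : 1 < α) {Z : ℝ → Ω → ℂ} {μ : Measure ℝ}
    (hZ : IsIndepIncrementSaS α P Z μ) {s t : TimeSet} (h : s ≤ t) :
    HasScale α P (fun ω => Z t ω - Z s ω) (μ.real (Set.Ioc (s : ℝ) t)) := by
  have hj := hZ.sas 2 ![(s : ℝ), t] (fun i => by fin_cases i; exacts [s.2, t.2])
  obtain ⟨N, hN⟩ := hj.exists_hasScale (by linarith) ![-1, 1]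
  have hN' : HasScale α P (Z t - Z s) N := by
    refine hN.congr (ae_of_all _ fun ω => ?_)
    simp [Fin.sum_univ_two]; ring
  have h1 := hZ.spectral s t s.2.1 h t.2.2
  rw [hN'.saSNorm_rpow hα] at h1
  rw [measureReal_def, h1, ENNReal.toReal_ofReal hN'.nonneg]
  exact hN'

lemma sum_ite_lt_increment {V : Type*} [AddCommGroup V] {n : ℕ} (w : Fin (n + 1) → V)
    (j : Fin (n + 1)) :
    ∑ k : Fin n, (if (k : ℕ) < j then w k.succ - w k.castSucc else 0) = w j - w 0 := by
  induction j using Fin.induction with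
  | zero => simp
  | succ j ih =>
    have : ∀ k : Fin n, (if (k : ℕ) < j.succ then w k.succ - w k.castSucc else 0)
        = (if (k : ℕ) < j.castSucc then w k.succ - w k.castSucc else 0)
          + (if k = j then w k.succ - w k.castSucc else 0) := fun k => by
      rcases lt_trichotomy k j with h | h | h
      · have h' : (k : ℕ) < j := h
        simp [h', h.ne, h'.trans (Nat.lt_succ_self _)]
      · simp [h]
      · have h' : (j : ℕ) < k := h
        simp [h.ne', not_lt.2 h'.le, not_lt.2 (Nat.succ_le_of_lt h')]
    simp_rw [this, Finset.sum_add_distrib, ih]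
    simp

/-- A combination of increments from `-π` can be rewritten in terms of the successive increments
along a monotone chain of times, with coefficients that do not depend on the process. -/
lemma exists_chain (c : TimeSet →₀ ℂ) :
    ∃ (n : ℕ) (t : Fin (n + 1) → TimeSet) (d : Fin n → ℂ), Monotone t ∧
      ∀ v : TimeSet → ℂ, (c.sum fun s a => a * (v s - v timeBot))
        = ∑ k, d k * (v (t k.succ) - v (t k.castSucc)) := by
  classical
  let S : Finset TimeSet := insert timeBot c.support
  obtain ⟨n, hn⟩ : ∃ n, S.card = n + 1 :=
    Nat.exists_eq_succ_of_ne_zero (Finset.card_ne_zero_of_mem (Finset.mem_insert_self _ _))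
  let t : Fin (n + 1) → TimeSet := S.orderEmbOfFin hn
  have hmem : ∀ s ∈ S, ∃ j, t j = s := fun s hs => by
    have : s ∈ Set.range (S.orderEmbOfFin hn) := by rw [Finset.range_orderEmbOfFin]; exact hs
    exact this
  have hmono : Monotone t := (S.orderEmbOfFin hn).monotone
  have ht0 : t 0 = timeBot := by
    obtain ⟨j, hj⟩ := hmem timeBot (Finset.mem_insert_self _ _)
    apply le_antisymm
    · rw [← hj]; exact hmono (Fin.zero_le _)
    · exact (t 0).2.1
  choose! j hj using hmem
  refine ⟨n, t, fun k => ∑ s ∈ c.support, if (k : ℕ) < j s then c s else 0, hmono, fun v => ?_⟩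
  have h1 : ∀ s ∈ c.support, c s * (v s - v timeBot)
      = ∑ k : Fin n, (if (k : ℕ) < j s then c s else 0) * (v (t k.succ) - v (t k.castSucc)) := by
    intro s hs
    have h2 := sum_ite_lt_increment (fun i => v (t i)) (j s)
    rw [hj s (Finset.mem_insert_of_mem hs), ht0] at h2
    rw [← h2, Finset.mul_sum]
    refine Finset.sum_congr rfl fun k _ => ?_
    split_ifs <;> simp
  rw [Finsupp.sum, Finset.sum_congr rfl h1, Finset.sum_comm]
  simp_rw [Finset.sum_mul]

lemma norm_sum_indicator_rpow (hα : 0 < α) {n : ℕ} {t : Fin (n + 1) → TimeSet} (ht : Monotone t)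
    (d : Fin n → ℂ) (θ : ℝ) :
    ‖∑ k : Fin n, d k * (Set.Ioc (t k.castSucc : ℝ) (t k.succ)).indicator (fun _ => (1 : ℂ)) θ‖ ^ α
      = ∑ k : Fin n, (Set.Ioc (t k.castSucc : ℝ) (t k.succ)).indicator (fun _ => ‖d k‖ ^ α) θ := by
  by_cases h : ∃ k : Fin n, θ ∈ Set.Ioc (t k.castSucc : ℝ) (t k.succ)
  · obtain ⟨k, hk⟩ := h
    have hne : ∀ l, l ≠ k → θ ∉ Set.Ioc (t l.castSucc : ℝ) (t l.succ) := by
      intro l hl hl'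
      rcases lt_or_gt_of_ne hl with h | h
      · have : (t l.succ : ℝ) ≤ t k.castSucc := ht (Fin.succ_le_castSucc_iff.2 h)
        linarith [hl'.2, hk.1]
      · have : (t k.succ : ℝ) ≤ t l.castSucc := ht (Fin.succ_le_castSucc_iff.2 h)
        linarith [hl'.1, hk.2]
    rw [Finset.sum_eq_single k, Finset.sum_eq_single k]
    · simp [Set.indicator_of_mem hk]
    · intro l _ hl; rw [Set.indicator_of_notMem (hne l hl)]
    · simp
    · intro l _ hl; rw [Set.indicator_of_notMem (hne l hl), mul_zero]
    · simp
  · push Not at h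
    rw [Finset.sum_eq_zero fun (k : Fin n) _ => by rw [Set.indicator_of_notMem (h k), mul_zero],
      Finset.sum_eq_zero fun (k : Fin n) _ => by rw [Set.indicator_of_notMem (h k)]]
    simp [hα.ne']

/-- The integral of the step function with coefficients `c`. -/
noncomputable def stepIntegral (Z : ℝ → Ω → ℂ) (c : TimeSet →₀ ℂ) (ω : Ω) : ℂ :=
  c.sum fun t a => a * (Z t ω - Z (-Real.pi) ω)

/-- For step functions `φ`, the scale of `∫ φ dZ` is `∫ ‖φ‖ ^ α dμ`. -/
lemma IsIndepIncrementSaS.hasScale_stepIntegral (hα : 1 < α) {Z : ℝ → Ω → ℂ} {μ : Measure ℝ}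
    (hZ : IsIndepIncrementSaS α P Z μ) (c : TimeSet →₀ ℂ) :
    HasScale α P (stepIntegral Z c) (∫ θ, ‖stepVal c θ‖ ^ α ∂μ) := by
  have hα0 : 0 < α := by linarith
  have := hZ.finite
  obtain ⟨n, t, d, ht, hv⟩ := exists_chain c
  have h1 : stepIntegral Z c = fun ω => ∑ k, d k * (Z (t k.succ) ω - Z (t k.castSucc) ω) := by
    ext ω
    exact hv fun s => Z s ω
  have h2 : ∀ θ, ‖stepVal c θ‖ ^ α
      = ∑ k : Fin n, (Set.Ioc (t k.castSucc : ℝ) (t k.succ)).indicator (fun _ => ‖d k‖ ^ α) θ := by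
    intro θ
    rw [← norm_sum_indicator_rpow hα0 ht]
    congr 2
    have := hv fun s => initialInd s θ
    rw [initialInd_timeBot] at this
    simp only [Pi.zero_apply, sub_zero] at this
    rw [stepVal, this]
    refine Finset.sum_congr rfl fun k _ => ?_
    rw [← initialInd_sub (ht (Fin.castSucc_le_succ k)), Pi.sub_apply]
  have h3 : ∫ θ, ‖stepVal c θ‖ ^ α ∂μ
      = ∑ k, ‖d k‖ ^ α * μ.real (Set.Ioc (t k.castSucc : ℝ) (t k.succ)) := by
    simp_rw [h2]
    rw [integral_finsetSum _ fun k _ => (integrable_const _).indicator measurableSet_Ioc]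
    refine Finset.sum_congr rfl fun k _ => ?_
    rw [integral_indicator_const _ measurableSet_Ioc, smul_eq_mul, mul_comm]
  rw [h1, h3]
  refine HasScale.sum_of_iIndepFun hα0
    (fun k => (hZ.hasScale_increment hα (ht (Fin.castSucc_le_succ k))).const_mul hα0 (d k)) ?_
  exact (hZ.indep n t ht).comp (fun k x => d k * x) fun k => measurable_const_mul _

lemma IsIndepIncrementSaS.memLp_increment (hα : 1 < α) {Z : ℝ → Ω → ℂ} {μ : Measure ℝ}
    (hZ : IsIndepIncrementSaS α P Z μ) (t : TimeSet) :
    MemLp (fun ω => Z t ω - Z (-Real.pi) ω) 1 P :=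
  (hZ.hasScale_increment hα (s := timeBot) (t := t) t.2.1).memLp_one hα

lemma HasScale.norm_le (hα : 1 < α) {X : Lp ℂ 1 P} {N : ℝ} (hX : HasScale α P X N) :
    ‖X‖ ≤ 2 * momentConst α * N ^ (1 / α) := by
  have := momentConst_pos hα
  have := hX.nonneg
  rw [Lp.norm_def, eLpNorm_one_eq_lintegral_enorm]
  exact ENNReal.toReal_le_of_le_ofReal (by positivity) (hX.lintegral_enorm_le hα)

lemma HasScale.rpow_le_norm (hα : 0 < α) {X : Lp ℂ 1 P} {N : ℝ} (hX : HasScale α P X N) :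
    N ^ (1 / α) ≤ scaleConst α * ‖X‖ := by
  refine hX.rpow_le hα (norm_nonneg _) ?_
  rw [Lp.norm_def, ENNReal.ofReal_toReal (Lp.eLpNorm_ne_top X), eLpNorm_one_eq_lintegral_enorm]

lemma isClosed_setOf_hasScale (hα : 0 < α) {E : Type*} [PseudoMetricSpace E] {J : E → Lp ℂ 1 P}
    (hJ : Continuous J) {N : E → ℝ} (hN : Continuous N) :
    IsClosed {x | HasScale α P (J x) (N x)} := by
  apply IsSeqClosed.isClosed
  intro x y hx hxy
  refine HasScale.of_tendsto hα hx (Lp.aestronglyMeasurable _).aemeasurable ?_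
    ((hN.tendsto y).comp hxy)
  have h1 := (hJ.tendsto y).comp hxy
  rw [tendsto_iff_edist_tendsto_0] at h1
  refine h1.congr fun n => ?_
  rw [Function.comp, Lp.edist_def, eLpNorm_one_eq_lintegral_enorm]
  rfl

lemma TendstoSaS.tendsto_lintegral (hα : 1 < α) {X : ℕ → Ω → ℂ} {Y : Ω → ℂ}
    (h : TendstoSaS α P X Y) : Tendsto (fun n => ∫⁻ ω, ‖X n ω - Y ω‖ₑ ∂P) atTop (𝓝 0) := by
  have h1 : Tendsto (fun n => ENNReal.ofReal (2 * momentConst α * saSNorm α P (X n - Y))) atTop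
      (𝓝 0) := by
    have := (h.2.const_mul (2 * momentConst α))
    rw [mul_zero] at this
    have h2 := (ENNReal.continuous_ofReal.tendsto 0).comp this
    rwa [ENNReal.ofReal_zero] at h2
  refine tendsto_of_tendsto_of_tendsto_of_le_of_le tendsto_const_nhds h1 (fun n => zero_le)
    fun n => ?_
  obtain h2 := (h.1 n).hasScale hα
  have h3 := h2.lintegral_enorm_le hα
  rwa [← h2.saSNorm_eq hα] at h3

omit [IsProbabilityMeasure P] in
lemma TendstoSaS.aemeasurable {X : ℕ → Ω → ℂ} {Y : Ω → ℂ} (h : TendstoSaS α P X Y)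
    (hX : AEMeasurable (X 0) P) : AEMeasurable Y P := by
  have h1 : AEMeasurable (X 0 - Y) P := (h.1 0).1 0
  have h2 := hX.sub h1
  rwa [sub_sub_cancel] at h2

/-- A `‖·‖_α`-limit of variables that also converge in `L¹` is the `L¹`-limit. -/
lemma TendstoSaS.ae_eq (hα : 1 < α) {X : ℕ → Ω → ℂ} {Y : Ω → ℂ} (h : TendstoSaS α P X Y)
    {x : ℕ → Lp ℂ 1 P} {y : Lp ℂ 1 P} (hx : ∀ n, x n =ᵐ[P] X n) (hxy : Tendsto x atTop (𝓝 y)) :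
    y =ᵐ[P] Y := by
  have hY : AEMeasurable Y P :=
    h.aemeasurable ((Lp.aestronglyMeasurable (x 0)).aemeasurable.congr (hx 0))
  have h1 := h.tendsto_lintegral hα
  have h2 : Tendsto (fun n => ∫⁻ ω, ‖x n ω - y ω‖ₑ ∂P) atTop (𝓝 0) := by
    rw [tendsto_iff_edist_tendsto_0] at hxy
    refine hxy.congr fun n => ?_
    rw [Lp.edist_def, eLpNorm_one_eq_lintegral_enorm]
    rfl
  have h3 : ∫⁻ ω, ‖y ω - Y ω‖ₑ ∂P = 0 := by
    refine le_antisymm (ge_of_tendsto' (by simpa using h2.add h1) fun n => ?_) zero_le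
    have hm : AEMeasurable (fun ω => ‖x n ω - y ω‖ₑ) P :=
      ((Lp.aestronglyMeasurable (x n)).sub (Lp.aestronglyMeasurable y)).enorm
    rw [← lintegral_add_left' hm]
    refine lintegral_mono_ae ?_
    filter_upwards [hx n] with ω hω
    rw [← hω, enorm_sub_rev (x n ω) (y ω)]
    calc ‖y ω - Y ω‖ₑ = ‖(y ω - x n ω) + (x n ω - Y ω)‖ₑ := by rw [sub_add_sub_cancel]
      _ ≤ _ := enorm_add_le _ _
  have hm : AEMeasurable (fun ω => ‖y ω - Y ω‖ₑ) P :=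
    ((Lp.aestronglyMeasurable y).aemeasurable.sub hY).enorm
  rw [lintegral_eq_zero_iff' hm] at h3
  filter_upwards [h3] with ω hω
  simpa [sub_eq_zero] using hω

/-- Convergence in the image of an `α`-isometric map. -/
lemma tendstoSaS_of_tendsto (hα : 1 < α) {X : ℕ → Ω → ℂ} {Y : Ω → ℂ} {N : ℕ → ℝ}
    (h : ∀ n, HasScale α P (X n - Y) (N n)) (hN : Tendsto N atTop (𝓝 0)) :
    TendstoSaS α P X Y := by
  refine ⟨fun n => (h n).isSaS (by linarith), ?_⟩
  simp_rw [fun n => (h n).saSNorm_eq hα]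
  have := (Real.continuous_rpow_const (by positivity : 0 ≤ 1 / α)).tendsto 0
  rw [Real.zero_rpow (by positivity)] at this
  exact this.comp hN

/-- A step function in terms of its coefficients. -/
noncomputable def StepData.coeffs (φ : StepData) : TimeSet →₀ ℂ :=
  ∑ j, φ.coef j • (Finsupp.single ⟨φ.right j, (φ.neg_pi_le j).trans (φ.le j), φ.le_pi j⟩ 1
    - Finsupp.single ⟨φ.left j, φ.neg_pi_le j, (φ.le j).trans (φ.le_pi j)⟩ 1)

lemma StepData.stepVal_coeffs (φ : StepData) : stepVal φ.coeffs = φ.toFun := by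
  ext θ
  rw [stepVal_eq, coeffs, map_sum, toFun]
  refine Finset.sum_congr rfl fun j _ => ?_
  rw [map_smul, map_sub, Finsupp.linearCombination_single, Finsupp.linearCombination_single,
    one_smul, one_smul, ← Pi.sub_apply, initialInd_sub (φ.le j), smul_eq_mul]
  simp only [Set.indicator_apply]
  split_ifs <;> simp

omit [MeasurableSpace Ω] in
lemma StepData.stepIntegral_coeffs (φ : StepData) (Z : ℝ → Ω → ℂ) :
    stepIntegral Z φ.coeffs = φ.integral Z := by
  ext ω
  change Finsupp.linearCombination ℂ (fun t : TimeSet => Z t ω - Z (-Real.pi) ω) φ.coeffs = _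
  rw [coeffs, map_sum, StepData.integral]
  refine Finset.sum_congr rfl fun j _ => ?_
  rw [map_smul, map_sub, Finsupp.linearCombination_single, Finsupp.linearCombination_single,
    one_smul, one_smul, smul_eq_mul]
  ring

omit [MeasurableSpace Ω] in
/-- Every combination of the indicators of `(-π, t]` is a step function. -/
lemma exists_stepData (c : TimeSet →₀ ℂ) : ∃ φ : StepData, φ.toFun = stepVal c ∧
    ∀ Z : ℝ → Ω → ℂ, φ.integral Z = stepIntegral Z c := by
  let e := c.support.equivFin
  have hsum : ∀ G : TimeSet → ℂ, ∑ t ∈ c.support, G t = ∑ j, G (e.symm j) := fun G => by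
    rw [← Finset.sum_coe_sort]
    exact (Equiv.sum_comp e.symm fun t : c.support => G t).symm
  refine ⟨⟨c.support.card, fun j => c (e.symm j), fun _ => -Real.pi,
    fun j => ((e.symm j : TimeSet) : ℝ), fun _ => le_rfl, fun j => (e.symm j : TimeSet).2.1,
    fun j => (e.symm j : TimeSet).2.2⟩, ?_, fun Z => ?_⟩
  · ext θ
    refine Eq.trans ?_ (hsum fun t => c t * initialInd t θ).symm
    refine Finset.sum_congr rfl fun j _ => ?_
    simp only [initialInd, Set.indicator_apply]
    split_ifs <;> simp
  · ext ω
    exact (hsum fun t => c t * (Z t ω - Z (-Real.pi) ω)).symm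

variable [Fact (1 ≤ ENNReal.ofReal α)]

/-- The stochastic integral with respect to `Z`, as a map `L^α(μ) → L¹(P)`. -/
theorem IsIndepIncrementSaS.exists_integral (hα : 1 < α) {Z : ℝ → Ω → ℂ} {μ : Measure ℝ}
    [IsFiniteMeasure μ] (hZ : IsIndepIncrementSaS α P Z μ) :
    ∃ J : Lp ℂ (ENNReal.ofReal α) μ →L[ℂ] Lp ℂ 1 P,
      (∀ φ, HasScale α P (J φ) (‖φ‖ ^ α)) ∧
      ∀ c, J (stepLp μ (ENNReal.ofReal α) c) =ᵐ[P] stepIntegral Z c := by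
  have hα0 : 0 < α := by linarith
  let f : (TimeSet →₀ ℂ) →ₗ[ℂ] Lp ℂ 1 P :=
    Finsupp.linearCombination ℂ fun t => (hZ.memLp_increment hα t).toLp _
  have hf : ∀ c, f c =ᵐ[P] stepIntegral Z c := fun c =>
    coeFn_linearCombination_toLp (fun t => hZ.memLp_increment hα t) c
  have hN : ∀ c, ‖stepLp μ (ENNReal.ofReal α) c‖ ^ α = ∫ θ, ‖stepVal c θ‖ ^ α ∂μ := fun c => by
    have hm : MemLp (stepVal c) (ENNReal.ofReal α) μ :=
      (memLp_congr_ae (coeFn_stepLp μ _ c)).1 (Lp.memLp _)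
    rw [← norm_toLp_rpow hα0 hm]
    congr 2
    exact Lp.ext ((coeFn_stepLp μ _ c).trans hm.coeFn_toLp.symm)
  have hscale : ∀ c, HasScale α P (f c) (‖stepLp μ (ENNReal.ofReal α) c‖ ^ α) := fun c => by
    rw [hN]
    exact (hZ.hasScale_stepIntegral hα c).congr (hf c).symm
  have hbound : ∀ c, ‖f c‖ ≤ 2 * momentConst α * ‖stepLp μ (ENNReal.ofReal α) c‖ := fun c => by
    have := (hscale c).norm_le hα
    rwa [← Real.rpow_mul (norm_nonneg _), mul_one_div_cancel hα0.ne', Real.rpow_one] at this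
  have hd := denseRange_stepLp μ hZ.supp (ENNReal.ofReal α) ENNReal.ofReal_ne_top
  have heq : ∀ c, f.extendOfNorm (stepLp μ (ENNReal.ofReal α)) (stepLp μ (ENNReal.ofReal α) c)
      = f c := fun c => LinearMap.extendOfNorm_eq hd ⟨_, hbound⟩ c
  refine ⟨f.extendOfNorm (stepLp μ (ENNReal.ofReal α)), fun φ => ?_, fun c => ?_⟩
  · refine hd.induction_on (p := fun φ => HasScale α P
      (f.extendOfNorm (stepLp μ (ENNReal.ofReal α)) φ) (‖φ‖ ^ α)) φ ?_ fun c => ?_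
    · exact isClosed_setOf_hasScale hα0 (ContinuousLinearMap.continuous _)
        (continuous_norm.rpow_const fun _ => Or.inr hα0.le)
    · rw [heq]
      exact hscale c
  · rw [heq]
    exact hf c

/-- On functions that have a stochastic integral in the sense of `HasStableIntegral`, the map of
`IsIndepIncrementSaS.exists_integral` agrees with it. -/
lemma HasStableIntegral.integral_ae_eq (hα : 1 < α) {Z : ℝ → Ω → ℂ} {μ : Measure ℝ}
    [IsFiniteMeasure μ] {J : Lp ℂ (ENNReal.ofReal α) μ →L[ℂ] Lp ℂ 1 P}
    (hJ : ∀ c, J (stepLp μ (ENNReal.ofReal α) c) =ᵐ[P] stepIntegral Z c) {h : ℝ → ℂ} {Y : Ω → ℂ}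
    (hh : MemLp h (ENNReal.ofReal α) μ) (hY : HasStableIntegral α P Z μ h Y) :
    J (hh.toLp h) =ᵐ[P] Y := by
  obtain ⟨-, φ, h1, h2⟩ := hY
  refine h2.ae_eq hα (x := fun n => J (stepLp μ (ENNReal.ofReal α) (φ n).coeffs)) (fun n => ?_) ?_
  · rw [← StepData.stepIntegral_coeffs]
    exact hJ _
  · refine (J.continuous.tendsto _).comp ?_
    rw [tendsto_iff_edist_tendsto_0]
    refine h1.congr fun n => ?_
    rw [Lp.edist_def]
    apply eLpNorm_congr_ae
    rw [← StepData.stepVal_coeffs]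
    exact ((coeFn_stepLp μ _ _).sub hh.coeFn_toLp).symm

lemma IsHarmonizable.integral_trigLp (hα : 1 < α) {ξ : ℤ → Ω → ℂ} {Z : ℝ → Ω → ℂ} {μ : Measure ℝ}
    [IsFiniteMeasure μ] (hξ : IsHarmonizable α P ξ Z μ)
    {J : Lp ℂ (ENNReal.ofReal α) μ →L[ℂ] Lp ℂ 1 P}
    (hJ : ∀ c, J (stepLp μ (ENNReal.ofReal α) c) =ᵐ[P] stepIntegral Z c) (c : ℤ →₀ ℂ) :
    J (trigLp μ (ENNReal.ofReal α) c) =ᵐ[P] fun ω => c.sum fun n a => a * ξ n ω := by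
  have h1 : ∀ n, J ((memLp_expi μ (ENNReal.ofReal α) n).toLp (expi n)) =ᵐ[P] ξ n := fun n =>
    HasStableIntegral.integral_ae_eq hα hJ _ (hξ.spectral n)
  have hm : ∀ n, MemLp (ξ n) 1 P := fun n => (memLp_congr_ae (h1 n)).1 (Lp.memLp _)
  have h2 : J (trigLp μ (ENNReal.ofReal α) c)
      = Finsupp.linearCombination ℂ (fun n => (hm n).toLp (ξ n)) c := by
    rw [trigLp, ← ContinuousLinearMap.coe_coe, Finsupp.apply_linearCombination]
    congr 2
    ext1 n
    exact Lp.ext ((h1 n).trans (hm n).coeFn_toLp.symm)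
  rw [h2]
  exact coeFn_linearCombination_toLp hm c

/-- Integrals with respect to the spectral processes of independent sequences: the scales add.
Independence passes from the sequences to the integrals because trigonometric polynomials are
dense. -/
lemma hasScale_add_of_indep (hα : 1 < α) {ξ η : ℤ → Ω → ℂ} {Zξ Zη : ℝ → Ω → ℂ} {μ ν : Measure ℝ}
    [IsFiniteMeasure μ] [IsFiniteMeasure ν] (hξ : IsHarmonizable α P ξ Zξ μ)
    (hη : IsHarmonizable α P η Zη ν) (hindep : IndepFun (fun ω k => ξ k ω) (fun ω k => η k ω) P)
    {J : Lp ℂ (ENNReal.ofReal α) μ →L[ℂ] Lp ℂ 1 P} {K : Lp ℂ (ENNReal.ofReal α) ν →L[ℂ] Lp ℂ 1 P}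
    (hJ : ∀ c, J (stepLp μ (ENNReal.ofReal α) c) =ᵐ[P] stepIntegral Zξ c)
    (hK : ∀ c, K (stepLp ν (ENNReal.ofReal α) c) =ᵐ[P] stepIntegral Zη c)
    (hJ' : ∀ φ, HasScale α P (J φ) (‖φ‖ ^ α)) (hK' : ∀ φ, HasScale α P (K φ) (‖φ‖ ^ α))
    (φ : Lp ℂ (ENNReal.ofReal α) μ) (ψ : Lp ℂ (ENNReal.ofReal α) ν) :
    HasScale α P (J φ + K ψ : Lp ℂ 1 P) (‖φ‖ ^ α + ‖ψ‖ ^ α) := by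
  have hα0 : 0 < α := by linarith
  have hd := (denseRange_trigLp μ hξ.process.supp (ENNReal.ofReal α) ENNReal.ofReal_ne_top).prodMap
    (denseRange_trigLp ν hη.process.supp (ENNReal.ofReal α) ENNReal.ofReal_ne_top)
  refine hd.induction_on (p := fun x => HasScale α P (J x.1 + K x.2 : Lp ℂ 1 P)
    (‖x.1‖ ^ α + ‖x.2‖ ^ α)) (φ, ψ) ?_ fun c => ?_
  · refine isClosed_setOf_hasScale hα0 (J := fun x : Lp ℂ (ENNReal.ofReal α) μ ×
      Lp ℂ (ENNReal.ofReal α) ν => J x.1 + K x.2) (by fun_prop)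
      (N := fun x => ‖x.1‖ ^ α + ‖x.2‖ ^ α) ?_
    exact (continuous_fst.norm.rpow_const fun _ => Or.inr hα0.le).add
      (continuous_snd.norm.rpow_const fun _ => Or.inr hα0.le)
  · have h1 := hξ.integral_trigLp hα hJ c.1
    have h2 := hη.integral_trigLp hα hK c.2
    have hm : ∀ d : ℤ →₀ ℂ, Measurable fun x : ℤ → ℂ => d.sum fun n a => a * x n := fun d => by
      unfold Finsupp.sum; fun_prop
    have h3 : IndepFun (fun ω => c.1.sum fun n a => a * ξ n ω)
        (fun ω => c.2.sum fun n a => a * η n ω) P := hindep.comp (hm c.1) (hm c.2)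
    refine (((hJ' _).congr h1).add_of_indepFun hα0 ((hK' _).congr h2) h3).congr ?_
    exact ((Lp.coeFn_add _ _).trans (h1.add h2)).symm

end StableIntegral

/-! ### Convexity inequalities for powers of the norm -/

section Convexity

variable {α : ℝ}

lemma signedPow_zero (β : ℝ) : signedPow β 0 = 0 := by simp [signedPow]

lemma norm_signedPow (hα : 1 < α) (z : ℂ) : ‖signedPow (α - 1) z‖ = ‖z‖ ^ (α - 1) := by
  rcases eq_or_ne z 0 with rfl | hz
  · simp [signedPow_zero, Real.zero_rpow (by linarith : α - 1 ≠ 0)]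
  · have : 0 < ‖z‖ := norm_pos_iff.2 hz
    rw [signedPow, norm_mul, RCLike.norm_conj, Complex.norm_of_nonneg (by positivity)]
    nth_rewrite 2 [← Real.rpow_one ‖z‖]
    rw [← Real.rpow_add this]
    congr 1; ring

lemma continuous_signedPow (hα : 1 < α) : Continuous (signedPow (α - 1)) := by
  rw [continuous_iff_continuousAt]
  intro z
  rcases eq_or_ne z 0 with rfl | hz
  · rw [ContinuousAt, signedPow_zero, tendsto_zero_iff_norm_tendsto_zero]
    simp_rw [norm_signedPow hα]
    have : Continuous fun z : ℂ => ‖z‖ ^ (α - 1) :=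
      continuous_norm.rpow_const fun _ => Or.inr (by linarith)
    have h0 := this.tendsto 0
    rwa [norm_zero, Real.zero_rpow (by linarith)] at h0
  · unfold signedPow
    apply ContinuousAt.mul
    · exact Complex.continuous_ofReal.continuousAt.comp
        (continuous_norm.continuousAt.rpow_const (Or.inl (norm_ne_zero_iff.2 hz)))
    · exact Complex.continuous_conj.continuousAt

lemma mul_rpow_sub_one_le (hα : 1 < α) {x y : ℝ} (hx : 0 ≤ x) (hy : 0 ≤ y) :
    x * y ^ (α - 1) ≤ x ^ α + y ^ α := by
  have key : ∀ s : ℝ, 0 ≤ s → s * s ^ (α - 1) = s ^ α := fun s hs => by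
    nth_rewrite 1 [← Real.rpow_one s]
    rw [← Real.rpow_add_of_nonneg hs zero_le_one (by linarith)]
    congr 1; ring
  have hx' : 0 ≤ x ^ α := by positivity
  have hy' : 0 ≤ y ^ α := by positivity
  rcases le_total x y with h | h
  · calc x * y ^ (α - 1) ≤ y * y ^ (α - 1) := by gcongr
      _ = y ^ α := key y hy
      _ ≤ _ := by linarith
  · calc x * y ^ (α - 1) ≤ x * x ^ (α - 1) := by gcongr
      _ = x ^ α := key x hx
      _ ≤ _ := by linarith

/-- The subgradient inequality for `‖·‖ ^ α`: with respect to the pairing `Re (w * v)`, the gradient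
at `z` is `α z^{<α-1>}`. -/
lemma rpow_norm_add_ge (hα : 1 < α) (z w : ℂ) :
    ‖z‖ ^ α + α * (w * signedPow (α - 1) z).re ≤ ‖z + w‖ ^ α := by
  have hα0 : 0 < α := by linarith
  have h1 : ((z + w) * signedPow (α - 1) z).re ≤ ‖z + w‖ * ‖z‖ ^ (α - 1) := by
    refine (Complex.re_le_norm _).trans ?_
    rw [norm_mul, norm_signedPow hα]
  rw [add_mul, Complex.add_re, mul_signedPow_self hα, Complex.ofReal_re] at h1
  have h2 := Real.young_inequality_of_nonneg (norm_nonneg (z + w))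
    (by positivity : 0 ≤ ‖z‖ ^ (α - 1)) (Real.HolderConjugate.conjExponent hα)
  have h3 : (‖z‖ ^ (α - 1)) ^ (Real.conjExponent α) = ‖z‖ ^ α := by
    rw [← Real.rpow_mul (norm_nonneg _), Real.conjExponent, mul_div_cancel₀ _ (by linarith)]
  rw [h3, Real.conjExponent] at h2
  have h4 : ‖z‖ ^ α + (w * signedPow (α - 1) z).re ≤ ‖z + w‖ ^ α / α + ‖z‖ ^ α / (α / (α - 1)) :=
    h1.trans h2
  have h5 : ‖z‖ ^ α / (α / (α - 1)) = ‖z‖ ^ α - ‖z‖ ^ α / α := by field_simp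
  rw [h5] at h4
  have h6 : ‖z + w‖ ^ α = α * (‖z + w‖ ^ α / α) := by field_simp
  have h7 : ‖z‖ ^ α = α * (‖z‖ ^ α / α) := by field_simp
  nlinarith

lemma re_mul_signedPow_le (hα : 1 < α) (w z : ℂ) :
    (w * signedPow (α - 1) z).re ≤ ‖w‖ * ‖z‖ ^ (α - 1) := by
  refine (Complex.re_le_norm _).trans ?_
  rw [norm_mul, norm_signedPow hα]

lemma rpow_eq_mul_rpow_sub_one (hα : 1 < α) {s : ℝ} (hs : 0 ≤ s) : s ^ α = s * s ^ (α - 1) := by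
  nth_rewrite 2 [← Real.rpow_one s]
  rw [← Real.rpow_add_of_nonneg hs zero_le_one (by linarith)]
  congr 1; ring

lemma re_signedPow_mono_expand (hα : 1 < α) (z w : ℂ) :
    ((w - z) * (signedPow (α - 1) w - signedPow (α - 1) z)).re
      = ‖w‖ ^ α + ‖z‖ ^ α - (z * signedPow (α - 1) w).re - (w * signedPow (α - 1) z).re := by
  have : (w - z) * (signedPow (α - 1) w - signedPow (α - 1) z)
      = w * signedPow (α - 1) w + z * signedPow (α - 1) z - z * signedPow (α - 1) w
        - w * signedPow (α - 1) z := by ring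
  rw [this, mul_signedPow_self hα, mul_signedPow_self hα]
  simp only [Complex.sub_re, Complex.add_re, Complex.ofReal_re]

lemma norm_factor_nonneg (hα : 1 < α) {x y : ℝ} (hx : 0 ≤ x) (hy : 0 ≤ y) :
    0 ≤ (x ^ (α - 1) - y ^ (α - 1)) * (x - y) := by
  rcases le_total x y with h | h
  · have := Real.rpow_le_rpow hx h (by linarith : 0 ≤ α - 1)
    nlinarith
  · have := Real.rpow_le_rpow hy h (by linarith : 0 ≤ α - 1)
    nlinarith

/-- Monotonicity of `z ↦ z^{<α-1>}` with respect to the pairing `Re (w * v)`. -/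
lemma re_signedPow_mono (hα : 1 < α) (z w : ℂ) :
    0 ≤ ((w - z) * (signedPow (α - 1) w - signedPow (α - 1) z)).re := by
  rw [re_signedPow_mono_expand hα]
  have h1 := re_mul_signedPow_le hα z w
  have h2 := re_mul_signedPow_le hα w z
  have h3 := norm_factor_nonneg hα (norm_nonneg w) (norm_nonneg z)
  rw [rpow_eq_mul_rpow_sub_one hα (norm_nonneg w), rpow_eq_mul_rpow_sub_one hα (norm_nonneg z)]
  nlinarith

/-- Strict monotonicity of `z ↦ z^{<α-1>}`: equality forces equal norms, and then equality in the
Cauchy-Schwarz inequality. -/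
lemma eq_of_re_signedPow_mono (hα : 1 < α) {z w : ℂ}
    (h : ((w - z) * (signedPow (α - 1) w - signedPow (α - 1) z)).re = 0) : w = z := by
  have hα1 : 0 < α - 1 := by linarith
  have hnorm : ‖w‖ = ‖z‖ := by
    rw [re_signedPow_mono_expand hα] at h
    have h1 := re_mul_signedPow_le hα z w
    have h2 := re_mul_signedPow_le hα w z
    rw [rpow_eq_mul_rpow_sub_one hα (norm_nonneg w), rpow_eq_mul_rpow_sub_one hα (norm_nonneg z)] at h
    by_contra hne
    have h3 : 0 < (‖w‖ ^ (α - 1) - ‖z‖ ^ (α - 1)) * (‖w‖ - ‖z‖) := by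
      rcases lt_or_gt_of_ne hne with h' | h'
      · have := Real.rpow_lt_rpow (norm_nonneg _) h' hα1
        nlinarith
      · have := Real.rpow_lt_rpow (norm_nonneg _) h' hα1
        nlinarith
    nlinarith
  rcases eq_or_ne z 0 with rfl | hz
  · rw [norm_zero, norm_eq_zero] at hnorm
    exact hnorm
  · have hpos : 0 < ‖z‖ ^ (α - 1 - 1) := Real.rpow_pos_of_pos (norm_pos_iff.2 hz) _
    rw [signedPow, signedPow, hnorm, ← mul_sub, mul_left_comm, Complex.re_ofReal_mul, ← map_sub,
      Complex.mul_conj, Complex.ofReal_re] at h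
    have := (mul_eq_zero.1 h).resolve_left hpos.ne'
    exact sub_eq_zero.1 (Complex.normSq_eq_zero.1 this)

lemma rpow_norm_add_gt (hα : 1 < α) (z : ℂ) {w : ℂ} (hw : w ≠ 0) :
    ‖z‖ ^ α + α * (w * signedPow (α - 1) z).re < ‖z + w‖ ^ α := by
  have h1 := rpow_norm_add_ge hα z (w / 2)
  have h2 := rpow_norm_add_ge hα (z + w / 2) (w / 2)
  have h3 := re_signedPow_mono hα z (z + w / 2)
  have h4 : ((z + w / 2 - z) * (signedPow (α - 1) (z + w / 2) - signedPow (α - 1) z)).re ≠ 0 := by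
    intro h
    have := eq_of_re_signedPow_mono hα h
    simp at this
    exact hw this
  have h5 := lt_of_le_of_ne h3 h4.symm
  rw [add_sub_cancel_left, mul_sub, Complex.sub_re] at h5
  rw [show z + w / 2 + w / 2 = z + w by ring] at h2
  have h6 : (w * signedPow (α - 1) z).re = 2 * (w / 2 * signedPow (α - 1) z).re := by
    have : w * signedPow (α - 1) z = ((2 : ℝ) : ℂ) * (w / 2 * signedPow (α - 1) z) := by
      push_cast; ring
    rw [this, Complex.re_ofReal_mul]
  rw [h6]
  nlinarith

/-- The convexity defect of `‖·‖ ^ α` at the midpoint. -/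
noncomputable def midDefect (α : ℝ) (a b : ℂ) : ℝ := ‖a‖ ^ α + ‖b‖ ^ α - 2 * ‖(a + b) / 2‖ ^ α

lemma midDefect_pos (hα : 1 < α) {a b : ℂ} (h : a ≠ b) : 0 < midDefect α a b := by
  have hw : (a - b) / 2 ≠ 0 := div_ne_zero (sub_ne_zero.2 h) two_ne_zero
  have h1 := rpow_norm_add_gt hα ((a + b) / 2) hw
  have h2 := rpow_norm_add_gt hα ((a + b) / 2) (neg_ne_zero.2 hw)
  rw [show (a + b) / 2 + (a - b) / 2 = a by ring] at h1
  rw [show (a + b) / 2 + -((a - b) / 2) = b by ring, neg_mul, Complex.neg_re] at h2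
  unfold midDefect
  linarith

lemma midDefect_nonneg (hα : 1 < α) (a b : ℂ) : 0 ≤ midDefect α a b := by
  rcases eq_or_ne a b with rfl | h
  · simp [midDefect, ← two_mul]
  · exact (midDefect_pos hα h).le

lemma rpow_norm_sub_le (hα : 0 < α) (a b : ℂ) :
    ‖a - b‖ ^ α ≤ 2 ^ α * (‖a‖ ^ α + ‖b‖ ^ α) := by
  have h1 : ‖a - b‖ ≤ 2 * max ‖a‖ ‖b‖ := by
    refine (norm_sub_le a b).trans ?_
    linarith [le_max_left ‖a‖ ‖b‖, le_max_right ‖a‖ ‖b‖]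
  have ha : 0 ≤ ‖a‖ ^ α := by positivity
  have hb : 0 ≤ ‖b‖ ^ α := by positivity
  calc ‖a - b‖ ^ α ≤ (2 * max ‖a‖ ‖b‖) ^ α := by gcongr
    _ = 2 ^ α * (max ‖a‖ ‖b‖) ^ α := Real.mul_rpow (by norm_num) (by positivity)
    _ ≤ 2 ^ α * (‖a‖ ^ α + ‖b‖ ^ α) := by
      gcongr
      rcases max_choice ‖a‖ ‖b‖ with h | h <;> rw [h] <;> linarith

lemma isCompact_normalized_pairs (hα : 0 < α) (ε : ℝ) :
    IsCompact {x : ℂ × ℂ | ‖x.1‖ ^ α + ‖x.2‖ ^ α = 1 ∧ ε ≤ ‖x.1 - x.2‖ ^ α} := by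
  have hc : ∀ F : ℂ × ℂ → ℂ, Continuous F → Continuous fun x => ‖F x‖ ^ α := fun F hF =>
    hF.norm.rpow_const fun _ => Or.inr hα.le
  refine Metric.isCompact_of_isClosed_isBounded ?_ ?_
  · exact (isClosed_eq ((hc _ continuous_fst).add (hc _ continuous_snd)) continuous_const).inter
      (isClosed_le continuous_const (hc _ (continuous_fst.sub continuous_snd)))
  · refine (Metric.isBounded_closedBall (x := (0 : ℂ × ℂ)) (r := 1)).subset ?_
    rintro ⟨a, b⟩ ⟨h, -⟩
    have ha : 0 ≤ ‖a‖ ^ α := by positivity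
    have hb : 0 ≤ ‖b‖ ^ α := by positivity
    simp only at h
    rw [mem_closedBall_zero_iff, Prod.norm_def, max_le_iff]
    constructor <;> by_contra! hlt
    · linarith [Real.one_lt_rpow hlt hα]
    · linarith [Real.one_lt_rpow hlt hα]

/-- A uniform convexity inequality for `‖·‖ ^ α` that can be integrated directly.  By homogeneity
it is a statement about normalized pairs, which form a compact set. -/
lemma exists_rpow_norm_sub_le (hα : 1 < α) {ε : ℝ} (hε : 0 < ε) :
    ∃ C, 0 ≤ C ∧ ∀ a b : ℂ,
      ‖a - b‖ ^ α ≤ ε * (‖a‖ ^ α + ‖b‖ ^ α) + C * midDefect α a b := by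
  have hα0 : 0 < α := by linarith
  obtain ⟨δ, hδ, hS⟩ : ∃ δ > 0, ∀ a b : ℂ, ‖a‖ ^ α + ‖b‖ ^ α = 1 → ε ≤ ‖a - b‖ ^ α →
      δ ≤ midDefect α a b := by
    have hK := isCompact_normalized_pairs hα0 ε
    rcases Set.eq_empty_or_nonempty
      {x : ℂ × ℂ | ‖x.1‖ ^ α + ‖x.2‖ ^ α = 1 ∧ ε ≤ ‖x.1 - x.2‖ ^ α} with h | h
    · refine ⟨1, one_pos, fun a b h1 h2 => ?_⟩
      have : (a, b) ∈ {x : ℂ × ℂ | ‖x.1‖ ^ α + ‖x.2‖ ^ α = 1 ∧ ε ≤ ‖x.1 - x.2‖ ^ α} := ⟨h1, h2⟩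
      rw [h] at this
      exact absurd this (Set.notMem_empty _)
    · have hcont : Continuous fun x : ℂ × ℂ => midDefect α x.1 x.2 := by
        have hc : ∀ F : ℂ × ℂ → ℂ, Continuous F → Continuous fun x => ‖F x‖ ^ α := fun F hF =>
          hF.norm.rpow_const fun _ => Or.inr hα0.le
        exact ((hc _ continuous_fst).add (hc _ continuous_snd)).sub
          (continuous_const.mul (hc _ (by fun_prop)))
      obtain ⟨x, hx, hmin⟩ := hK.exists_isMinOn h hcont.continuousOn
      refine ⟨midDefect α x.1 x.2, midDefect_pos hα ?_, fun a b h1 h2 => hmin (a := (a, b)) ⟨h1, h2⟩⟩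
      intro h0
      have := hx.2
      rw [h0, sub_self, norm_zero, Real.zero_rpow hα0.ne'] at this
      linarith
  refine ⟨2 ^ α / δ, by positivity, fun a b => ?_⟩
  have hD := midDefect_nonneg hα a b
  set s := ‖a‖ ^ α + ‖b‖ ^ α with hs
  have hs0 : 0 ≤ s := by positivity
  by_cases hlt : ‖a - b‖ ^ α ≤ ε * s
  · have : 0 ≤ 2 ^ α / δ * midDefect α a b := by positivity
    linarith
  push Not at hlt
  have hle := rpow_norm_sub_le hα0 a b
  have hspos : 0 < s := by
    rcases hs0.eq_or_lt with h | h
    · rw [← hs, ← h] at hle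
      rw [← h] at hlt
      linarith
    · exact h
  set r : ℝ := s ^ (-(1 / α)) with hr
  have hrpos : 0 < r := Real.rpow_pos_of_pos hspos _
  have hrα : r ^ α = s⁻¹ := by
    rw [hr, ← Real.rpow_mul hs0, neg_mul, one_div_mul_cancel hα0.ne', Real.rpow_neg_one]
  have hscale : ∀ z : ℂ, ‖(r : ℂ) * z‖ ^ α = s⁻¹ * ‖z‖ ^ α := fun z => by
    rw [norm_mul, Complex.norm_of_nonneg hrpos.le, Real.mul_rpow hrpos.le (norm_nonneg _), hrα]
  have h1 := hS (r * a) (r * b) (by rw [hscale, hscale, ← mul_add, ← hs, inv_mul_cancel₀ hspos.ne'])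
    (by
      rw [← mul_sub, hscale, ← div_eq_inv_mul, le_div_iff₀ hspos]
      exact hlt.le)
  have h2 : midDefect α (r * a) (r * b) = s⁻¹ * midDefect α a b := by
    unfold midDefect
    rw [hscale, hscale, ← mul_add (r : ℂ), mul_div_assoc, hscale]
    ring
  rw [h2, ← div_eq_inv_mul, le_div_iff₀ hspos] at h1
  calc ‖a - b‖ ^ α ≤ 2 ^ α * s := hle
    _ = 2 ^ α / δ * (δ * s) := by field_simp
    _ ≤ 2 ^ α / δ * midDefect α a b := by gcongr
    _ ≤ _ := by
      have : 0 ≤ ε * s := by positivity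
      linarith

end Convexity

/-! ### Best approximation in `L^α` -/

section Minimization

variable {α : ℝ}

lemma Lp_norm_rpow {S : Type*} [MeasurableSpace S] {m : Measure S} (hα : 0 < α)
    (φ : Lp ℂ (ENNReal.ofReal α) m) : ‖φ‖ ^ α = ∫ x, ‖φ x‖ ^ α ∂m := by
  have := norm_toLp_rpow hα (Lp.memLp φ)
  rwa [Lp.toLp_coeFn] at this

lemma MemLp.integrable_norm_rpow_ofReal {S : Type*} [MeasurableSpace S] {m : Measure S}
    (hα : 0 < α) {F : S → ℂ} (hF : MemLp F (ENNReal.ofReal α) m) :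
    Integrable (fun x => ‖F x‖ ^ α) m := by
  have := hF.integrable_norm_rpow (by simpa using hα) ENNReal.ofReal_ne_top
  rwa [ENNReal.toReal_ofReal hα.le] at this

variable [Fact (1 ≤ ENNReal.ofReal α)]

omit [Fact (1 ≤ ENNReal.ofReal α)] in
/-- Uniform convexity of `L^α`, with constants that do not depend on the measure. -/
lemma exists_Lp_norm_sub_le (hα : 1 < α) {ε : ℝ} (hε : 0 < ε) :
    ∃ C, 0 ≤ C ∧ ∀ {m : Measure ℝ} (a b : Lp ℂ (ENNReal.ofReal α) m), ‖a - b‖ ^ α ≤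
      ε * (‖a‖ ^ α + ‖b‖ ^ α) + C * (‖a‖ ^ α + ‖b‖ ^ α - 2 * ‖(2⁻¹ : ℂ) • (a + b)‖ ^ α) := by
  have hα0 : 0 < α := by linarith
  obtain ⟨C, hC, h⟩ := exists_rpow_norm_sub_le hα hε
  refine ⟨C, hC, fun {m} a b => ?_⟩
  have hi : ∀ φ : Lp ℂ (ENNReal.ofReal α) m, Integrable (fun x => ‖φ x‖ ^ α) m := fun φ =>
    MemLp.integrable_norm_rpow_ofReal hα0 (Lp.memLp φ)
  simp only [Lp_norm_rpow hα0]
  have s1 : Integrable (fun x => ‖a x‖ ^ α + ‖b x‖ ^ α) m := (hi a).add (hi b)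
  have s2 : Integrable (fun x => ‖a x‖ ^ α + ‖b x‖ ^ α - 2 * ‖((2⁻¹ : ℂ) • (a + b) :
      Lp ℂ (ENNReal.ofReal α) m) x‖ ^ α) m := s1.sub ((hi _).const_mul 2)
  rw [← integral_add (hi a) (hi b), ← integral_const_mul, ← integral_const_mul,
    ← integral_sub s1 ((hi _).const_mul 2), ← integral_const_mul,
    ← integral_add (s1.const_mul ε) (s2.const_mul C)]
  refine integral_mono_ae (hi _) ((s1.const_mul ε).add (s2.const_mul C)) ?_
  filter_upwards [Lp.coeFn_sub a b, Lp.coeFn_smul (2⁻¹ : ℂ) (a + b), Lp.coeFn_add a b]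
    with x h1 h2 h3
  have := h (a x) (b x)
  rw [h1, h2, Pi.smul_apply, h3, Pi.sub_apply, Pi.add_apply, smul_eq_mul, ← div_eq_inv_mul]
  exact this

/-- Best approximation in `L^α`: the functional `‖A - R h‖ ^ α + ‖T h‖ ^ α` has a unique minimizer
on a closed subspace, as minimizing sequences are Cauchy by uniform convexity. -/
theorem exists_unique_minimizer (hα : 1 < α) {μ ν m : Measure ℝ}
    (R : Lp ℂ (ENNReal.ofReal α) m →L[ℂ] Lp ℂ (ENNReal.ofReal α) μ)
    (T : Lp ℂ (ENNReal.ofReal α) m →L[ℂ] Lp ℂ (ENNReal.ofReal α) ν)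
    (hRT : ∀ h, ‖h‖ ^ α = ‖R h‖ ^ α + ‖T h‖ ^ α) (A : Lp ℂ (ENNReal.ofReal α) μ)
    {S : Submodule ℂ (Lp ℂ (ENNReal.ofReal α) m)}
    (hS : IsClosed (S : Set (Lp ℂ (ENNReal.ofReal α) m))) :
    ∃ h ∈ S, (∀ w ∈ S, ‖A - R h‖ ^ α + ‖T h‖ ^ α ≤ ‖A - R w‖ ^ α + ‖T w‖ ^ α) ∧
      ∀ h' ∈ S, (∀ w ∈ S, ‖A - R h'‖ ^ α + ‖T h'‖ ^ α ≤ ‖A - R w‖ ^ α + ‖T w‖ ^ α) → h' = h := by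
  have hα0 : 0 < α := by linarith
  let F : Lp ℂ (ENNReal.ofReal α) m → ℝ := fun h => ‖A - R h‖ ^ α + ‖T h‖ ^ α
  have hF0 : ∀ h, 0 ≤ F h := fun h => by positivity
  have hFc : Continuous F :=
    ((continuous_const.sub R.continuous).norm.rpow_const fun _ => Or.inr hα0.le).add
      (T.continuous.norm.rpow_const fun _ => Or.inr hα0.le)
  let d : ℝ := sInf (F '' S)
  have hbdd : BddBelow (F '' S) := ⟨0, by rintro _ ⟨h, -, rfl⟩; exact hF0 h⟩
  have hne : (F '' S).Nonempty := ⟨F 0, 0, S.zero_mem, rfl⟩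
  have hd : ∀ h ∈ S, d ≤ F h := fun h hh => csInf_le hbdd ⟨h, hh, rfl⟩
  have hd0 : 0 ≤ d := le_csInf hne (by rintro _ ⟨h, -, rfl⟩; exact hF0 h)
  have key : ∀ ε > 0, ∃ C, 0 ≤ C ∧ ∀ h ∈ S, ∀ w ∈ S,
      ‖h - w‖ ^ α ≤ ε * (F h + F w) + C * (F h + F w - 2 * d) := by
    intro ε hε
    obtain ⟨C, hC, hC'⟩ := exists_Lp_norm_sub_le hα hε
    refine ⟨C, hC, fun h hh w hw => ?_⟩
    have h1 := hC' (A - R h) (A - R w)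
    have h2 := hC' (T h) (T w)
    have h3 := hd ((2⁻¹ : ℂ) • (h + w)) (S.smul_mem _ (S.add_mem hh hw))
    have e1 : (2⁻¹ : ℂ) • (A - R h + (A - R w)) = A - R ((2⁻¹ : ℂ) • (h + w)) := by
      rw [map_smul, map_add]
      have : A = (2⁻¹ : ℂ) • (A + A) := by
        rw [← two_smul ℂ A, smul_smul]; norm_num
      nth_rewrite 3 [this]
      rw [← smul_sub]; congr 1; abel
    have e2 : (2⁻¹ : ℂ) • (T h + T w) = T ((2⁻¹ : ℂ) • (h + w)) := by rw [map_smul, map_add]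
    rw [sub_sub_sub_cancel_left, norm_sub_rev, ← map_sub, e1] at h1
    rw [← map_sub, e2] at h2
    rw [hRT (h - w)]
    have h4 : C * (2 * d) ≤ C * (2 * F ((2⁻¹ : ℂ) • (h + w))) := by gcongr
    simp only [F] at h4 ⊢
    linarith
  have hseq : ∀ n : ℕ, ∃ h ∈ S, F h < d + 1 / (n + 1 : ℝ) := fun n => by
    obtain ⟨_, ⟨h, hh, rfl⟩, hlt⟩ := exists_lt_of_csInf_lt hne
      (lt_add_of_pos_right d (by positivity : (0 : ℝ) < 1 / (n + 1 : ℝ)))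
    exact ⟨h, hh, hlt⟩
  choose u huS hu using hseq
  have hu1 : ∀ n, F (u n) ≤ d + 1 := fun n => by
    refine (hu n).le.trans ?_
    have : (1 : ℝ) / (n + 1) ≤ 1 := by
      rw [div_le_one (by positivity)]
      have : (0 : ℝ) ≤ n := by positivity
      linarith
    linarith
  have hcauchy : CauchySeq u := by
    rw [Metric.cauchySeq_iff]
    intro r hr
    have hrα : 0 < r ^ α := by positivity
    obtain ⟨C, hC, hC'⟩ := key (r ^ α / (4 * (d + 1))) (by positivity)
    obtain ⟨N, hN⟩ := exists_nat_one_div_lt (show 0 < r ^ α / (4 * (C + 1)) by positivity)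
    refine ⟨N, fun n hn k hk => ?_⟩
    have hle : ∀ j ≥ N, F (u j) ≤ d + r ^ α / (4 * (C + 1)) := fun j hj => by
      refine (hu j).le.trans ?_
      have : (1 : ℝ) / (j + 1) ≤ 1 / (N + 1) := by gcongr
      linarith
    have h1 := hC' (u n) (huS n) (u k) (huS k)
    have h2 : r ^ α / (4 * (d + 1)) * (F (u n) + F (u k)) ≤ r ^ α / 2 := by
      calc r ^ α / (4 * (d + 1)) * (F (u n) + F (u k))
          ≤ r ^ α / (4 * (d + 1)) * ((d + 1) + (d + 1)) := by gcongr <;> apply hu1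
        _ = r ^ α / 2 := by field_simp; ring
    have h3 : C * (F (u n) + F (u k) - 2 * d) < r ^ α / 2 := by
      calc C * (F (u n) + F (u k) - 2 * d)
          ≤ C * (2 * (r ^ α / (4 * (C + 1)))) := by
            gcongr
            linarith [hle n hn, hle k hk]
        _ < (C + 1) * (2 * (r ^ α / (4 * (C + 1)))) := by
            gcongr; linarith
        _ = r ^ α / 2 := by field_simp; ring
    rw [dist_eq_norm]
    exact (Real.rpow_lt_rpow_iff (norm_nonneg _) hr.le hα0).1 (by linarith)
  obtain ⟨h, hlim⟩ := cauchySeq_tendsto_of_complete hcauchy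
  have hhS : h ∈ S := hS.mem_of_tendsto hlim (Eventually.of_forall huS)
  have hFh : F h = d := by
    refine tendsto_nhds_unique ((hFc.tendsto h).comp hlim) ?_
    refine tendsto_of_tendsto_of_tendsto_of_le_of_le tendsto_const_nhds ?_
      (fun n => hd _ (huS n)) (fun n => (hu n).le)
    simpa using (tendsto_const_nhds (x := d)).add
      (tendsto_one_div_add_atTop_nhds_zero_nat (𝕜 := ℝ))
  refine ⟨h, hhS, fun w hw => hFh.le.trans (hd w hw), fun h' hh' hmin => ?_⟩
  have hFh' : F h' = d := le_antisymm ((hmin h hhS).trans hFh.le) (hd h' hh')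
  have hz : ‖h' - h‖ ^ α ≤ 0 := by
    apply le_of_forall_pos_le_add
    intro δ hδ
    obtain ⟨C, hC, hC'⟩ := key (δ / (2 * (d + 1))) (by positivity)
    have h1 := hC' h' hh' h hhS
    rw [hFh, hFh'] at h1
    have h2 : δ / (2 * (d + 1)) * (d + d) ≤ δ := by
      rw [div_mul_eq_mul_div, div_le_iff₀ (by positivity)]
      nlinarith
    nlinarith
  have := (Real.rpow_eq_zero (norm_nonneg (h' - h)) hα0.ne').1 (le_antisymm hz (by positivity))
  exact sub_eq_zero.1 (norm_eq_zero.1 this)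

/-- The pairing `∫ v φ^{<α-1>} dm`, whose real part is the derivative of `‖φ‖ ^ α / α` in direction
`v`. -/
noncomputable def dualPairing (α : ℝ) (m : Measure ℝ) (v φ : ℝ → ℂ) : ℂ :=
  ∫ θ, v θ * signedPow (α - 1) (φ θ) ∂m

omit [Fact (1 ≤ ENNReal.ofReal α)] in
lemma integrable_mul_signedPow (hα : 1 < α) {m : Measure ℝ} {v φ : ℝ → ℂ}
    (hv : MemLp v (ENNReal.ofReal α) m) (hφ : MemLp φ (ENNReal.ofReal α) m) :
    Integrable (fun θ => v θ * signedPow (α - 1) (φ θ)) m := by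
  have hα0 : 0 < α := by linarith
  refine Integrable.mono' ((MemLp.integrable_norm_rpow_ofReal hα0 hv).add
    (MemLp.integrable_norm_rpow_ofReal hα0 hφ))
    (hv.1.mul ((continuous_signedPow hα).comp_aestronglyMeasurable hφ.1)) (ae_of_all _ fun θ => ?_)
  rw [norm_mul, norm_signedPow hα]
  exact mul_rpow_sub_one_le hα (norm_nonneg _) (norm_nonneg _)

omit [Fact (1 ≤ ENNReal.ofReal α)] in
lemma Lp_rpow_norm_add_ge (hα : 1 < α) {m : Measure ℝ} (φ w : Lp ℂ (ENNReal.ofReal α) m) :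
    ‖φ‖ ^ α + α * (dualPairing α m w φ).re ≤ ‖φ + w‖ ^ α := by
  have hα0 : 0 < α := by linarith
  have hi : ∀ φ : Lp ℂ (ENNReal.ofReal α) m, Integrable (fun x => ‖φ x‖ ^ α) m := fun φ =>
    MemLp.integrable_norm_rpow_ofReal hα0 (Lp.memLp φ)
  have hj := integrable_mul_signedPow hα (Lp.memLp w) (Lp.memLp φ)
  have hre : (dualPairing α m w φ).re = ∫ θ, (w θ * signedPow (α - 1) (φ θ)).re ∂m :=
    (integral_re hj).symm
  have hj' : Integrable (fun θ => (w θ * signedPow (α - 1) (φ θ)).re) m := hj.re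
  rw [Lp_norm_rpow hα0, Lp_norm_rpow hα0, hre, ← integral_const_mul,
    ← integral_add (hi φ) (hj'.const_mul α)]
  refine integral_mono_ae ((hi φ).add (hj'.const_mul α)) (hi _) ?_
  filter_upwards [Lp.coeFn_add φ w] with x hx
  rw [hx]
  exact rpow_norm_add_ge hα _ _

omit [Fact (1 ≤ ENNReal.ofReal α)] in
lemma tendsto_dualPairing (hα : 1 < α) {m : Measure ℝ} (v φ w : Lp ℂ (ENNReal.ofReal α) m) :
    Tendsto (fun n : ℕ => dualPairing α m v (φ + ((1 / (n + 1 : ℝ) : ℝ) : ℂ) • w : Lp ℂ _ m))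
      atTop (𝓝 (dualPairing α m v φ)) := by
  have hα0 : 0 < α := by linarith
  have hbound : MemLp (fun θ => ((‖φ θ‖ + ‖w θ‖ : ℝ) : ℂ)) (ENNReal.ofReal α) m :=
    ((Lp.memLp φ).norm.add (Lp.memLp w).norm).ofReal
  have hc : ∀ n : ℕ, (φ + ((1 / (n + 1 : ℝ) : ℝ) : ℂ) • w : Lp ℂ (ENNReal.ofReal α) m)
      =ᵐ[m] fun θ => φ θ + ((1 / (n + 1 : ℝ) : ℝ) : ℂ) * w θ := fun n => by
    filter_upwards [Lp.coeFn_add φ (((1 / (n + 1 : ℝ) : ℝ) : ℂ) • w),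
      Lp.coeFn_smul ((1 / (n + 1 : ℝ) : ℝ) : ℂ) w] with θ h1 h2
    rw [h1, Pi.add_apply, h2, Pi.smul_apply, smul_eq_mul]
  refine tendsto_integral_of_dominated_convergence
    (fun θ => ‖v θ‖ ^ α + ‖((‖φ θ‖ + ‖w θ‖ : ℝ) : ℂ)‖ ^ α)
    (fun n => (integrable_mul_signedPow hα (Lp.memLp v) (Lp.memLp _)).aestronglyMeasurable)
    ((MemLp.integrable_norm_rpow_ofReal hα0 (Lp.memLp v)).add
      (MemLp.integrable_norm_rpow_ofReal hα0 hbound)) (fun n => ?_) ?_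
  · filter_upwards [hc n] with θ hθ
    rw [norm_mul, norm_signedPow hα, hθ]
    have hle : ‖φ θ + ((1 / (n + 1 : ℝ) : ℝ) : ℂ) * w θ‖ ≤ ‖((‖φ θ‖ + ‖w θ‖ : ℝ) : ℂ)‖ := by
      rw [Complex.norm_of_nonneg (by positivity)]
      refine (norm_add_le _ _).trans ?_
      rw [norm_mul, Complex.norm_of_nonneg (by positivity)]
      have : (1 : ℝ) / (n + 1) ≤ 1 := by
        rw [div_le_one (by positivity)]
        have : (0 : ℝ) ≤ n := by positivity
        linarith
      nlinarith [norm_nonneg (w θ)]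
    refine (mul_rpow_sub_one_le hα (norm_nonneg _) (norm_nonneg _)).trans ?_
    gcongr
  · filter_upwards [ae_all_iff.2 hc] with θ hθ
    simp_rw [hθ]
    refine tendsto_const_nhds.mul (((continuous_signedPow hα).tendsto _).comp ?_)
    have h1 : Tendsto (fun n : ℕ => ((1 / (n + 1 : ℝ) : ℝ) : ℂ)) atTop (𝓝 ((0 : ℝ) : ℂ)) :=
      (Complex.continuous_ofReal.tendsto _).comp tendsto_one_div_add_atTop_nhds_zero_nat
    have := tendsto_const_nhds (x := φ θ) |>.add (h1.mul_const (w θ))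
    simpa using this

omit [Fact (1 ≤ ENNReal.ofReal α)] in
lemma dualPairing_smul {m : Measure ℝ} (c : ℂ) {v v' φ : ℝ → ℂ} (h : v' =ᵐ[m] fun θ => c * v θ) :
    dualPairing α m v' φ = c * dualPairing α m v φ := by
  rw [dualPairing, dualPairing, ← integral_const_mul]
  apply integral_congr_ae
  filter_upwards [h] with θ hθ
  rw [hθ, mul_assoc]

/-- The first order condition for a minimizer.  The subgradient inequality is used at the points
`h + v / (n + 1)`, which avoids differentiating under the integral. -/
theorem dualPairing_eq_of_minimizer (hα : 1 < α) {μ ν m : Measure ℝ}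
    (R : Lp ℂ (ENNReal.ofReal α) m →L[ℂ] Lp ℂ (ENNReal.ofReal α) μ)
    (T : Lp ℂ (ENNReal.ofReal α) m →L[ℂ] Lp ℂ (ENNReal.ofReal α) ν)
    (A : Lp ℂ (ENNReal.ofReal α) μ) {S : Submodule ℂ (Lp ℂ (ENNReal.ofReal α) m)}
    {h : Lp ℂ (ENNReal.ofReal α) m} (hh : h ∈ S)
    (hmin : ∀ w ∈ S, ‖A - R h‖ ^ α + ‖T h‖ ^ α ≤ ‖A - R w‖ ^ α + ‖T w‖ ^ α)
    {v : Lp ℂ (ENNReal.ofReal α) m} (hv : v ∈ S) :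
    dualPairing α μ (R v) (A - R h : Lp ℂ _ μ) = dualPairing α ν (T v) (T h) := by
  have key : ∀ v ∈ S, (dualPairing α μ (R v) (A - R h : Lp ℂ _ μ)).re
      ≤ (dualPairing α ν (T v) (T h)).re := by
    intro v hv
    have h1 := tendsto_dualPairing hα (R v) (A - R h) (-R v)
    have h2 := tendsto_dualPairing hα (T v) (T h) (T v)
    refine le_of_tendsto_of_tendsto' ((Complex.continuous_re.tendsto _).comp h1)
      ((Complex.continuous_re.tendsto _).comp h2) fun n => ?_
    simp only [Function.comp]
    set ε : ℝ := 1 / (n + 1 : ℝ) with hε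
    have hε0 : 0 < ε := by positivity
    have h3 := hmin (h + (ε : ℂ) • v) (S.add_mem hh (S.smul_mem _ hv))
    have h4 := Lp_rpow_norm_add_ge hα (A - R h + (ε : ℂ) • -R v) ((ε : ℂ) • R v)
    have h5 := Lp_rpow_norm_add_ge hα (T h + (ε : ℂ) • T v) (((-ε : ℝ) : ℂ) • T v)
    have e1 : A - R (h + (ε : ℂ) • v) = A - R h + (ε : ℂ) • -R v := by
      rw [map_add, map_smul, smul_neg]; abel
    have e2 : T (h + (ε : ℂ) • v) = T h + (ε : ℂ) • T v := by rw [map_add, map_smul]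
    rw [e1, e2] at h3
    rw [show A - R h + (ε : ℂ) • -R v + (ε : ℂ) • R v = A - R h by rw [smul_neg]; abel,
      dualPairing_smul (m := μ) (ε : ℂ) (Lp.coeFn_smul _ (R v)), Complex.re_ofReal_mul] at h4
    rw [show T h + (ε : ℂ) • T v + ((-ε : ℝ) : ℂ) • T v = T h by
        rw [Complex.ofReal_neg, neg_smul]; abel,
      dualPairing_smul (m := ν) ((-ε : ℝ) : ℂ)
        (Lp.coeFn_smul _ (T v)), Complex.re_ofReal_mul] at h5
    have h6 : 0 < α * ε := by positivity
    have h7 : (α * ε) * (dualPairing α μ (R v) (A - R h + (ε : ℂ) • -R v : Lp ℂ _ μ)).re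
        ≤ (α * ε) * (dualPairing α ν (T v) (T h + (ε : ℂ) • T v : Lp ℂ _ ν)).re := by
      nlinarith
    exact le_of_mul_le_mul_left h7 h6
  have key2 : ∀ c : ℂ, (c * dualPairing α μ (R v) (A - R h : Lp ℂ _ μ)).re
      ≤ (c * dualPairing α ν (T v) (T h)).re := by
    intro c
    have := key (c • v) (S.smul_mem c hv)
    rw [map_smul, map_smul, dualPairing_smul (m := μ) c (Lp.coeFn_smul c (R v)),
      dualPairing_smul (m := ν) c (Lp.coeFn_smul c (T v))] at this
    exact this
  have a1 := key2 1
  have a2 := key2 (-1)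
  have a3 := key2 Complex.I
  have a4 := key2 (-Complex.I)
  simp at a1 a2 a3 a4
  exact Complex.ext (le_antisymm a1 a2) (le_antisymm a4 a3)

end Minimization

/-! ### Fourier coefficients on `(-π, π]` -/

section Hardy

/-- Lebesgue measure on `(-π, π]`. -/
noncomputable abbrev circMeas : Measure ℝ := volume.restrict (Set.Ioc (-Real.pi) Real.pi)

lemma circMeas_real_univ : circMeas.real Set.univ = 2 * Real.pi := by
  rw [measureReal_restrict_apply MeasurableSet.univ, Set.univ_inter, Real.volume_real_Ioc_of_le
    (by linarith [Real.pi_pos])]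
  ring

lemma circMeas_compl : circMeas (Set.Ioc (-Real.pi) Real.pi)ᶜ = 0 := by
  rw [Measure.restrict_apply measurableSet_Ioc.compl]; simp

lemma integral_expi (n : ℤ) : ∫ θ, expi n θ ∂circMeas = if n = 0 then 2 * (Real.pi : ℂ) else 0 := by
  split_ifs with h
  · subst h
    simp_rw [expi_zero]
    rw [integral_const, circMeas_real_univ]; simp
  · have hn : Complex.I * (n : ℂ) ≠ 0 := mul_ne_zero Complex.I_ne_zero (by exact_mod_cast h)
    rw [← intervalIntegral.integral_of_le (by linarith [Real.pi_pos])]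
    unfold expi
    rw [integral_exp_mul_complex hn, div_eq_zero_iff]
    left
    rw [sub_eq_zero, Complex.exp_eq_exp_iff_exists_int]
    exact ⟨n, by push_cast; ring⟩

lemma integrable_expi_mul {m : Measure ℝ} {F : ℝ → ℂ} (hF : Integrable F m) (n : ℤ) :
    Integrable (fun θ => expi n θ * F θ) m :=
  hF.bdd_mul (continuous_expi n).aestronglyMeasurable (ae_of_all _ fun θ => (norm_expi n θ).le)

/-- The trigonometric polynomial with coefficients `c`. -/
noncomputable def trigVal (c : ℤ →₀ ℂ) (θ : ℝ) : ℂ := c.sum fun n a => a * expi n θ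

lemma coeFn_trigLp (μ : Measure ℝ) [IsFiniteMeasure μ] (p : ℝ≥0∞) (c : ℤ →₀ ℂ) :
    trigLp μ p c =ᵐ[μ] trigVal c := coeFn_linearCombination_toLp _ c

lemma continuous_trigVal (c : ℤ →₀ ℂ) : Continuous (trigVal c) :=
  continuous_finsetSum _ fun n _ => continuous_const.mul (continuous_expi n)

lemma memLp_trigVal (μ : Measure ℝ) [IsFiniteMeasure μ] (p : ℝ≥0∞) (c : ℤ →₀ ℂ) :
    MemLp (trigVal c) p μ := (memLp_congr_ae (coeFn_trigLp μ p c)).1 (Lp.memLp _)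

/-- Uniqueness of Fourier coefficients in `L¹`.  Trigonometric polynomials are dense in
`L¹(|u| dθ)`, hence approximate the phase of `u` there. -/
lemma ae_eq_zero_of_integral_expi_mul {u : ℝ → ℂ} (hu : Integrable u circMeas)
    (h : ∀ n, ∫ θ, expi n θ * u θ ∂circMeas = 0) : u =ᵐ[circMeas] 0 := by
  have hm : AEMeasurable (fun θ => ‖u θ‖ₑ) circMeas := hu.1.enorm
  let κ : Measure ℝ := circMeas.withDensity fun θ => ‖u θ‖ₑ
  have hκ : IsFiniteMeasure κ := isFiniteMeasure_withDensity hu.2.ne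
  have hκ0 : κ (Set.Ioc (-Real.pi) Real.pi)ᶜ = 0 :=
    withDensity_absolutelyContinuous _ _ circMeas_compl
  let s : ℝ → ℂ := fun θ => conj (u θ) / ‖u θ‖
  have hs : AEStronglyMeasurable s circMeas :=
    ((Complex.continuous_conj.comp_aestronglyMeasurable hu.1).aemeasurable.div
      (Complex.measurable_ofReal.comp_aemeasurable hu.1.norm.aemeasurable)).aestronglyMeasurable
  have hs1 : ∀ θ, ‖s θ‖ ≤ 1 := fun θ => by
    simp only [s]
    rw [norm_div, RCLike.norm_conj, Complex.norm_real, norm_norm]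
    exact div_self_le_one _
  have hsκ : MemLp s 1 κ := MemLp.of_bound
    (hs.mono_ac (withDensity_absolutelyContinuous _ _)) 1 (ae_of_all _ hs1)
  have hsu : ∀ θ, s θ * u θ = (‖u θ‖ : ℂ) := fun θ => by
    simp only [s]
    rcases eq_or_ne (u θ) 0 with h0 | h0
    · simp [h0]
    · have : (‖u θ‖ : ℂ) ≠ 0 := by exact_mod_cast norm_ne_zero_iff.2 h0
      rw [div_mul_eq_mul_div, mul_comm, Complex.mul_conj, Complex.normSq_eq_norm_sq]
      push_cast
      field_simp
  have htrig : ∀ c : ℤ →₀ ℂ, ∫ θ, trigVal c θ * u θ ∂circMeas = 0 := fun c => by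
    have : ∀ θ, trigVal c θ * u θ = ∑ n ∈ c.support, c n * (expi n θ * u θ) := fun θ => by
      rw [trigVal, Finsupp.sum, Finset.sum_mul]
      exact Finset.sum_congr rfl fun n _ => mul_assoc _ _ _
    simp_rw [this]
    rw [integral_finsetSum _ fun n _ => (integrable_expi_mul hu n).const_mul _]
    exact Finset.sum_eq_zero fun n _ => by rw [integral_const_mul, h, mul_zero]
  have hsi : Integrable (fun θ => s θ * u θ) circMeas :=
    hu.bdd_mul hs (ae_of_all _ hs1)
  have hle : ∀ c : ℤ →₀ ℂ, ‖∫ θ, s θ * u θ ∂circMeas‖ₑ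
      ≤ edist (trigLp κ 1 c) (hsκ.toLp s) := fun c => by
    have hci : Integrable (fun θ => trigVal c θ * u θ) circMeas :=
      hu.bdd_mul (continuous_trigVal c).aestronglyMeasurable (c := ∑ n ∈ c.support, ‖c n‖)
        (ae_of_all _ fun θ => norm_sum_le_of_le _ fun n _ => by rw [norm_mul, norm_expi, mul_one])
    rw [← sub_zero (∫ θ, s θ * u θ ∂circMeas), ← htrig c, ← integral_sub hsi hci, edist_comm,
      Lp.edist_def, eLpNorm_one_eq_lintegral_enorm]
    refine (enorm_integral_le_lintegral_enorm _).trans (le_of_eq ?_)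
    have hκe : (fun θ => ‖((hsκ.toLp s : ℝ → ℂ) - (trigLp κ 1 c : ℝ → ℂ)) θ‖ₑ)
        =ᵐ[κ] fun θ => ‖s θ - trigVal c θ‖ₑ := by
      filter_upwards [hsκ.coeFn_toLp, coeFn_trigLp κ 1 c] with θ h1 h2
      rw [Pi.sub_apply, h1, h2]
    rw [lintegral_congr_ae hκe, lintegral_withDensity_eq_lintegral_mul_non_measurable₀ _ hm
      (ae_of_all _ fun θ => enorm_lt_top)]
    refine lintegral_congr fun θ => ?_
    rw [← sub_mul, enorm_mul, Pi.mul_apply, mul_comm]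
  have h0 : ∫ θ, s θ * u θ ∂circMeas = 0 := by
    rw [← enorm_eq_zero]
    refine le_antisymm (le_of_forall_pos_le_add fun ε hε => ?_) zero_le
    obtain ⟨c, hc⟩ := (denseRange_trigLp κ hκ0 1 ENNReal.one_ne_top).exists_mem_open
      (Metric.isOpen_eball (x := hsκ.toLp s) (ε := ε)) ⟨_, Metric.mem_eball_self hε⟩
    rw [zero_add]
    exact (hle c).trans (le_of_lt hc)
  simp_rw [hsu] at h0
  rw [integral_complex_ofReal] at h0
  have h1 : ∫ θ, ‖u θ‖ ∂circMeas = 0 := by exact_mod_cast h0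
  rw [integral_eq_zero_iff_of_nonneg (fun θ => norm_nonneg _) hu.norm] at h1
  filter_upwards [h1] with θ hθ
  simpa using hθ

/-- `F ∈ L¹(-π, π]` has vanishing Fourier coefficients at all indices `≤ -a`. -/
structure IsAnalyticFrom (a : ℤ) (F : ℝ → ℂ) : Prop where
  integrable : Integrable F circMeas
  integral_eq : ∀ k, a ≤ k → ∫ θ, expi k θ * F θ ∂circMeas = 0

lemma IsAnalyticFrom.trigVal_mul {a : ℤ} {F : ℝ → ℂ} (hF : IsAnalyticFrom a F) {c : ℤ →₀ ℂ}
    (hc : c ∈ Finsupp.supported ℂ ℂ (Set.Ici (0 : ℤ))) :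
    IsAnalyticFrom a fun θ => trigVal c θ * F θ := by
  have hsum : ∀ θ, trigVal c θ * F θ = ∑ n ∈ c.support, c n * (expi n θ * F θ) := fun θ => by
    rw [trigVal, Finsupp.sum, Finset.sum_mul]
    exact Finset.sum_congr rfl fun n _ => mul_assoc _ _ _
  refine ⟨?_, fun k hk => ?_⟩
  · simp_rw [hsum]
    exact integrable_finsetSum _ fun n _ => (integrable_expi_mul hF.integrable n).const_mul _
  · have h1 : ∀ θ, expi k θ * (trigVal c θ * F θ)
        = ∑ n ∈ c.support, c n * (expi (k + n) θ * F θ) := fun θ => by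
      rw [hsum, Finset.mul_sum]
      refine Finset.sum_congr rfl fun n _ => ?_
      rw [expi_add]; ring
    simp_rw [h1]
    rw [integral_finsetSum _ fun n _ => (integrable_expi_mul hF.integrable _).const_mul _]
    refine Finset.sum_eq_zero fun n hn => ?_
    have : (0 : ℤ) ≤ n := (Finsupp.mem_supported ℂ c).1 hc hn
    rw [integral_const_mul, hF.integral_eq _ (by linarith), mul_zero]

lemma IsAnalyticFrom.of_tendsto {a : ℤ} {F : ℕ → ℝ → ℂ} {H : ℝ → ℂ}
    (hF : ∀ n, IsAnalyticFrom a (F n)) (hH : Integrable H circMeas)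
    (h : Tendsto (fun n => ∫⁻ θ, ‖F n θ - H θ‖ₑ ∂circMeas) atTop (𝓝 0)) :
    IsAnalyticFrom a H := by
  refine ⟨hH, fun k hk => ?_⟩
  have := tendsto_integral_of_L1 (fun θ => expi k θ * H θ) (integrable_expi_mul hH k).1
    (F := fun n θ => expi k θ * F n θ) (l := atTop)
    (Eventually.of_forall fun n => integrable_expi_mul (hF n).integrable k) (by
      refine h.congr fun n => lintegral_congr fun θ => ?_
      rw [← mul_sub, enorm_mul, ← ofReal_norm (expi k θ), norm_expi, ENNReal.ofReal_one, one_mul])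
  simp_rw [(hF _).integral_eq k hk] at this
  exact tendsto_nhds_unique this tendsto_const_nhds

/-- Parseval: two square integrable functions with one-sided Fourier series. -/
lemma IsAnalyticFrom.integral_mul_eq_zero_of_memLp {F G : ℝ → ℂ} (hF : IsAnalyticFrom 1 F)
    (hG : IsAnalyticFrom 0 G) (hF2 : MemLp F 2 circMeas) (hG2 : MemLp G 2 circMeas) :
    ∫ θ, F θ * G θ ∂circMeas = 0 := by
  let r : ℝ := (Real.sqrt (2 * Real.pi))⁻¹
  let e : ℤ → Lp ℂ 2 circMeas := fun n => (r : ℂ) • (memLp_expi circMeas 2 n).toLp (expi n)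
  have hinner : ∀ (n : ℤ) {H : ℝ → ℂ} (hH : MemLp H 2 circMeas),
      inner ℂ (e n) (hH.toLp H) = (r : ℂ) * ∫ θ, expi (-n) θ * H θ ∂circMeas := by
    intro n H hH
    simp only [e]
    rw [inner_smul_left, Complex.conj_ofReal, L2.inner_def]
    congr 1
    apply integral_congr_ae
    filter_upwards [(memLp_expi circMeas 2 n).coeFn_toLp, hH.coeFn_toLp] with θ h1 h2
    rw [h1, h2, RCLike.inner_apply, conj_expi, mul_comm]
  have hr0 : 0 < r := by positivity
  have hr : r * r * (2 * Real.pi) = 1 := by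
    simp only [r]
    rw [← mul_inv, Real.mul_self_sqrt (by positivity), inv_mul_cancel₀ (by positivity)]
  have hon : Orthonormal ℂ e := by
    rw [orthonormal_iff_ite]
    intro n m
    have h1 : e m = (r : ℂ) • (memLp_expi circMeas 2 m).toLp (expi m) := rfl
    rw [h1, inner_smul_right, hinner]
    simp_rw [← expi_add, integral_expi]
    by_cases h : n = m
    · subst h
      simp only [neg_add_cancel, if_true]
      have : ((r * r * (2 * Real.pi) : ℝ) : ℂ) = 1 := by rw [hr]; simp
      rw [← this]; push_cast; ring
    · have : -n + m ≠ 0 := fun h0 => h (by linarith)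
      simp [h, this]
  have hspan : (⊤ : Submodule ℂ (Lp ℂ 2 circMeas)) ≤
      (Submodule.span ℂ (Set.range e)).topologicalClosure := by
    have hd := denseRange_trigLp circMeas circMeas_compl 2 (by simp)
    rw [DenseRange, ← LinearMap.coe_range, Submodule.dense_iff_topologicalClosure_eq_top] at hd
    rw [← hd]
    apply Submodule.topologicalClosure_mono
    rw [trigLp, Finsupp.range_linearCombination, Submodule.span_le]
    rintro _ ⟨n, rfl⟩
    have : (memLp_expi circMeas 2 n).toLp (expi n) = (r : ℂ)⁻¹ • e n := by
      simp only [e]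
      rw [smul_smul, inv_mul_cancel₀ (by exact_mod_cast hr0.ne'), one_smul]
    simp only [this]
    exact Submodule.smul_mem _ _ (Submodule.subset_span ⟨n, rfl⟩)
  let b := HilbertBasis.mk hon hspan
  have hF2' : MemLp (fun θ => conj (F θ)) 2 circMeas := hF2.star
  have hsum := b.hasSum_inner_mul_inner (hF2'.toLp _) (hG2.toLp G)
  have hzero : ∀ n, inner ℂ (hF2'.toLp _) (b n) * inner ℂ (b n) (hG2.toLp G) = 0 := by
    intro n
    simp only [b, HilbertBasis.coe_mk]
    rcases le_or_gt n 0 with hn | hn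
    · rw [hinner n hG2, hG.integral_eq _ (by linarith), mul_zero, mul_zero]
    · rw [← inner_conj_symm, hinner n hF2']
      have : ∫ θ, expi (-n) θ * conj (F θ) ∂circMeas = conj (∫ θ, expi n θ * F θ ∂circMeas) := by
        rw [← integral_conj]
        congr 1; ext θ
        rw [map_mul, conj_expi]
      rw [this, hF.integral_eq n (by linarith)]
      simp
  simp_rw [hzero] at hsum
  have h0 := hsum.unique hasSum_zero
  rw [L2.inner_def] at h0
  rw [← h0]
  apply integral_congr_ae
  filter_upwards [hF2'.coeFn_toLp, hG2.coeFn_toLp] with θ h1 h2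
  rw [h1, h2, RCLike.inner_apply, Complex.conj_conj, mul_comm]

end Hardy

/-! ### Szegő factors -/

section Hardy

lemma isFiniteMeasure_densityMeasure {W : ℝ → ℝ} (hW : Integrable W circMeas) :
    IsFiniteMeasure (densityMeasure W) := isFiniteMeasure_withDensity_ofReal hW.2

lemma circMeas_le_densityMeasure {W : ℝ → ℝ} (hW : ∀ θ, 1 ≤ W θ) : circMeas ≤ densityMeasure W := by
  nth_rewrite 1 [← withDensity_one (μ := circMeas)]
  refine withDensity_mono (ae_of_all _ fun θ => ?_)
  simpa using hW θ

lemma densityMeasure_ac (W : ℝ → ℝ) : densityMeasure W ≪ circMeas := withDensity_absolutelyContinuous _ _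

lemma circMeas_ac_densityMeasure {W : ℝ → ℝ} (hW : ∀ θ, 1 ≤ W θ) : circMeas ≪ densityMeasure W :=
  Measure.absolutelyContinuous_of_le (circMeas_le_densityMeasure hW)

lemma integral_densityMeasure {W : ℝ → ℝ} (hWm : Measurable W) (hW : ∀ θ, 1 ≤ W θ) (F : ℝ → ℂ) :
    ∫ θ, F θ ∂(densityMeasure W) = ∫ θ, (W θ : ℂ) * F θ ∂circMeas := by
  rw [densityMeasure, integral_withDensity_eq_integral_toReal_smul hWm.ennreal_ofReal
    (ae_of_all _ fun θ => ENNReal.ofReal_lt_top)]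
  congr 1; ext θ
  rw [ENNReal.toReal_ofReal (by linarith [hW θ]), Complex.real_smul]

lemma trigVal_single_zero (θ : ℝ) : trigVal (Finsupp.single 0 1) θ = 1 := by
  simp [trigVal, expi_zero]

lemma trigVal_sub (c d : ℤ →₀ ℂ) (θ : ℝ) : trigVal (c - d) θ = trigVal c θ - trigVal d θ :=
  map_sub (Finsupp.linearCombination ℂ fun n => expi n θ) c d

/-- Multiplication of a trigonometric polynomial by `e^{inθ}`. -/
noncomputable def trigShift (n : ℤ) (c : ℤ →₀ ℂ) : ℤ →₀ ℂ := c.mapDomain fun k => n + k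

lemma trigVal_trigShift (n : ℤ) (c : ℤ →₀ ℂ) (θ : ℝ) :
    trigVal (trigShift n c) θ = expi n θ * trigVal c θ := by
  rw [trigVal, trigShift, Finsupp.sum_mapDomain_index (by simp) (by intros; ring), trigVal,
    Finsupp.mul_sum]
  refine Finsupp.sum_congr fun k _ => ?_
  rw [expi_add]; ring

lemma trigShift_mem {n : ℤ} (hn : 1 ≤ n) {c : ℤ →₀ ℂ}
    (hc : c ∈ Finsupp.supported ℂ ℂ (Set.Ici (0 : ℤ))) :
    trigShift n c ∈ Finsupp.supported ℂ ℂ (Set.Ici (1 : ℤ)) := by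
  classical
  rw [Finsupp.mem_supported] at hc ⊢
  intro k hk
  obtain ⟨j, hj, rfl⟩ := Finset.mem_image.1 (Finsupp.mapDomain_support hk)
  have : (0 : ℤ) ≤ j := hc hj
  simp only [Set.mem_Ici]
  linarith

lemma integral_trigVal {c : ℤ →₀ ℂ} (hc : c ∈ Finsupp.supported ℂ ℂ (Set.Ici (1 : ℤ))) :
    ∫ θ, trigVal c θ ∂circMeas = 0 := by
  unfold trigVal Finsupp.sum
  rw [integral_finsetSum _ fun n _ =>
    ((memLp_expi circMeas 1 n).integrable le_rfl).const_mul _]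
  refine Finset.sum_eq_zero fun n hn => ?_
  have : (1 : ℤ) ≤ n := (Finsupp.mem_supported ℂ c).1 hc hn
  rw [integral_const_mul, integral_expi, if_neg (by linarith), mul_zero]

/-- A function `p` in the closure in `L²(W dθ)` of analytic trigonometric polynomials, normalized
to have mean `1`, and with `|p|² W` equal to the constant `C`. -/
structure IsSzegoFactor (W : ℝ → ℝ) (p : ℝ → ℂ) (C : ℝ) : Prop where
  memLp : MemLp p 2 (densityMeasure W)
  exists_tendsto : ∃ q : ℕ → ℤ →₀ ℂ, (∀ m, q m ∈ Finsupp.supported ℂ ℂ (Set.Ici (0 : ℤ))) ∧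
    Tendsto (fun m => eLpNorm (trigVal (q m) - p) 2 (densityMeasure W)) atTop (𝓝 0)
  norm_sq_mul : ∀ᵐ θ ∂circMeas, ‖p θ‖ ^ 2 * W θ = C
  integral_eq : ∫ θ, p θ ∂circMeas = 2 * Real.pi
  one_le : 1 ≤ C
  le_integral : C * (2 * Real.pi) ≤ ∫ θ, W θ ∂circMeas

/-- For a weight `W ≥ 1`, the residual `p` of the projection of `1` onto the closed span of
`e^{ikθ}`, `k ≥ 1`, in `L²(W dθ)` is a Szegő factor: `p` is orthogonal to `e^{inθ} p` for `n ≥ 1`,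
so all nonconstant Fourier coefficients of `|p|² W` vanish. -/
theorem exists_isSzegoFactor {W : ℝ → ℝ} (hWm : Measurable W) (hW : ∀ θ, 1 ≤ W θ)
    (hWi : Integrable W circMeas) : ∃ p C, IsSzegoFactor W p C := by
  have := isFiniteMeasure_densityMeasure hWi
  set ω := densityMeasure W with hω
  let S : Submodule ℂ (Lp ℂ 2 ω) :=
    ((Finsupp.supported ℂ ℂ (Set.Ici (1 : ℤ))).map (trigLp ω 2)).topologicalClosure
  have hSc : IsClosed (S : Set (Lp ℂ 2 ω)) := Submodule.isClosed_topologicalClosure _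
  have : CompleteSpace S := hSc.completeSpace_coe
  let e₀ : Lp ℂ 2 ω := trigLp ω 2 (Finsupp.single 0 1)
  let p : Lp ℂ 2 ω := e₀ - S.starProjection e₀
  have hqS : S.starProjection e₀ ∈ S := Submodule.starProjection_apply_mem _ _
  have horth : ∀ s ∈ S, inner ℂ s p = 0 := fun s hs =>
    (Submodule.mem_orthogonal _ _).1 (Submodule.sub_starProjection_mem_orthogonal e₀) s hs
  obtain ⟨x, hx, hxlim⟩ := mem_closure_iff_seq_limit.1 hqS
  choose c hcS hcx using hx
  let q : ℕ → ℤ →₀ ℂ := fun m => Finsupp.single 0 1 - c m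
  have hc0 : ∀ m, c m ∈ Finsupp.supported ℂ ℂ (Set.Ici (0 : ℤ)) := fun m =>
    Finsupp.supported_mono (Set.Ici_subset_Ici.2 zero_le_one) (hcS m)
  have hq : ∀ m, q m ∈ Finsupp.supported ℂ ℂ (Set.Ici (0 : ℤ)) := fun m =>
    Submodule.sub_mem _ (Finsupp.single_mem_supported ℂ _ Set.self_mem_Ici) (hc0 m)
  have hqlim : Tendsto (fun m => trigLp ω 2 (q m)) atTop (𝓝 p) := by
    simp only [q, map_sub, hcx]
    exact tendsto_const_nhds.sub hxlim
  have hqL : Tendsto (fun m => eLpNorm (trigVal (q m) - (p : ℝ → ℂ)) 2 ω) atTop (𝓝 0) := by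
    rw [tendsto_iff_edist_tendsto_0] at hqlim
    refine hqlim.congr fun m => ?_
    rw [Lp.edist_def]
    exact eLpNorm_congr_ae ((coeFn_trigLp ω 2 (q m)).sub (ae_eq_refl _))
  have hpm : MemLp p 2 ω := Lp.memLp p
  have hac := circMeas_ac_densityMeasure hW
  -- the nonconstant Fourier coefficients of `|p|² W`
  have hshift : ∀ n : ℤ, 1 ≤ n → ∫ θ, expi (-n) θ * ((‖p θ‖ ^ 2 : ℝ) : ℂ) ∂ω = 0 := by
    intro n hn
    have hm : MemLp (fun θ => expi n θ * p θ) 2 ω := by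
      refine hpm.of_le ((continuous_expi n).aestronglyMeasurable.mul hpm.1)
        (ae_of_all _ fun θ => ?_)
      rw [norm_mul, norm_expi, one_mul]
    have hmem : hm.toLp _ ∈ S := by
      refine hSc.mem_of_tendsto (b := atTop) (f := fun m => trigLp ω 2 (trigShift n (q m))) ?_
        (Eventually.of_forall fun m => Submodule.le_topologicalClosure _
          (Submodule.mem_map_of_mem (trigShift_mem hn (hq m))))
      rw [tendsto_iff_edist_tendsto_0]
      refine hqL.congr fun m => ?_
      rw [Lp.edist_def]
      refine eLpNorm_congr_norm_ae ?_
      filter_upwards [coeFn_trigLp ω 2 (trigShift n (q m)), hm.coeFn_toLp] with θ h1 h2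
      rw [Pi.sub_apply, Pi.sub_apply, h1, h2, trigVal_trigShift, ← mul_sub, norm_mul, norm_expi,
        one_mul]
    have h0 := horth _ hmem
    rw [L2.inner_def] at h0
    rw [← h0]
    apply integral_congr_ae
    filter_upwards [hm.coeFn_toLp] with θ h1
    rw [h1, RCLike.inner_apply, map_mul, conj_expi, ← Complex.normSq_eq_norm_sq,
      Complex.normSq_eq_conj_mul_self]
    ring
  have hnorm : ∫ θ, ‖p θ‖ ^ 2 ∂ω = ‖p‖ ^ 2 := by
    have h1 : inner ℂ p p = ((∫ θ, ‖p θ‖ ^ 2 ∂ω : ℝ) : ℂ) := by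
      rw [L2.inner_def, ← integral_complex_ofReal]
      congr 1; ext θ
      rw [inner_self_eq_norm_sq_to_K]; simp
    rw [inner_self_eq_norm_sq_to_K] at h1
    exact Complex.ofReal_injective (by rw [← h1]; simp)
  set C : ℝ := ‖p‖ ^ 2 / (2 * Real.pi) with hC
  have hC2 : C * (2 * Real.pi) = ‖p‖ ^ 2 := by rw [hC]; field_simp
  have hpi2 : Integrable (fun θ => ((‖p θ‖ ^ 2 : ℝ) : ℂ)) ω := by
    have := hpm.integrable_norm_pow (by norm_num)
    exact this.ofReal
  have hpW : Integrable (fun θ => (W θ : ℂ) * ((‖p θ‖ ^ 2 : ℝ) : ℂ)) circMeas := by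
    have := (integrable_withDensity_iff_integrable_smul' hWm.ennreal_ofReal
      (ae_of_all _ fun θ => ENNReal.ofReal_lt_top)).1 hpi2
    refine this.congr (ae_of_all _ fun θ => ?_)
    simp only
    rw [ENNReal.toReal_ofReal (by linarith [hW θ]), Complex.real_smul]
  have hcoef : ∀ n, ∫ θ, expi n θ * ((W θ : ℂ) * ((‖p θ‖ ^ 2 : ℝ) : ℂ)) ∂circMeas
      = ∫ θ, expi n θ * ((‖p θ‖ ^ 2 : ℝ) : ℂ) ∂ω := fun n => by
    refine Eq.trans ?_ (integral_densityMeasure hWm hW _).symm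
    congr 1; ext θ; ring
  have hconst : (fun θ => (W θ : ℂ) * ((‖p θ‖ ^ 2 : ℝ) : ℂ) - (C : ℂ)) =ᵐ[circMeas] 0 := by
    refine ae_eq_zero_of_integral_expi_mul (hpW.sub (integrable_const _)) fun n => ?_
    simp_rw [mul_sub]
    rw [integral_sub (integrable_expi_mul hpW n) (integrable_expi_mul (integrable_const _) n),
      hcoef, integral_mul_const, integral_expi]
    rcases lt_trichotomy n 0 with h | h | h
    · have := hshift (-n) (by linarith)
      rw [neg_neg] at this
      rw [this, if_neg h.ne]; simp
    · subst h
      simp_rw [expi_zero, one_mul]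
      rw [integral_complex_ofReal, hnorm, ← hC2]
      simp; ring
    · have h1 : ∫ θ, expi n θ * ((‖p θ‖ ^ 2 : ℝ) : ℂ) ∂ω
          = conj (∫ θ, expi (-n) θ * ((‖p θ‖ ^ 2 : ℝ) : ℂ) ∂ω) := by
        rw [← integral_conj]
        congr 1; ext θ
        rw [map_mul, conj_expi, neg_neg, Complex.conj_ofReal]
      rw [h1, hshift n (by linarith), if_neg h.ne']; simp
  have hconst' : ∀ᵐ θ ∂circMeas, ‖p θ‖ ^ 2 * W θ = C := by
    filter_upwards [hconst] with θ hθ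
    have : (W θ : ℂ) * ((‖p θ‖ ^ 2 : ℝ) : ℂ) = (C : ℂ) := sub_eq_zero.1 hθ
    rw [mul_comm]
    exact_mod_cast this
  -- the mean of `p`
  have hpc : MemLp p 2 circMeas := hpm.mono_measure (circMeas_le_densityMeasure hW)
  have hint : ∫ θ, p θ ∂circMeas = 2 * Real.pi := by
    have hq1 : ∀ m, ∫ θ, trigVal (q m) θ ∂circMeas = 2 * Real.pi := fun m => by
      simp only [q, trigVal_sub, trigVal_single_zero]
      rw [integral_sub (integrable_const _) ((memLp_trigVal circMeas 1 _).integrable le_rfl),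
        integral_trigVal (hcS m), integral_const, circMeas_real_univ]
      simp
    have hlim := tendsto_integral_of_L1 (F := fun m => trigVal (q m)) (l := atTop)
      (p : ℝ → ℂ) hpc.1
      (Eventually.of_forall fun m => (memLp_trigVal circMeas 1 _).integrable le_rfl) (by
        have h1 : Tendsto (fun m => eLpNorm (trigVal (q m) - (p : ℝ → ℂ)) 2 ω *
            circMeas Set.univ ^ (1 / (1 : ℝ≥0∞).toReal - 1 / (2 : ℝ≥0∞).toReal)) atTop (𝓝 0) := by
          have := ENNReal.Tendsto.mul_const (b := circMeas Set.univ ^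
            (1 / (1 : ℝ≥0∞).toReal - 1 / (2 : ℝ≥0∞).toReal)) hqL
            (Or.inr (ENNReal.rpow_ne_top_of_nonneg (by norm_num) (measure_ne_top _ _)))
          rwa [zero_mul] at this
        refine tendsto_of_tendsto_of_tendsto_of_le_of_le tendsto_const_nhds h1
          (fun m => zero_le) fun m => ?_
        have h2 := eLpNorm_le_eLpNorm_mul_rpow_measure_univ (μ := circMeas) (p := 1) (q := 2)
          one_le_two ((memLp_trigVal circMeas 2 (q m)).sub hpc).1
        rw [eLpNorm_one_eq_lintegral_enorm] at h2
        refine h2.trans ?_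
        gcongr
        exact circMeas_le_densityMeasure hW)
    simp_rw [hq1] at hlim
    exact tendsto_nhds_unique hlim tendsto_const_nhds |>.symm ▸ rfl
  have hC0 : 0 ≤ C := by positivity
  have hle : ∀ᵐ θ ∂circMeas, ‖p θ‖ ≤ Real.sqrt C := by
    filter_upwards [hconst'] with θ hθ
    apply Real.le_sqrt_of_sq_le
    rw [← hθ]
    exact le_mul_of_one_le_right (by positivity) (hW θ)
  refine ⟨p, C, hpm, ⟨q, hq, hqL⟩, hconst', hint, ?_, ?_⟩
  · have h1 : 2 * Real.pi ≤ Real.sqrt C * (2 * Real.pi) := by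
      have := norm_integral_le_of_norm_le_const hle
      rw [hint, circMeas_real_univ] at this
      rwa [show ‖(2 * Real.pi : ℂ)‖ = 2 * Real.pi by simp [abs_of_pos Real.pi_pos]] at this
    have h2 : 1 ≤ Real.sqrt C := by
      by_contra! h
      nlinarith [Real.pi_pos]
    rwa [Real.one_le_sqrt] at h2
  · rw [hC2]
    have h1 : ‖p‖ ^ 2 ≤ ‖e₀‖ * ‖p‖ := by
      have h2 : inner ℂ p p = inner ℂ e₀ p := by
        nth_rewrite 1 [show p = e₀ - S.starProjection e₀ from rfl]
        rw [inner_sub_left, horth _ hqS, sub_zero]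
      have h3 : ‖p‖ ^ 2 = ‖inner ℂ e₀ p‖ := by
        rw [← h2, inner_self_eq_norm_sq_to_K]; simp
      rw [h3]
      exact norm_inner_le_norm _ _
    have h2 : ‖p‖ ≤ ‖e₀‖ := by
      rcases (norm_nonneg p).eq_or_lt with h | h
      · rw [← h]; exact norm_nonneg _
      · nlinarith
    have h3 : ‖e₀‖ ^ 2 = ∫ θ, W θ ∂circMeas := by
      have h4 : inner ℂ e₀ e₀ = ((∫ θ, W θ ∂circMeas : ℝ) : ℂ) := by
        rw [L2.inner_def, ← integral_complex_ofReal]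
        have h5 := integral_densityMeasure hWm hW fun _ => 1
        simp only [mul_one] at h5
        rw [← h5]
        apply integral_congr_ae
        filter_upwards [coeFn_trigLp ω 2 (Finsupp.single 0 1)] with θ h6
        simp only [e₀]
        rw [h6, trigVal_single_zero]; simp
      rw [inner_self_eq_norm_sq_to_K] at h4
      exact Complex.ofReal_injective (by rw [← h4]; simp)
    rw [← h3]
    gcongr

end Hardy

/-! ### Products in the Hardy space -/

section HardyProduct

lemma IsSzegoFactor.norm_sq_mul_le {W : ℝ → ℝ} {p : ℝ → ℂ} {C : ℝ} (hp : IsSzegoFactor W p C)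
    {H : ℝ → ℂ} {K : ℝ} (hH : ∀ θ, ‖H θ‖ ≤ K * W θ) :
    ∀ᵐ θ ∂circMeas, ‖p θ ^ 2 * H θ‖ ≤ K * C := by
  filter_upwards [hp.norm_sq_mul] with θ hθ
  rw [norm_mul, norm_pow, ← hθ]
  calc ‖p θ‖ ^ 2 * ‖H θ‖ ≤ ‖p θ‖ ^ 2 * (K * W θ) := by gcongr; exact hH θ
    _ = K * (‖p θ‖ ^ 2 * W θ) := by ring

lemma IsSzegoFactor.aestronglyMeasurable {W : ℝ → ℝ} (hW : ∀ θ, 1 ≤ W θ) {p : ℝ → ℂ} {C : ℝ}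
    (hp : IsSzegoFactor W p C) : AEStronglyMeasurable p circMeas :=
  hp.memLp.1.mono_ac (circMeas_ac_densityMeasure hW)

/-- Multiplication by the square of a Szegő factor of a majorant of `H` preserves analyticity, since
`|p|² |H|` is controlled by `|p|² W`, and `p` is an `L²(W dθ)`-limit of analytic polynomials. -/
theorem IsSzegoFactor.isAnalyticFrom_sq_mul {W : ℝ → ℝ} (hWm : Measurable W)
    (hW : ∀ θ, 1 ≤ W θ) {p : ℝ → ℂ} {C : ℝ} (hp : IsSzegoFactor W p C) {a : ℤ} {H : ℝ → ℂ}
    (hHa : IsAnalyticFrom a H) {K : ℝ} (hK : 0 ≤ K) (hH : ∀ θ, ‖H θ‖ ≤ K * W θ) :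
    IsAnalyticFrom a fun θ => p θ ^ 2 * H θ := by
  obtain ⟨q, hq, hlim⟩ := hp.exists_tendsto
  have hpm := hp.aestronglyMeasurable hW
  have hint : Integrable (fun θ => p θ ^ 2 * H θ) circMeas :=
    Integrable.of_bound ((hpm.pow 2).mul hHa.integrable.1) _ (hp.norm_sq_mul_le hH)
  have hac := densityMeasure_ac W
  refine IsAnalyticFrom.of_tendsto
    (fun m => (hHa.trigVal_mul (hq m)).trigVal_mul (hq m)) hint ?_
  let e : ℕ → ℝ≥0∞ := fun m => eLpNorm (trigVal (q m) - p) 2 (densityMeasure W)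
  let M : ℝ≥0∞ := eLpNorm ((2 : ℂ) • p) 2 (densityMeasure W)
  have hM : M ≠ ∞ := (hp.memLp.const_smul (2 : ℂ)).2.ne
  have hlim2 : Tendsto (fun m => ENNReal.ofReal K * (e m * (e m + M))) atTop (𝓝 0) := by
    have h1 : Tendsto (fun m => e m + M) atTop (𝓝 (0 + M)) := hlim.add tendsto_const_nhds
    have h2 := ENNReal.Tendsto.mul hlim (Or.inr (by simpa using hM)) h1
      (Or.inr ENNReal.zero_ne_top)
    rw [zero_mul] at h2
    have h3 := ENNReal.Tendsto.const_mul (a := ENNReal.ofReal K) h2 (Or.inr ENNReal.ofReal_ne_top)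
    rwa [mul_zero] at h3
  refine tendsto_of_tendsto_of_tendsto_of_le_of_le tendsto_const_nhds hlim2 (fun m => zero_le)
    fun m => ?_
  set t := trigVal (q m) with ht
  have htm : AEStronglyMeasurable t (densityMeasure W) := (continuous_trigVal _).aestronglyMeasurable
  have hd : AEStronglyMeasurable (t - p) (densityMeasure W) := htm.sub hp.memLp.1
  have hd2 : AEStronglyMeasurable ((t - p) + (2 : ℂ) • p) (densityMeasure W) :=
    hd.add (hp.memLp.1.const_smul 2)
  calc ∫⁻ θ, ‖t θ * (t θ * H θ) - p θ ^ 2 * H θ‖ₑ ∂circMeas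
      ≤ ∫⁻ θ, ENNReal.ofReal K * (ENNReal.ofReal (W θ) *
          ‖((t - p) • ((t - p) + (2 : ℂ) • p)) θ‖ₑ) ∂circMeas := by
        refine lintegral_mono fun θ => ?_
        have h1 : t θ * (t θ * H θ) - p θ ^ 2 * H θ
            = ((t - p) • ((t - p) + (2 : ℂ) • p)) θ * H θ := by
          simp only [Pi.smul_apply', Pi.sub_apply, Pi.add_apply, Pi.smul_apply, smul_eq_mul]
          ring
        rw [h1, enorm_mul, ← mul_assoc, mul_comm, ← ENNReal.ofReal_mul hK]
        gcongr
        rw [← ofReal_norm]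
        exact ENNReal.ofReal_le_ofReal (hH θ)
    _ = ENNReal.ofReal K * ∫⁻ θ, ‖((t - p) • ((t - p) + (2 : ℂ) • p)) θ‖ₑ ∂(densityMeasure W) := by
        rw [lintegral_const_mul' _ _ ENNReal.ofReal_ne_top, densityMeasure,
          lintegral_withDensity_eq_lintegral_mul_non_measurable₀ _ hWm.ennreal_ofReal.aemeasurable
            (ae_of_all _ fun θ => ENNReal.ofReal_lt_top)]
        rfl
    _ ≤ ENNReal.ofReal K * (e m * (e m + M)) := by
        gcongr
        rw [← eLpNorm_one_eq_lintegral_enorm]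
        refine (eLpNorm_smul_le_mul_eLpNorm (p := 2) (q := 2) (r := 1) hd2 hd).trans ?_
        gcongr
        exact eLpNorm_add_le hd (hp.memLp.1.const_smul 2) one_le_two

lemma IsSzegoFactor.integral_norm_sub_one_sq_le {W : ℝ → ℝ} (hW : ∀ θ, 1 ≤ W θ) {p : ℝ → ℂ} {C : ℝ}
    (hp : IsSzegoFactor W p C) :
    Integrable (fun θ => ‖p θ - 1‖ ^ 2) circMeas ∧
      ∫ θ, ‖p θ - 1‖ ^ 2 ∂circMeas ≤ 2 * Real.pi * (C - 1) := by
  have hpc : MemLp p 2 circMeas := hp.memLp.mono_measure (circMeas_le_densityMeasure hW)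
  have h1 : Integrable (fun θ => (p θ).re) circMeas := (hpc.integrable one_le_two).re
  have h2 : Integrable (fun θ => ‖p θ‖ ^ 2) circMeas := hpc.integrable_norm_pow (by norm_num)
  have he : ∀ θ, ‖p θ - 1‖ ^ 2 = ‖p θ‖ ^ 2 - 2 * (p θ).re + 1 := fun θ => by
    rw [← Complex.normSq_eq_norm_sq, ← Complex.normSq_eq_norm_sq, Complex.normSq_apply,
      Complex.normSq_apply, Complex.sub_re, Complex.sub_im, Complex.one_re, Complex.one_im]
    ring
  have hre : ∫ θ, (p θ).re ∂circMeas = 2 * Real.pi := by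
    have h3 : ∫ θ, (p θ).re ∂circMeas = (∫ θ, p θ ∂circMeas).re :=
      integral_re (hpc.integrable one_le_two)
    rw [h3, hp.integral_eq]
    simp
  have hle : ∫ θ, ‖p θ‖ ^ 2 ∂circMeas ≤ C * (2 * Real.pi) := by
    rw [← circMeas_real_univ, mul_comm, ← smul_eq_mul, ← integral_const]
    refine integral_mono_ae h2 (integrable_const _) ?_
    filter_upwards [hp.norm_sq_mul] with θ hθ
    rw [← hθ]
    exact le_mul_of_one_le_right (by positivity) (hW θ)
  have h3 : Integrable (fun θ => ‖p θ‖ ^ 2 - 2 * (p θ).re) circMeas := h2.sub (h1.const_mul 2)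
  simp_rw [he]
  refine ⟨h3.add (integrable_const _), ?_⟩
  rw [integral_add h3 (integrable_const _), integral_sub h2 (h1.const_mul 2), integral_const_mul,
    hre, integral_const, circMeas_real_univ]
  simp only [smul_eq_mul]
  linarith

lemma IsAnalyticFrom.integral_mul_eq_zero_of_measurable {F G : ℝ → ℂ} (hF : IsAnalyticFrom 1 F)
    (hG : IsAnalyticFrom 0 G) (hFm : Measurable F) (hGm : Measurable G)
    (hFG : Integrable (fun θ => F θ * G θ) circMeas) :
    ∫ θ, F θ * G θ ∂circMeas = 0 := by
  have hI : Integrable (fun θ => ‖F θ‖ + ‖G θ‖) circMeas :=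
    hF.integrable.norm.add hG.integrable.norm
  let W : ℕ → ℝ → ℝ := fun n θ => 1 + 1 / (n + 1 : ℝ) * (‖F θ‖ + ‖G θ‖)
  have hW : ∀ n θ, 1 ≤ W n θ := fun n θ => by
    have : 0 ≤ 1 / (n + 1 : ℝ) * (‖F θ‖ + ‖G θ‖) := by positivity
    simp only [W]; linarith
  have hWm : ∀ n, Measurable (W n) := fun n => by
    have := hFm.norm; have := hGm.norm
    simp only [W]; fun_prop
  have hWi : ∀ n, Integrable (W n) circMeas := fun n =>
    (integrable_const _).add (hI.const_mul _)
  choose p C hp using fun n => exists_isSzegoFactor (hWm n) (hW n) (hWi n)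
  have hFW : ∀ (n : ℕ) θ, ‖F θ‖ ≤ (n + 1 : ℝ) * W n θ := fun n θ => by
    have h1 : (n + 1 : ℝ) * W n θ = (n + 1) + (‖F θ‖ + ‖G θ‖) := by
      simp only [W]; field_simp
    rw [h1]
    have : (0 : ℝ) ≤ n := by positivity
    linarith [norm_nonneg (G θ)]
  have hGW : ∀ (n : ℕ) θ, ‖G θ‖ ≤ (n + 1 : ℝ) * W n θ := fun n θ => by
    have h1 : (n + 1 : ℝ) * W n θ = (n + 1) + (‖F θ‖ + ‖G θ‖) := by
      simp only [W]; field_simp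
    rw [h1]
    have : (0 : ℝ) ≤ n := by positivity
    linarith [norm_nonneg (F θ)]
  have hzero : ∀ n, ∫ θ, p n θ ^ 2 * F θ * (p n θ ^ 2 * G θ) ∂circMeas = 0 := fun n => by
    have h1 := (hp n).isAnalyticFrom_sq_mul (hWm n) (hW n) hF (by positivity) (hFW n)
    have h2 := (hp n).isAnalyticFrom_sq_mul (hWm n) (hW n) hG (by positivity) (hGW n)
    exact h1.integral_mul_eq_zero_of_memLp h2
      (MemLp.of_bound h1.integrable.1 _ ((hp n).norm_sq_mul_le (hFW n)))
      (MemLp.of_bound h2.integrable.1 _ ((hp n).norm_sq_mul_le (hGW n)))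
  -- the constants `C n` tend to `1`
  let I : ℝ := ∫ θ, (‖F θ‖ + ‖G θ‖) ∂circMeas
  have hC : ∀ n, 2 * Real.pi * (C n - 1) ≤ 1 / (n + 1 : ℝ) * I := fun n => by
    have h1 := (hp n).le_integral
    simp only [W] at h1
    rw [integral_add (integrable_const _) (hI.const_mul _), integral_const, integral_const_mul,
      circMeas_real_univ, smul_eq_mul] at h1
    linarith
  have hsq : Tendsto (fun n => ∫ θ, ‖p n θ - 1‖ ^ 2 ∂circMeas) atTop (𝓝 0) := by
    refine tendsto_of_tendsto_of_tendsto_of_le_of_le tendsto_const_nhds ?_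
      (fun n => integral_nonneg fun θ => by positivity)
      (fun n => ((hp n).integral_norm_sub_one_sq_le (hW n)).2.trans (hC n))
    have := (tendsto_one_div_add_atTop_nhds_zero_nat (𝕜 := ℝ)).mul_const I
    rwa [zero_mul] at this
  have hmeas : TendstoInMeasure circMeas (fun n θ => ‖p n θ - 1‖ ^ 2) atTop fun _ => (0 : ℝ) := by
    refine tendstoInMeasure_of_tendsto_eLpNorm one_ne_zero
      (fun n => ((hp n).integral_norm_sub_one_sq_le (hW n)).1.1) aestronglyMeasurable_const ?_
    have h1 := (ENNReal.continuous_ofReal.tendsto 0).comp hsq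
    rw [ENNReal.ofReal_zero] at h1
    refine h1.congr fun n => ?_
    rw [Function.comp, ofReal_integral_eq_lintegral_ofReal
      ((hp n).integral_norm_sub_one_sq_le (hW n)).1 (ae_of_all _ fun θ => by positivity),
      eLpNorm_one_eq_lintegral_enorm]
    refine lintegral_congr fun θ => ?_
    rw [Pi.sub_apply, sub_zero, Real.enorm_of_nonneg (by positivity)]
  obtain ⟨s, -, hs⟩ := hmeas.exists_seq_tendsto_ae
  have hp1 : ∀ᵐ θ ∂circMeas, Tendsto (fun k => p (s k) θ) atTop (𝓝 1) := by
    filter_upwards [hs] with θ hθ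
    rw [tendsto_iff_norm_sub_tendsto_zero]
    have := (Real.continuous_sqrt.tendsto 0).comp hθ
    rw [Real.sqrt_zero] at this
    refine this.congr fun k => ?_
    exact Real.sqrt_sq (norm_nonneg _)
  have hCI : ∀ n, C n ≤ 1 + I := fun n => by
    have hI0 : 0 ≤ I := integral_nonneg fun θ => by positivity
    have h1 : 1 / (n + 1 : ℝ) * I ≤ I := by
      refine mul_le_of_le_one_left hI0 ?_
      rw [div_le_one (by positivity)]
      have : (0 : ℝ) ≤ n := by positivity
      linarith
    have h2 := hC n
    have h3 := (hp n).one_le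
    nlinarith [Real.pi_gt_three]
  have hlim := tendsto_integral_of_dominated_convergence
    (F := fun k θ => p (s k) θ ^ 2 * F θ * (p (s k) θ ^ 2 * G θ)) (μ := circMeas)
    (f := fun θ => F θ * G θ) (fun θ => (1 + I) ^ 2 * ‖F θ * G θ‖)
    (fun k => ((((hp _).aestronglyMeasurable (hW _)).pow 2).mul hFm.aestronglyMeasurable).mul
      ((((hp _).aestronglyMeasurable (hW _)).pow 2).mul hGm.aestronglyMeasurable))
    (hFG.norm.const_mul _) (fun k => by
      filter_upwards [(hp (s k)).norm_sq_mul] with θ hθ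
      have h1 : ‖p (s k) θ‖ ^ 2 ≤ 1 + I := by
        refine le_trans ?_ (hCI (s k))
        rw [← hθ]
        exact le_mul_of_one_le_right (by positivity) (hW _ θ)
      have h2 : p (s k) θ ^ 2 * F θ * (p (s k) θ ^ 2 * G θ)
          = (p (s k) θ ^ 2) ^ 2 * (F θ * G θ) := by ring
      rw [h2, norm_mul, norm_pow, norm_pow]
      gcongr) (by
      filter_upwards [hp1] with θ hθ
      have := ((hθ.pow 2).mul_const (F θ)).mul ((hθ.pow 2).mul_const (G θ))
      simpa using this)
  simp_rw [hzero] at hlim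
  exact tendsto_nhds_unique hlim tendsto_const_nhds

lemma IsAnalyticFrom.congr {a : ℤ} {F G : ℝ → ℂ} (hF : IsAnalyticFrom a F)
    (h : F =ᵐ[circMeas] G) : IsAnalyticFrom a G := by
  refine ⟨hF.integrable.congr h, fun k hk => ?_⟩
  rw [← hF.integral_eq k hk]
  apply integral_congr_ae
  filter_upwards [h] with θ hθ
  rw [hθ]

/-- The product of two functions in the Hardy space `H¹`, one of them with mean zero, has mean zero
as soon as it is integrable. -/
theorem IsAnalyticFrom.integral_mul_eq_zero {F G : ℝ → ℂ} (hF : IsAnalyticFrom 1 F)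
    (hG : IsAnalyticFrom 0 G) (hFG : Integrable (fun θ => F θ * G θ) circMeas) :
    ∫ θ, F θ * G θ ∂circMeas = 0 := by
  have hF' := hF.integrable.1.ae_eq_mk
  have hG' := hG.integrable.1.ae_eq_mk
  have h : (fun θ => F θ * G θ) =ᵐ[circMeas] fun θ => hF.integrable.1.mk F θ *
      hG.integrable.1.mk G θ := hF'.mul hG'
  rw [integral_congr_ae h]
  exact (hF.congr hF').integral_mul_eq_zero_of_measurable (hG.congr hG')
    hF.integrable.1.stronglyMeasurable_mk.measurable hG.integrable.1.stronglyMeasurable_mk.measurable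
    (hFG.congr h)

end HardyProduct

/-! ### Measures with a density, and restriction maps -/

section DensityMeasure

variable {α : ℝ} {f g : ℝ → ℝ}

lemma densityMeasure_compl (f : ℝ → ℝ) : densityMeasure f (Set.Ioc (-Real.pi) Real.pi)ᶜ = 0 :=
  densityMeasure_ac f circMeas_compl

lemma densityMeasure_add (hf : Measurable f) (hf0 : ∀ᵐ θ ∂circMeas, 0 < f θ)
    (hg0 : ∀ᵐ θ ∂circMeas, 0 < g θ) :
    densityMeasure (fun θ => f θ + g θ) = densityMeasure f + densityMeasure g := by
  rw [densityMeasure, densityMeasure, densityMeasure,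
    ← withDensity_add_left hf.ennreal_ofReal]
  apply withDensity_congr_ae
  filter_upwards [hf0, hg0] with θ h1 h2
  rw [Pi.add_apply, ENNReal.ofReal_add h1.le h2.le]

lemma circMeas_ac_densityMeasure_of_pos (hf : Measurable f) (hf0 : ∀ᵐ θ ∂circMeas, 0 < f θ) :
    circMeas ≪ densityMeasure f := by
  refine withDensity_absolutelyContinuous' hf.ennreal_ofReal.aemeasurable ?_
  filter_upwards [hf0] with θ h
  simpa using h

lemma integrable_densityMeasure_iff (hf : Measurable f) (hf0 : ∀ᵐ θ ∂circMeas, 0 < f θ)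
    {E : Type*} [NormedAddCommGroup E] [NormedSpace ℝ E] {F : ℝ → E} :
    Integrable F (densityMeasure f) ↔ Integrable (fun θ => f θ • F θ) circMeas := by
  rw [densityMeasure, integrable_withDensity_iff_integrable_smul' hf.ennreal_ofReal
    (ae_of_all _ fun θ => ENNReal.ofReal_lt_top)]
  apply integrable_congr
  filter_upwards [hf0] with θ h
  rw [ENNReal.toReal_ofReal h.le]

lemma integral_densityMeasure_eq (hf : Measurable f) (hf0 : ∀ᵐ θ ∂circMeas, 0 < f θ)
    {E : Type*} [NormedAddCommGroup E] [NormedSpace ℝ E] (F : ℝ → E) :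
    ∫ θ, F θ ∂(densityMeasure f) = ∫ θ, f θ • F θ ∂circMeas := by
  rw [densityMeasure, integral_withDensity_eq_integral_toReal_smul hf.ennreal_ofReal
    (ae_of_all _ fun θ => ENNReal.ofReal_lt_top)]
  apply integral_congr_ae
  filter_upwards [hf0] with θ h
  rw [ENNReal.toReal_ofReal h.le]

/-- Hölder's inequality: if `W^{-1/(α-1)}` is integrable, then `L^α(W dθ)` embeds into
`L¹(dθ)`. -/
lemma exists_lintegral_enorm_le (hα : 1 < α) {W : ℝ → ℝ} (hW : Measurable W)
    (hW0 : ∀ᵐ θ ∂circMeas, 0 < W θ)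
    (hWi : Integrable (fun θ => W θ ^ (-1 / (α - 1))) circMeas) :
    ∃ M : ℝ≥0∞, M ≠ ∞ ∧ ∀ h : ℝ → ℂ, AEStronglyMeasurable h (densityMeasure W) →
      ∫⁻ θ, ‖h θ‖ₑ ∂circMeas ≤ M * eLpNorm h (ENNReal.ofReal α) (densityMeasure W) := by
  have hα0 : 0 < α := by linarith
  have hα1 : 0 < α - 1 := by linarith
  have hpq : α.HolderConjugate (α / (α - 1)) := Real.HolderConjugate.conjExponent hα
  let w : ℝ → ℝ≥0∞ := fun θ => ENNReal.ofReal (W θ)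
  have hwm : Measurable w := hW.ennreal_ofReal
  refine ⟨(∫⁻ θ, (w θ ^ (-(1 / α))) ^ (α / (α - 1)) ∂circMeas) ^ (1 / (α / (α - 1))), ?_,
    fun h hh => ?_⟩
  · refine ENNReal.rpow_ne_top_of_nonneg (by positivity) (ne_of_lt ?_)
    refine lt_of_eq_of_lt ?_ hWi.2
    refine lintegral_congr_ae ?_
    filter_upwards [hW0] with θ hθ
    have he : -(1 / α) * (α / (α - 1)) = -1 / (α - 1) := by field_simp
    rw [← ENNReal.rpow_mul, he, ENNReal.ofReal_rpow_of_pos hθ,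
      Real.enorm_of_nonneg (by positivity)]
  · have hhm : AEMeasurable (fun θ => ‖h θ‖ₑ) circMeas :=
      (hh.mono_ac (circMeas_ac_densityMeasure_of_pos hW hW0)).enorm
    have h1 : eLpNorm h (ENNReal.ofReal α) (densityMeasure W)
        = (∫⁻ θ, (w θ ^ (1 / α) * ‖h θ‖ₑ) ^ α ∂circMeas) ^ (1 / α) := by
      rw [eLpNorm_eq_lintegral_rpow_enorm_toReal (by simpa using hα0) ENNReal.ofReal_ne_top,
        ENNReal.toReal_ofReal hα0.le, densityMeasure,
        lintegral_withDensity_eq_lintegral_mul_non_measurable₀ _ hwm.aemeasurable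
          (ae_of_all _ fun θ => ENNReal.ofReal_lt_top)]
      congr 1
      refine lintegral_congr fun θ => ?_
      rw [ENNReal.mul_rpow_of_nonneg _ _ hα0.le, ← ENNReal.rpow_mul, one_div_mul_cancel hα0.ne',
        ENNReal.rpow_one, Pi.mul_apply]
    have h2 := ENNReal.lintegral_mul_le_Lp_mul_Lq circMeas hpq
      (f := fun θ => w θ ^ (1 / α) * ‖h θ‖ₑ) (g := fun θ => w θ ^ (-(1 / α)))
      ((hwm.pow_const _).aemeasurable.mul hhm) (hwm.pow_const _).aemeasurable
    rw [h1, mul_comm]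
    refine le_trans (le_of_eq (lintegral_congr_ae ?_)) h2
    filter_upwards [hW0] with θ hθ
    have hw0 : w θ ≠ 0 := by simpa [w] using hθ
    have hwt : w θ ≠ ∞ := ENNReal.ofReal_ne_top
    rw [Pi.mul_apply, mul_right_comm, ← ENNReal.rpow_add _ _ hw0 hwt, add_neg_cancel,
      ENNReal.rpow_zero, one_mul]

end DensityMeasure

section Restriction

variable {S : Type*} [MeasurableSpace S] {p : ℝ≥0∞}

/-- The map `L^p(m) → L^p(μ)` for `μ ≤ m` given by the identity on functions. -/
noncomputable def Lp.ofMeasureLE [Fact (1 ≤ p)] {μ m : Measure S} (h : μ ≤ m) :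
    Lp ℂ p m →L[ℂ] Lp ℂ p μ :=
  LinearMap.mkContinuous
    { toFun := fun φ => ((Lp.memLp φ).mono_measure h).toLp φ
      map_add' := fun φ ψ => by
        rw [← MemLp.toLp_add]
        exact MemLp.toLp_congr _ _
          ((Lp.coeFn_add φ ψ).filter_mono (Measure.absolutelyContinuous_of_le h).ae_le)
      map_smul' := fun c φ => by
        rw [RingHom.id_apply, ← MemLp.toLp_const_smul]
        exact MemLp.toLp_congr _ _
          ((Lp.coeFn_smul c φ).filter_mono (Measure.absolutelyContinuous_of_le h).ae_le) } 1
    fun φ => by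
      rw [one_mul, Lp.norm_def φ]
      simp only [LinearMap.coe_mk, AddHom.coe_mk]
      rw [Lp.norm_toLp]
      exact ENNReal.toReal_mono (Lp.eLpNorm_ne_top φ) (eLpNorm_mono_measure _ h)

lemma Lp.coeFn_ofMeasureLE [Fact (1 ≤ p)] {μ m : Measure S} (h : μ ≤ m) (φ : Lp ℂ p m) :
    Lp.ofMeasureLE h φ =ᵐ[μ] φ := MemLp.coeFn_toLp ((Lp.memLp φ).mono_measure h)

lemma Lp.ofMeasureLE_eq [Fact (1 ≤ p)] {μ m : Measure S} (h : μ ≤ m) {φ : Lp ℂ p m}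
    {ψ : Lp ℂ p μ} {F : S → ℂ} (hφ : φ =ᵐ[m] F) (hψ : ψ =ᵐ[μ] F) : Lp.ofMeasureLE h φ = ψ :=
  Lp.ext (((Lp.coeFn_ofMeasureLE h φ).trans
    (hφ.filter_mono (Measure.absolutelyContinuous_of_le h).ae_le)).trans hψ.symm)

lemma norm_rpow_eq_add_of_measure_add {α : ℝ} [Fact (1 ≤ ENNReal.ofReal α)] (hα : 0 < α)
    {μ ν m : Measure S} (hm : m = μ + ν) (hμ : μ ≤ m) (hν : ν ≤ m)
    (φ : Lp ℂ (ENNReal.ofReal α) m) :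
    ‖φ‖ ^ α = ‖Lp.ofMeasureLE hμ φ‖ ^ α + ‖Lp.ofMeasureLE hν φ‖ ^ α := by
  have hi := MemLp.integrable_norm_rpow_ofReal hα (Lp.memLp φ)
  rw [Lp_norm_rpow hα, Lp_norm_rpow hα, Lp_norm_rpow hα]
  have h1 : ∫ x, ‖φ x‖ ^ α ∂m = ∫ x, ‖φ x‖ ^ α ∂μ + ∫ x, ‖φ x‖ ^ α ∂ν := by
    conv_lhs => rw [show ∫ x, ‖φ x‖ ^ α ∂m = ∫ x, ‖φ x‖ ^ α ∂(μ + ν) by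
      congr 1]
    exact integral_add_measure (hi.mono_measure hμ) (hi.mono_measure hν)
  rw [h1]
  congr 1 <;> apply integral_congr_ae
  · filter_upwards [Lp.coeFn_ofMeasureLE hμ φ] with x hx
    rw [hx]
  · filter_upwards [Lp.coeFn_ofMeasureLE hν φ] with x hx
    rw [hx]

end Restriction

/-! ### The past, the symbol, and the system of equations -/

section Past

variable {p : ℝ≥0∞} {α : ℝ}

lemma trigVal_eq (c : ℤ →₀ ℂ) : trigVal c = Finsupp.linearCombination ℂ expi c := by
  ext θ
  rw [Finsupp.linearCombination_apply, Finsupp.sum, Finset.sum_apply]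
  rfl

/-- The closed span of `e^{ikθ}`, `k ≤ -1`, as a subspace of `L^p(μ)`. -/
noncomputable def pastLp (μ : Measure ℝ) [IsFiniteMeasure μ] (p : ℝ≥0∞) [Fact (1 ≤ p)] :
    Submodule ℂ (Lp ℂ p μ) :=
  ((Finsupp.supported ℂ ℂ (Set.Iic (-1 : ℤ))).map (trigLp μ p)).topologicalClosure

lemma isClosed_pastLp (μ : Measure ℝ) [IsFiniteMeasure μ] [Fact (1 ≤ p)] :
    IsClosed (pastLp μ p : Set (Lp ℂ p μ)) := Submodule.isClosed_topologicalClosure _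

lemma trigLp_mem_pastLp (μ : Measure ℝ) [IsFiniteMeasure μ] [Fact (1 ≤ p)] {c : ℤ →₀ ℂ}
    (hc : c ∈ Finsupp.supported ℂ ℂ (Set.Iic (-1 : ℤ))) : trigLp μ p c ∈ pastLp μ p :=
  Submodule.le_topologicalClosure _ (Submodule.mem_map_of_mem hc)

lemma exists_tendsto_of_mem_pastLp {μ : Measure ℝ} [IsFiniteMeasure μ] [Fact (1 ≤ p)]
    {φ : Lp ℂ p μ} (hφ : φ ∈ pastLp μ p) :
    ∃ c : ℕ → ℤ →₀ ℂ, (∀ n, c n ∈ Finsupp.supported ℂ ℂ (Set.Iic (-1 : ℤ))) ∧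
      Tendsto (fun n => trigLp μ p (c n)) atTop (𝓝 φ) := by
  obtain ⟨x, hx, hlim⟩ := mem_closure_iff_seq_limit.1 hφ
  choose c hc hcx using hx
  exact ⟨c, hc, by simpa only [hcx] using hlim⟩

lemma tendsto_eLpNorm_trigVal_sub {μ : Measure ℝ} [IsFiniteMeasure μ] [Fact (1 ≤ p)]
    {φ : Lp ℂ p μ} {c : ℕ → ℤ →₀ ℂ} (h : Tendsto (fun n => trigLp μ p (c n)) atTop (𝓝 φ)) :
    Tendsto (fun n => eLpNorm (trigVal (c n) - (φ : ℝ → ℂ)) p μ) atTop (𝓝 0) := by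
  rw [tendsto_iff_edist_tendsto_0] at h
  refine h.congr fun n => ?_
  rw [Lp.edist_def]
  exact eLpNorm_congr_ae ((coeFn_trigLp μ p (c n)).sub (ae_eq_refl _))

lemma mem_pastFunctions {μ : Measure ℝ} [IsFiniteMeasure μ] [Fact (1 ≤ ENNReal.ofReal α)]
    {φ : Lp ℂ (ENNReal.ofReal α) μ} (hφ : φ ∈ pastLp μ (ENNReal.ofReal α)) :
    (φ : ℝ → ℂ) ∈ pastFunctions α μ := by
  obtain ⟨c, hc, hlim⟩ := exists_tendsto_of_mem_pastLp hφ
  refine ⟨Lp.memLp φ, fun n => trigVal (c n), fun n => ?_, tendsto_eLpNorm_trigVal_sub hlim⟩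
  rw [Finsupp.mem_span_image_iff_linearCombination]
  exact ⟨c n, hc n, (trigVal_eq _).symm⟩

lemma integrable_conj {F : ℝ → ℂ} (hF : Integrable F circMeas) :
    Integrable (fun θ => conj (F θ)) circMeas :=
  (integrable_norm_iff (Complex.continuous_conj.comp_aestronglyMeasurable hF.1)).1
    (hF.norm.congr (ae_of_all _ fun _ => (RCLike.norm_conj _).symm))

lemma integral_expi_neg_mul_conj (k : ℤ) (F : ℝ → ℂ) :
    ∫ θ, expi k θ * conj (F θ) ∂circMeas = conj (∫ θ, expi (-k) θ * F θ ∂circMeas) := by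
  rw [← integral_conj]
  congr 1; ext θ
  rw [map_mul, conj_expi, neg_neg]

/-- Elements of the past have vanishing Fourier coefficients at indices `k ≥ 0`. -/
lemma isAnalyticFrom_conj_of_mem_pastLp (hα : 1 < α) [Fact (1 ≤ ENNReal.ofReal α)] {W : ℝ → ℝ}
    [IsFiniteMeasure (densityMeasure W)] (hW : Measurable W) (hW0 : ∀ᵐ θ ∂circMeas, 0 < W θ)
    (hWi : Integrable (fun θ => W θ ^ (-1 / (α - 1))) circMeas)
    {φ : Lp ℂ (ENNReal.ofReal α) (densityMeasure W)}
    (hφ : φ ∈ pastLp (densityMeasure W) (ENNReal.ofReal α)) :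
    IsAnalyticFrom 0 fun θ => conj (φ θ) := by
  obtain ⟨M, hM, hle⟩ := exists_lintegral_enorm_le hα hW hW0 hWi
  obtain ⟨c, hc, hlim⟩ := exists_tendsto_of_mem_pastLp hφ
  have hφm : AEStronglyMeasurable φ circMeas :=
    (Lp.aestronglyMeasurable φ).mono_ac (circMeas_ac_densityMeasure_of_pos hW hW0)
  have hφi : Integrable φ circMeas :=
    ⟨hφm, (hle φ (Lp.aestronglyMeasurable φ)).trans_lt
      (ENNReal.mul_lt_top hM.lt_top (Lp.eLpNorm_lt_top φ))⟩
  refine IsAnalyticFrom.of_tendsto (F := fun n θ => conj (trigVal (c n) θ)) (fun n => ?_)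
    (integrable_conj hφi) ?_
  · refine ⟨integrable_conj ((memLp_trigVal circMeas 1 _).integrable le_rfl), fun k hk => ?_⟩
    rw [integral_expi_neg_mul_conj]
    have h1 : ∀ θ, expi (-k) θ * trigVal (c n) θ
        = ∑ m ∈ (c n).support, c n m * expi (-k + m) θ := fun θ => by
      rw [trigVal, Finsupp.mul_sum]
      refine Finset.sum_congr rfl fun m _ => ?_
      rw [expi_add]; ring
    simp_rw [h1]
    rw [integral_finsetSum _ fun m _ =>
      ((memLp_expi circMeas 1 _).integrable le_rfl).const_mul _, Finset.sum_eq_zero, map_zero]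
    intro m hm
    have : m ≤ (-1 : ℤ) := (Finsupp.mem_supported ℂ (c n)).1 (hc n) hm
    rw [integral_const_mul, integral_expi, if_neg (by linarith), mul_zero]
  · have h1 := ENNReal.Tendsto.const_mul (a := M) (tendsto_eLpNorm_trigVal_sub hlim) (Or.inr hM)
    rw [mul_zero] at h1
    refine tendsto_of_tendsto_of_tendsto_of_le_of_le tendsto_const_nhds h1 (fun n => zero_le)
      fun n => ?_
    refine le_trans (le_of_eq (lintegral_congr fun θ => ?_)) (hle (trigVal (c n) - (φ : ℝ → ℂ))
      ((continuous_trigVal _).aestronglyMeasurable.sub (Lp.aestronglyMeasurable φ)))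
    rw [← map_sub, Pi.sub_apply, ← ofReal_norm, ← ofReal_norm, RCLike.norm_conj]

end Past

section Symbol

/-- The coefficients of the partial sum `∑_{j < N} a_j e^{ijθ}`. -/
noncomputable def symbolCoeffs (a : ℕ → ℂ) (N : ℕ) : ℤ →₀ ℂ :=
  ∑ j ∈ Finset.range N, Finsupp.single (j : ℤ) (a j)

lemma symbolCoeffs_sum (a : ℕ → ℂ) (N : ℕ) (v : ℤ → ℂ) :
    ((symbolCoeffs a N).sum fun n b => b * v n) = ∑ j ∈ Finset.range N, a j * v j := by
  change Finsupp.linearCombination ℂ v (symbolCoeffs a N) = _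
  rw [symbolCoeffs, map_sum]
  simp [Finsupp.linearCombination_single]

lemma norm_mul_expi (a : ℕ → ℂ) (j : ℕ) (θ : ℝ) : ‖a j * expi j θ‖ = ‖a j‖ := by
  rw [norm_mul, norm_expi, mul_one]

lemma summable_mul_expi {a : ℕ → ℂ} (ha : Summable fun j => ‖a j‖) (θ : ℝ) :
    Summable fun j : ℕ => a j * expi j θ :=
  Summable.of_norm (by simpa only [norm_mul_expi] using ha)

lemma continuous_symbolA {a : ℕ → ℂ} (ha : Summable fun j => ‖a j‖) : Continuous (symbolA a) :=
  continuous_tsum (fun j => continuous_const.mul (continuous_expi j)) ha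
    fun j θ => (norm_mul_expi a j θ).le

lemma norm_trigVal_symbolCoeffs_sub_le {a : ℕ → ℂ} (ha : Summable fun j => ‖a j‖) (N : ℕ)
    (θ : ℝ) : ‖trigVal (symbolCoeffs a N) θ - symbolA a θ‖ ≤ ∑' j, ‖a (j + N)‖ := by
  rw [trigVal, symbolCoeffs_sum, symbolA, ← (summable_mul_expi ha θ).sum_add_tsum_nat_add N,
    sub_add_cancel_left, norm_neg]
  refine (norm_tsum_le_tsum_norm ?_).trans (le_of_eq (tsum_congr fun _ => norm_mul_expi a _ θ))
  simpa only [norm_mul_expi] using (summable_nat_add_iff N).2 ha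

lemma memLp_symbolA {a : ℕ → ℂ} (ha : Summable fun j => ‖a j‖) (μ : Measure ℝ)
    [IsFiniteMeasure μ] (p : ℝ≥0∞) : MemLp (symbolA a) p μ := by
  refine MemLp.of_bound (continuous_symbolA ha).aestronglyMeasurable (∑' j, ‖a j‖)
    (ae_of_all _ fun θ => ?_)
  refine (norm_tsum_le_tsum_norm ?_).trans (le_of_eq (tsum_congr fun _ => norm_mul_expi a _ θ))
  simpa only [norm_mul_expi] using ha

lemma tendsto_trigLp_symbolCoeffs {a : ℕ → ℂ} (ha : Summable fun j => ‖a j‖) (μ : Measure ℝ)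
    [IsFiniteMeasure μ] (p : ℝ≥0∞) [Fact (1 ≤ p)] :
    Tendsto (fun N => trigLp μ p (symbolCoeffs a N)) atTop
      (𝓝 ((memLp_symbolA ha μ p).toLp (symbolA a))) := by
  rw [tendsto_iff_edist_tendsto_0]
  have h0 := tendsto_sum_nat_add fun j => ‖a j‖
  have h1 := (ENNReal.continuous_ofReal.tendsto 0).comp h0
  rw [ENNReal.ofReal_zero] at h1
  have h2 := ENNReal.Tendsto.const_mul (a := μ Set.univ ^ p.toReal⁻¹) h1
    (Or.inr (ENNReal.rpow_ne_top_of_nonneg (by positivity) (measure_ne_top _ _)))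
  rw [mul_zero] at h2
  refine tendsto_of_tendsto_of_tendsto_of_le_of_le tendsto_const_nhds h2 (fun n => zero_le)
    fun N => ?_
  rw [Lp.edist_def]
  refine eLpNorm_le_of_ae_bound ?_
  filter_upwards [coeFn_trigLp μ p (symbolCoeffs a N), (memLp_symbolA ha μ p).coeFn_toLp]
    with θ h3 h4
  rw [Pi.sub_apply, h3, h4]
  exact norm_trigVal_symbolCoeffs_sub_le ha N θ

end Symbol

section System

variable {α : ℝ} {f g : ℝ → ℝ} {a : ℕ → ℂ}

/-- The system has at most one solution.  Given two, the difference of the functions `C` times the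
conjugate of the difference of the functions `h` is a product of one-sided Fourier series, hence has
mean zero, while its real part has a sign by monotonicity of the signed power. -/
theorem SolvesSystem.unique (hα : 1 < α) (hf : Measurable f) (hg : Measurable g)
    (hf0 : ∀ᵐ θ ∂circMeas, 0 < f θ) (hg0 : ∀ᵐ θ ∂circMeas, 0 < g θ)
    [IsFiniteMeasure (densityMeasure f)] (ha : Summable fun j => ‖a j‖) {h h' : ℝ → ℂ}
    {c c' : ℕ → ℂ}
    (hhf : MemLp h (ENNReal.ofReal α) (densityMeasure f))
    (hhg : MemLp h (ENNReal.ofReal α) (densityMeasure g))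
    (hhf' : MemLp h' (ENNReal.ofReal α) (densityMeasure f))
    (hhg' : MemLp h' (ENNReal.ofReal α) (densityMeasure g))
    (hs : SolvesSystem α f g a h c) (hs' : SolvesSystem α f g a h' c') :
    h' =ᵐ[circMeas] h ∧ c' = c := by
  obtain ⟨⟨C, ⟨hCi, hCc, hCn⟩, hC⟩, hhi, hhz⟩ := hs
  obtain ⟨⟨C', ⟨hCi', hCc', hCn'⟩, hC'⟩, hhi', hhz'⟩ := hs'
  have hCi : Integrable C circMeas := hCi
  have hCi' : Integrable C' circMeas := hCi'
  have hhi : Integrable h circMeas := hhi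
  have hhi' : Integrable h' circMeas := hhi'
  have hA := memLp_symbolA ha (densityMeasure f) (ENNReal.ofReal α)
  let D : ℝ → ℂ := fun θ => C θ - C' θ
  let d : ℝ → ℂ := fun θ => conj (h θ - h' θ)
  have hD : IsAnalyticFrom 1 D := by
    refine ⟨hCi.sub hCi', fun k hk => ?_⟩
    simp only [D, mul_sub]
    have h1 := hCn (-k) (by linarith)
    have h2 := hCn' (-k) (by linarith)
    rw [neg_neg] at h1 h2
    rw [integral_sub (integrable_expi_mul hCi k) (integrable_expi_mul hCi' k), h1, h2, sub_zero]
  have hd : IsAnalyticFrom 0 d := by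
    refine ⟨integrable_conj (hhi.sub hhi'), fun k hk => ?_⟩
    obtain ⟨n, rfl⟩ := Int.eq_ofNat_of_zero_le hk
    have h1 := hhz n
    have h2 := hhz' n
    simp only [d]
    rw [integral_expi_neg_mul_conj]
    simp_rw [mul_sub]
    rw [integral_sub (integrable_expi_mul hhi _) (integrable_expi_mul hhi' _), h1, h2, sub_zero,
      map_zero]
  -- the two monotonicity defects
  let u : ℝ → ℂ := fun θ => ((symbolA a θ - h' θ) - (symbolA a θ - h θ)) *
    (signedPow (α - 1) (symbolA a θ - h' θ) - signedPow (α - 1) (symbolA a θ - h θ))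
  let v : ℝ → ℂ := fun θ => (h θ - h' θ) * (signedPow (α - 1) (h θ) - signedPow (α - 1) (h' θ))
  have hu : Integrable (fun θ => f θ • u θ) circMeas := by
    rw [← integrable_densityMeasure_iff hf hf0]
    simp only [u, mul_sub]
    have hv := (hA.sub hhf').sub (hA.sub hhf)
    exact (integrable_mul_signedPow hα hv (hA.sub hhf')).sub
      (integrable_mul_signedPow hα hv (hA.sub hhf))
  have hv : Integrable (fun θ => g θ • v θ) circMeas := by
    rw [← integrable_densityMeasure_iff hg hg0]
    simp only [v, mul_sub]
    have hv := hhg.sub hhg'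
    exact (integrable_mul_signedPow hα hv hhg).sub (integrable_mul_signedPow hα hv hhg')
  have hprod : ∀ᵐ θ ∂circMeas, conj (D θ * d θ) = -(f θ • u θ + g θ • v θ) := by
    filter_upwards [hC, hC'] with θ h1 h2
    simp only [D, d, u, v]
    rw [map_mul, Complex.conj_conj, map_sub, ← h1, ← h2, Complex.real_smul, Complex.real_smul]
    ring
  have hint : Integrable (fun θ => conj (D θ * d θ)) circMeas :=
    ((hu.add hv).neg).congr (by filter_upwards [hprod] with θ h1; rw [h1]; rfl)
  have hint' : Integrable (fun θ => D θ * d θ) circMeas :=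
    (integrable_conj hint).congr (ae_of_all _ fun θ => Complex.conj_conj _)
  have hzero := hD.integral_mul_eq_zero hd hint'
  have hsum : ∫ θ, (f θ • u θ + g θ • v θ) ∂circMeas = 0 := by
    have h1 : ∫ θ, conj (D θ * d θ) ∂circMeas = 0 := by rw [integral_conj, hzero, map_zero]
    rw [integral_congr_ae hprod, integral_neg, neg_eq_zero] at h1
    exact h1
  have hre : ∫ θ, (f θ * (u θ).re + g θ * (v θ).re) ∂circMeas = 0 := by
    have h1 : ∫ θ, (f θ • u θ + g θ • v θ).re ∂circMeas
        = (∫ θ, (f θ • u θ + g θ • v θ) ∂circMeas).re := integral_re (hu.add hv)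
    rw [hsum] at h1
    simpa using h1
  have hu0 : ∀ θ, 0 ≤ (u θ).re := fun θ => re_signedPow_mono hα _ _
  have hv0 : ∀ θ, 0 ≤ (v θ).re := fun θ => re_signedPow_mono hα _ _
  have hae : (fun θ => f θ * (u θ).re + g θ * (v θ).re) =ᵐ[circMeas] 0 := by
    refine (integral_eq_zero_iff_of_nonneg_ae ?_ ?_).1 hre
    · filter_upwards [hf0, hg0] with θ h1 h2
      exact add_nonneg (mul_nonneg h1.le (hu0 θ)) (mul_nonneg h2.le (hv0 θ))
    · have := (hu.add hv).re
      refine this.congr (ae_of_all _ fun θ => ?_)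
      simp
  have heq : h' =ᵐ[circMeas] h := by
    filter_upwards [hae, hf0, hg0] with θ h1 h2 h3
    have h1 : f θ * (u θ).re + g θ * (v θ).re = 0 := h1
    have h4 : (v θ).re = 0 := by
      have := mul_nonneg h2.le (hu0 θ)
      have h5 := mul_nonneg h3.le (hv0 θ)
      have h6 : g θ * (v θ).re = 0 := by linarith
      exact (mul_eq_zero.1 h6).resolve_left h3.ne'
    exact (eq_of_re_signedPow_mono hα h4).symm
  refine ⟨heq, ?_⟩
  ext j
  rw [← hCc, ← hCc']
  congr 1
  apply integral_congr_ae
  filter_upwards [heq, hC, hC'] with θ h1 h2 h3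
  rw [h1] at h3
  rw [← Complex.conj_conj (C θ), ← h2, h3, Complex.conj_conj]

/-- The first order condition of the minimization problem gives a solution of the system. -/
theorem exists_solvesSystem (hα : 1 < α) (hf : Measurable f) (hg : Measurable g)
    (hf0 : ∀ᵐ θ ∂circMeas, 0 < f θ) (hg0 : ∀ᵐ θ ∂circMeas, 0 < g θ)
    [IsFiniteMeasure (densityMeasure f)] [IsFiniteMeasure (densityMeasure g)]
    (ha : Summable fun j => ‖a j‖) {h : ℝ → ℂ}
    (hhf : MemLp h (ENNReal.ofReal α) (densityMeasure f))
    (hhg : MemLp h (ENNReal.ofReal α) (densityMeasure g))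
    (hh : IsAnalyticFrom 0 fun θ => conj (h θ))
    (horth : ∀ k : ℤ, k < 0 → dualPairing α (densityMeasure f) (expi k) (fun θ => symbolA a θ - h θ)
      = dualPairing α (densityMeasure g) (expi k) h) :
    ∃ c, SolvesSystem α f g a h c := by
  have hA := memLp_symbolA ha (densityMeasure f) (ENNReal.ofReal α)
  let Ψ : ℝ → ℂ := fun θ =>
    signedPow (α - 1) (symbolA a θ - h θ) * (f θ : ℂ) - signedPow (α - 1) (h θ) * (g θ : ℂ)
  have hu : ∀ k, Integrable
      (fun θ => f θ • (expi k θ * signedPow (α - 1) (symbolA a θ - h θ))) circMeas := fun k =>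
    (integrable_densityMeasure_iff hf hf0).1
      (integrable_mul_signedPow hα (memLp_expi _ _ k) (hA.sub hhf))
  have hv : ∀ k, Integrable
      (fun θ => g θ • (expi k θ * signedPow (α - 1) (h θ))) circMeas := fun k =>
    (integrable_densityMeasure_iff hg hg0).1
      (integrable_mul_signedPow hα (memLp_expi _ _ k) hhg)
  have hΨ : ∀ k θ, expi k θ * Ψ θ = f θ • (expi k θ * signedPow (α - 1) (symbolA a θ - h θ))
      - g θ • (expi k θ * signedPow (α - 1) (h θ)) := fun k θ => by
    simp only [Ψ]
    rw [Complex.real_smul, Complex.real_smul]; ring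
  have hΨi : Integrable Ψ circMeas :=
    ((hu 0).sub (hv 0)).congr (ae_of_all _ fun θ => by
      rw [Pi.sub_apply, ← hΨ, expi_zero, one_mul])
  have hΨ0 : ∀ k : ℤ, k < 0 → ∫ θ, expi k θ * Ψ θ ∂circMeas = 0 := fun k hk => by
    simp_rw [hΨ]
    rw [integral_sub (hu k) (hv k), ← integral_densityMeasure_eq hf hf0,
      ← integral_densityMeasure_eq hg hg0, sub_eq_zero]
    exact horth k hk
  refine ⟨fun j => (2 * Real.pi : ℂ)⁻¹ * ∫ θ, expi (-j) θ * conj (Ψ θ) ∂circMeas,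
    ⟨fun θ => conj (Ψ θ), ⟨integrable_conj hΨi, fun j => rfl, fun k hk => ?_⟩,
      ae_of_all _ fun _ => (Complex.conj_conj _).symm⟩,
    (integrable_conj hh.integrable).congr (ae_of_all _ fun θ => Complex.conj_conj _),
    fun k => ?_⟩
  · rw [integral_expi_neg_mul_conj, neg_neg, hΨ0 k hk, map_zero]
  · have h1 := hh.integral_eq k (by positivity)
    rwa [integral_expi_neg_mul_conj, map_eq_zero] at h1

end System

/-! ### Prediction in `‖·‖_α` -/

section Prediction

lemma tendsto_norm_sub_rpow {E : Type*} [NormedAddCommGroup E] {α : ℝ} (hα : 0 < α) {x : ℕ → E}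
    {y : E} (h : Tendsto x atTop (𝓝 y)) : Tendsto (fun n => ‖x n - y‖ ^ α) atTop (𝓝 0) := by
  have := (Real.continuous_rpow_const hα.le).tendsto 0
  rw [Real.zero_rpow hα.ne'] at this
  exact this.comp (tendsto_iff_norm_sub_tendsto_zero.1 h)

variable {Ω : Type*} [MeasurableSpace Ω] {P : Measure Ω} [IsProbabilityMeasure P] {α : ℝ}
  [Fact (1 ≤ ENNReal.ofReal α)]

/-- The range of an `α`-isometric map on a closed subspace is closed under `‖·‖_α`-limits. -/
lemma exists_ae_eq_of_tendstoSaS (hα : 1 < α) {μ : Measure ℝ}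
    {J : Lp ℂ (ENNReal.ofReal α) μ →L[ℂ] Lp ℂ 1 P} (hJ : ∀ φ, HasScale α P (J φ) (‖φ‖ ^ α))
    {S : Submodule ℂ (Lp ℂ (ENNReal.ofReal α) μ)}
    (hS : IsClosed (S : Set (Lp ℂ (ENNReal.ofReal α) μ))) {X : ℕ → Ω → ℂ} {Y : Ω → ℂ}
    (hXY : TendstoSaS α P X Y) {x : ℕ → Lp ℂ (ENNReal.ofReal α) μ} (hx : ∀ n, x n ∈ S)
    (hxX : ∀ n, J (x n) =ᵐ[P] X n) : ∃ y ∈ S, J y =ᵐ[P] Y := by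
  have hα0 : 0 < α := by linarith
  have hanti : AntilipschitzWith (scaleConst α).toNNReal J := by
    refine AddMonoidHomClass.antilipschitz_of_bound J fun φ => ?_
    have := (hJ φ).rpow_le_norm hα0
    rwa [← Real.rpow_mul (norm_nonneg _), mul_one_div_cancel hα0.ne', Real.rpow_one,
      ← Real.coe_toNNReal _ (scaleConst_pos hα0).le] at this
  have hclosed : IsClosed (J '' S) :=
    (hanti.isClosedEmbedding J.uniformContinuous).isClosedMap _ hS
  have hX : ∀ n, MemLp (X n) 1 P := fun n => (memLp_congr_ae (hxX n)).1 (Lp.memLp _)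
  have hY : MemLp Y 1 P := by
    have := (hX 0).sub (((hXY.1 0).hasScale hα).memLp_one hα)
    rwa [sub_sub_cancel] at this
  have hlim : Tendsto (fun n => J (x n)) atTop (𝓝 (hY.toLp Y)) := by
    rw [tendsto_iff_edist_tendsto_0]
    refine (hXY.tendsto_lintegral hα).congr fun n => ?_
    rw [Lp.edist_def, eLpNorm_one_eq_lintegral_enorm]
    apply lintegral_congr_ae
    filter_upwards [hxX n, hY.coeFn_toLp] with ω h1 h2
    rw [Pi.sub_apply, h1, h2]
  obtain ⟨y, hy, hyY⟩ := hclosed.mem_of_tendsto hlim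
    (Eventually.of_forall fun n => Set.mem_image_of_mem J (hx n))
  exact ⟨y, hy, by rw [hyY]; exact hY.coeFn_toLp⟩

/-- The stochastic integral identifies `H⁻` with the closed span of `e^{ikθ}`, `k ≤ -1`. -/
theorem mem_pastSpace_iff (hα : 1 < α) {μ : Measure ℝ} [IsFiniteMeasure μ]
    {J : Lp ℂ (ENNReal.ofReal α) μ →L[ℂ] Lp ℂ 1 P} (hJ : ∀ φ, HasScale α P (J φ) (‖φ‖ ^ α))
    {ζ : ℤ → Ω → ℂ}
    (hζ : ∀ c, J (trigLp μ (ENNReal.ofReal α) c) =ᵐ[P] fun ω => c.sum fun n b => b * ζ n ω)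
    {W : Ω → ℂ} :
    W ∈ pastSpace α P ζ ↔ ∃ w ∈ pastLp μ (ENNReal.ofReal α), J w =ᵐ[P] W := by
  have hα0 : 0 < α := by linarith
  have hζ' : ∀ c, J (trigLp μ (ENNReal.ofReal α) c) =ᵐ[P] Finsupp.linearCombination ℂ ζ c :=
    fun c => by
      refine (hζ c).trans (ae_of_all _ fun ω => ?_)
      rw [Finsupp.linearCombination_apply, Finsupp.sum, Finset.sum_apply]
      rfl
  constructor
  · rintro ⟨X, hX, hXW⟩
    choose c hc hcX using fun n => (Finsupp.mem_span_image_iff_linearCombination ℂ).1 (hX n)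
    exact exists_ae_eq_of_tendstoSaS hα hJ (isClosed_pastLp μ) hXW
      (fun n => trigLp_mem_pastLp μ (hc n)) fun n => by rw [← hcX]; exact hζ' _
  · rintro ⟨w, hw, hwW⟩
    obtain ⟨c, hc, hlim⟩ := exists_tendsto_of_mem_pastLp hw
    refine ⟨fun n => Finsupp.linearCombination ℂ ζ (c n), fun n => ?_, ?_⟩
    · rw [Finsupp.mem_span_image_iff_linearCombination]
      exact ⟨c n, hc n, rfl⟩
    · refine tendstoSaS_of_tendsto hα
        (N := fun n => ‖trigLp μ (ENNReal.ofReal α) (c n) - w‖ ^ α) (fun n => ?_) ?_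
      · refine (hJ (trigLp μ _ (c n) - w)).congr ?_
        rw [map_sub]
        exact (Lp.coeFn_sub _ _).trans ((hζ' _).sub hwW)
      · exact tendsto_norm_sub_rpow hα0 hlim

variable {ξ : ℤ → Ω → ℂ} {Zξ : ℝ → Ω → ℂ} {μ : Measure ℝ} {a : ℕ → ℂ}

lemma IsHarmonizable.isFunctional_integral [IsFiniteMeasure μ] (hα : 1 < α)
    (hξ : IsHarmonizable α P ξ Zξ μ) {J : Lp ℂ (ENNReal.ofReal α) μ →L[ℂ] Lp ℂ 1 P}
    (hJ : ∀ φ, HasScale α P (J φ) (‖φ‖ ^ α))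
    (hJ' : ∀ c, J (stepLp μ (ENNReal.ofReal α) c) =ᵐ[P] stepIntegral Zξ c)
    (ha : Summable fun j => ‖a j‖) :
    IsFunctional α P a ξ (J ((memLp_symbolA ha μ (ENNReal.ofReal α)).toLp (symbolA a))) := by
  have hα0 : 0 < α := by linarith
  have hlim := tendsto_trigLp_symbolCoeffs ha μ (ENNReal.ofReal α)
  refine tendstoSaS_of_tendsto hα (N := fun N => ‖trigLp μ (ENNReal.ofReal α) (symbolCoeffs a N)
    - (memLp_symbolA ha μ (ENNReal.ofReal α)).toLp (symbolA a)‖ ^ α) (fun N => ?_) ?_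
  · refine (hJ _).congr ?_
    rw [map_sub]
    refine (Lp.coeFn_sub _ _).trans ?_
    filter_upwards [hξ.integral_trigLp hα hJ' (symbolCoeffs a N)] with ω h1
    rw [Pi.sub_apply, Pi.sub_apply, h1, symbolCoeffs_sum]
  · exact tendsto_norm_sub_rpow hα0 hlim

lemma IsFunctional.ae_eq [IsFiniteMeasure μ] (hα : 1 < α)
    (hξ : IsHarmonizable α P ξ Zξ μ) {J : Lp ℂ (ENNReal.ofReal α) μ →L[ℂ] Lp ℂ 1 P}
    (hJ' : ∀ c, J (stepLp μ (ENNReal.ofReal α) c) =ᵐ[P] stepIntegral Zξ c)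
    (ha : Summable fun j => ‖a j‖) {U : Ω → ℂ} (hU : IsFunctional α P a ξ U) :
    J ((memLp_symbolA ha μ (ENNReal.ofReal α)).toLp (symbolA a)) =ᵐ[P] U := by
  refine TendstoSaS.ae_eq hα hU
    (x := fun N => J (trigLp μ (ENNReal.ofReal α) (symbolCoeffs a N))) (fun N => ?_)
    ((J.continuous.tendsto _).comp (tendsto_trigLp_symbolCoeffs ha μ (ENNReal.ofReal α)))
  filter_upwards [hξ.integral_trigLp hα hJ' (symbolCoeffs a N)] with ω h1
  rw [h1, symbolCoeffs_sum]

/-- Integration with respect to `Zξ + Zη`. -/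
lemma hasStableIntegral_add (hα : 1 < α) {Zη : ℝ → Ω → ℂ} {ν m : Measure ℝ} [IsFiniteMeasure m]
    [IsFiniteMeasure μ] [IsFiniteMeasure ν] (hm : m (Set.Ioc (-Real.pi) Real.pi)ᶜ = 0)
    (hμ : μ ≤ m) (hν : ν ≤ m)
    {J : Lp ℂ (ENNReal.ofReal α) μ →L[ℂ] Lp ℂ 1 P} {K : Lp ℂ (ENNReal.ofReal α) ν →L[ℂ] Lp ℂ 1 P}
    (hJ : ∀ c, J (stepLp μ (ENNReal.ofReal α) c) =ᵐ[P] stepIntegral Zξ c)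
    (hK : ∀ c, K (stepLp ν (ENNReal.ofReal α) c) =ᵐ[P] stepIntegral Zη c)
    (hJK : ∀ φ, HasScale α P (J (Lp.ofMeasureLE hμ φ) + K (Lp.ofMeasureLE hν φ) : Lp ℂ 1 P)
      (‖φ‖ ^ α)) (φ : Lp ℂ (ENNReal.ofReal α) m) :
    HasStableIntegral α P (fun θ => Zξ θ + Zη θ) m φ
      (J (Lp.ofMeasureLE hμ φ) + K (Lp.ofMeasureLE hν φ) : Lp ℂ 1 P) := by
  have hα0 : 0 < α := by linarith
  obtain ⟨x, hx, hlim⟩ := mem_closure_iff_seq_limit.1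
    (denseRange_stepLp m hm (ENNReal.ofReal α) ENNReal.ofReal_ne_top φ)
  choose c hcx using hx
  choose s hs hsi using fun n => exists_stepData (Ω := Ω) (c n)
  refine ⟨Lp.memLp φ, s, ?_, ?_⟩
  · rw [tendsto_iff_edist_tendsto_0] at hlim
    refine hlim.congr fun n => ?_
    rw [Lp.edist_def, ← hcx, hs]
    exact eLpNorm_congr_ae ((coeFn_stepLp m _ (c n)).sub (ae_eq_refl _))
  · refine tendstoSaS_of_tendsto hα (N := fun n => ‖x n - φ‖ ^ α) (fun n => ?_) ?_
    · refine (hJK (x n - φ)).congr ?_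
      have e1 : Lp.ofMeasureLE hμ (x n) = stepLp μ (ENNReal.ofReal α) (c n) := by
        rw [← hcx]
        exact Lp.ofMeasureLE_eq hμ (coeFn_stepLp m _ _) (coeFn_stepLp μ _ _)
      have e2 : Lp.ofMeasureLE hν (x n) = stepLp ν (ENNReal.ofReal α) (c n) := by
        rw [← hcx]
        exact Lp.ofMeasureLE_eq hν (coeFn_stepLp m _ _) (coeFn_stepLp ν _ _)
      have e3 : J (Lp.ofMeasureLE hμ (x n - φ)) + K (Lp.ofMeasureLE hν (x n - φ))
          = (J (stepLp μ (ENNReal.ofReal α) (c n)) + K (stepLp ν (ENNReal.ofReal α) (c n)))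
            - (J (Lp.ofMeasureLE hμ φ) + K (Lp.ofMeasureLE hν φ)) := by
        simp only [map_sub, e1, e2]; abel
      rw [e3]
      refine (Lp.coeFn_sub _ _).trans (EventuallyEq.sub ?_ (ae_eq_refl _))
      filter_upwards [Lp.coeFn_add (J (stepLp μ (ENNReal.ofReal α) (c n)))
        (K (stepLp ν (ENNReal.ofReal α) (c n))), hJ (c n), hK (c n)] with ω h1 h2 h3
      rw [h1, Pi.add_apply, h2, h3, hsi]
      simp only [stepIntegral, Finsupp.sum, Pi.add_apply]
      rw [← Finset.sum_add_distrib]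
      refine Finset.sum_congr rfl fun t _ => ?_
      ring
    · exact tendsto_norm_sub_rpow hα0 hlim

end Prediction

/-! ### The optimal linear estimate -/

theorem theorem1 {Ω : Type*} [MeasurableSpace Ω] (P : Measure Ω) [IsProbabilityMeasure P]
    (α : ℝ) (hα : 1 < α) (hα' : α ≤ 2)
    (f g : ℝ → ℝ) (hf : Measurable f) (hg : Measurable g)
    (hfint : IntegrableOn f (Set.Ioc (-Real.pi) Real.pi))
    (hgint : IntegrableOn g (Set.Ioc (-Real.pi) Real.pi))
    (hfpos : ∀ᵐ θ ∂volume.restrict (Set.Ioc (-Real.pi) Real.pi), 0 < f θ)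
    (hgpos : ∀ᵐ θ ∂volume.restrict (Set.Ioc (-Real.pi) Real.pi), 0 < g θ)
    (hmin : IntegrableOn (fun θ => (f θ + g θ) ^ (-1 / (α - 1)))
      (Set.Ioc (-Real.pi) Real.pi))
    (ξ η : ℤ → Ω → ℂ) (Zξ Zη : ℝ → Ω → ℂ)
    (hξ : IsHarmonizable α P ξ Zξ (densityMeasure f))
    (hη : IsHarmonizable α P η Zη (densityMeasure g))
    (hindep : IndepFun (fun ω k => ξ k ω) (fun ω k => η k ω) P)
    (a : ℕ → ℂ) (ha : Summable (fun j => ‖a j‖)) :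
    (∃ U, IsFunctional α P a ξ U) ∧
    ∀ U, IsFunctional α P a ξ U →
      ∃ (Y : Ω → ℂ) (h : ℝ → ℂ) (c : ℕ → ℂ),
        -- `Y` is the optimal estimate, and it is unique up to almost sure equality
        IsOptimalEstimate α P (fun k => ξ k + η k) U Y ∧
        (∀ Y', IsOptimalEstimate α P (fun k => ξ k + η k) U Y' → Y' =ᵐ[P] Y) ∧
        -- `Y = ∫ h (dZξ + dZη)` with `h` in the closed span of the past exponentials
        h ∈ pastFunctions α (densityMeasure (fun θ => f θ + g θ)) ∧
        HasStableIntegral α P (fun θ => Zξ θ + Zη θ) (densityMeasure (fun θ => f θ + g θ)) h Y ∧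
        -- `h` and `c` solve the system of equations, and are its only solution
        SolvesSystem α f g a h c ∧
        (∀ (h' : ℝ → ℂ) (c' : ℕ → ℂ),
          MemLp h' (ENNReal.ofReal α) (densityMeasure (fun θ => f θ + g θ)) →
          SolvesSystem α f g a h' c' →
            h' =ᵐ[volume.restrict (Set.Ioc (-Real.pi) Real.pi)] h ∧ c' = c) ∧
        -- the error of the estimate
        IsSaS α P (U - Y) ∧
        IntegrableOn (fun θ => ‖symbolA a θ - h θ‖ ^ α * f θ) (Set.Ioc (-Real.pi) Real.pi) ∧
        IntegrableOn (fun θ => ‖h θ‖ ^ α * g θ) (Set.Ioc (-Real.pi) Real.pi) ∧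
        saSNorm α P (U - Y) ^ α
          = (∫ θ in Set.Ioc (-Real.pi) Real.pi, ‖symbolA a θ - h θ‖ ^ α * f θ)
            + ∫ θ in Set.Ioc (-Real.pi) Real.pi, ‖h θ‖ ^ α * g θ := by
  have hα0 : 0 < α := by linarith
  have : Fact (1 ≤ ENNReal.ofReal α) := ⟨by rw [ENNReal.one_le_ofReal]; exact hα.le⟩
  have hμf := isFiniteMeasure_densityMeasure hfint
  have hμg := isFiniteMeasure_densityMeasure hgint
  have hμ := isFiniteMeasure_densityMeasure (hfint.add hgint)
  have hfgm : Measurable fun θ => f θ + g θ := hf.add hg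
  have hfg0 : ∀ᵐ θ ∂circMeas, 0 < f θ + g θ := by
    filter_upwards [hfpos, hgpos] with θ h1 h2
    exact add_pos h1 h2
  have hadd := densityMeasure_add hf hfpos hgpos
  set μ : Measure ℝ := densityMeasure fun θ => f θ + g θ with hμ_def
  have hfμ : densityMeasure f ≤ μ := by rw [hadd]; exact Measure.le_add_right le_rfl
  have hgμ : densityMeasure g ≤ μ := by rw [hadd]; exact Measure.le_add_left le_rfl
  let p := ENNReal.ofReal α
  let R : Lp ℂ p μ →L[ℂ] Lp ℂ p (densityMeasure f) := Lp.ofMeasureLE hfμ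
  let T : Lp ℂ p μ →L[ℂ] Lp ℂ p (densityMeasure g) := Lp.ofMeasureLE hgμ
  have hRT : ∀ φ : Lp ℂ p μ, ‖φ‖ ^ α = ‖R φ‖ ^ α + ‖T φ‖ ^ α :=
    norm_rpow_eq_add_of_measure_add hα0 hadd hfμ hgμ
  obtain ⟨J, hJ, hJ'⟩ := hξ.process.exists_integral hα
  obtain ⟨K, hK, hK'⟩ := hη.process.exists_integral hα
  have hJK := hasScale_add_of_indep hα hξ hη hindep hJ' hK' hJ hK
  -- integration with respect to the sum of the two spectral processes
  let I : Lp ℂ p μ →L[ℂ] Lp ℂ 1 P := J ∘L R + K ∘L T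
  have hI : ∀ φ, HasScale α P (I φ) (‖φ‖ ^ α) := fun φ => by
    rw [hRT]
    exact hJK (R φ) (T φ)
  have hIζ : ∀ c, I (trigLp μ p c) =ᵐ[P] fun ω => c.sum fun n b => b * (ξ n + η n) ω := fun c => by
    have e1 : R (trigLp μ p c) = trigLp (densityMeasure f) p c :=
      Lp.ofMeasureLE_eq hfμ (coeFn_trigLp μ _ _) (coeFn_trigLp _ _ _)
    have e2 : T (trigLp μ p c) = trigLp (densityMeasure g) p c :=
      Lp.ofMeasureLE_eq hgμ (coeFn_trigLp μ _ _) (coeFn_trigLp _ _ _)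
    have e3 : I (trigLp μ p c)
        = J (trigLp (densityMeasure f) p c) + K (trigLp (densityMeasure g) p c) := by
      rw [← e1, ← e2]; rfl
    rw [e3]
    filter_upwards [Lp.coeFn_add (J (trigLp (densityMeasure f) p c))
      (K (trigLp (densityMeasure g) p c)), hξ.integral_trigLp hα hJ' c,
      hη.integral_trigLp hα hK' c] with ω h1 h2 h3
    rw [h1, Pi.add_apply, h2, h3]
    simp only [Finsupp.sum, Pi.add_apply, mul_add, Finset.sum_add_distrib]
  have hAm := memLp_symbolA ha (densityMeasure f) p
  let A : Lp ℂ p (densityMeasure f) := hAm.toLp (symbolA a)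
  refine ⟨⟨_, hξ.isFunctional_integral hα hJ hJ' ha⟩, fun U hU => ?_⟩
  have hUA : J A =ᵐ[P] U := hU.ae_eq hα hξ hJ' ha
  -- the scale of the error of a candidate estimate
  have herr : ∀ {w : Lp ℂ p μ} {W : Ω → ℂ}, I w =ᵐ[P] W →
      HasScale α P (U - W) (‖A - R w‖ ^ α + ‖T w‖ ^ α) := fun {w W} hw => by
    have h1 := hJK (A - R w) (-T w)
    rw [norm_neg] at h1
    refine h1.congr ?_
    have h2 : J (A - R w) + K (-T w) = J A - I w := by
      have : I w = J (R w) + K (T w) := rfl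
      rw [this, map_sub, map_neg]; abel
    rw [h2]
    exact (Lp.coeFn_sub _ _).trans (hUA.sub hw)
  have hpast : ∀ {W : Ω → ℂ}, W ∈ pastSpace α P (fun k => ξ k + η k) ↔
      ∃ w ∈ pastLp μ p, I w =ᵐ[P] W := mem_pastSpace_iff hα hI hIζ
  have hle : ∀ {w w' : Lp ℂ p μ} {W W' : Ω → ℂ}, I w =ᵐ[P] W → I w' =ᵐ[P] W' →
      (saSNorm α P (U - W) ≤ saSNorm α P (U - W') ↔
        ‖A - R w‖ ^ α + ‖T w‖ ^ α ≤ ‖A - R w'‖ ^ α + ‖T w'‖ ^ α) := fun h h' => by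
    rw [(herr h).saSNorm_eq hα, (herr h').saSNorm_eq hα]
    exact Real.rpow_le_rpow_iff (herr h).nonneg (herr h').nonneg (by positivity)
  obtain ⟨h, hhS, hbest, huniq⟩ := exists_unique_minimizer hα R T hRT A (isClosed_pastLp μ)
  have hhf : MemLp h p (densityMeasure f) := (Lp.memLp h).mono_measure hfμ
  have hhg : MemLp h p (densityMeasure g) := (Lp.memLp h).mono_measure hgμ
  have hRh : R h =ᵐ[densityMeasure f] h := Lp.coeFn_ofMeasureLE hfμ h
  have hTh : T h =ᵐ[densityMeasure g] h := Lp.coeFn_ofMeasureLE hgμ h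
  have hARh : (A - R h : Lp ℂ p (densityMeasure f))
      =ᵐ[densityMeasure f] fun θ => symbolA a θ - h θ :=
    (Lp.coeFn_sub _ _).trans (hAm.coeFn_toLp.sub hRh)
  obtain ⟨c, hc⟩ := exists_solvesSystem hα hf hg hfpos hgpos ha hhf hhg
    (isAnalyticFrom_conj_of_mem_pastLp hα hfgm hfg0 hmin hhS) fun k hk => by
      have hmem : trigLp μ p (Finsupp.single k 1) ∈ pastLp μ p :=
        trigLp_mem_pastLp μ (Finsupp.single_mem_supported ℂ _ (Int.le_sub_one_of_lt hk))
      have h1 := dualPairing_eq_of_minimizer hα R T A hhS hbest hmem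
      have h2 : trigLp μ p (Finsupp.single k 1) =ᵐ[μ] expi k :=
        (coeFn_trigLp μ p _).trans (ae_of_all _ fun θ => by simp [trigVal])
      have h3 : R (trigLp μ p (Finsupp.single k 1)) =ᵐ[densityMeasure f] expi k :=
        (Lp.coeFn_ofMeasureLE hfμ _).trans
          (h2.filter_mono (Measure.absolutelyContinuous_of_le hfμ).ae_le)
      have h4 : T (trigLp μ p (Finsupp.single k 1)) =ᵐ[densityMeasure g] expi k :=
        (Lp.coeFn_ofMeasureLE hgμ _).trans
          (h2.filter_mono (Measure.absolutelyContinuous_of_le hgμ).ae_le)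
      have h5 : dualPairing α (densityMeasure f) (expi k) (fun θ => symbolA a θ - h θ)
          = dualPairing α (densityMeasure f) (R (trigLp μ p (Finsupp.single k 1)))
            (A - R h : Lp ℂ p (densityMeasure f)) := by
        apply integral_congr_ae
        filter_upwards [h3, hARh] with θ h6 h7
        rw [h6, h7]
      have h6 : dualPairing α (densityMeasure g) (expi k) h
          = dualPairing α (densityMeasure g) (T (trigLp μ p (Finsupp.single k 1))) (T h) := by
        apply integral_congr_ae
        filter_upwards [h4, hTh] with θ h6 h7
        rw [h6, h7]
      rw [h5, h6, h1]
  have hIh : I h =ᵐ[P] I h := ae_eq_refl _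
  have hopt : IsOptimalEstimate α P (fun k => ξ k + η k) U (I h) := by
    refine ⟨hpast.2 ⟨h, hhS, hIh⟩, fun W hW => ?_⟩
    obtain ⟨w, hw, hwW⟩ := hpast.1 hW
    exact (hle hIh hwW).2 (hbest w hw)
  refine ⟨I h, h, c, hopt, fun Y' hY' => ?_, mem_pastFunctions hhS,
    hasStableIntegral_add hα (densityMeasure_compl _) hfμ hgμ hJ' hK' hI h, hc,
    fun h' c' hh' hs' => hc.unique hα hf hg hfpos hgpos ha hhf hhg (hh'.mono_measure hfμ)
      (hh'.mono_measure hgμ) hs', (herr hIh).isSaS hα0, ?_, ?_, ?_⟩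
  · obtain ⟨w, hw, hwY⟩ := hpast.1 hY'.1
    have hwh : w = h := huniq w hw fun v hv =>
      (hle hwY (ae_eq_refl (I v))).1 (hY'.2 _ (hpast.2 ⟨v, hv, ae_eq_refl _⟩))
    rw [← hwh]
    exact hwY.symm
  · have h1 := (integrable_densityMeasure_iff hf hfpos).1
      (MemLp.integrable_norm_rpow_ofReal hα0 (hAm.sub hhf))
    exact h1.congr (ae_of_all _ fun θ => mul_comm _ _)
  · have h1 := (integrable_densityMeasure_iff hg hgpos).1
      (MemLp.integrable_norm_rpow_ofReal hα0 hhg)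
    exact h1.congr (ae_of_all _ fun θ => mul_comm _ _)
  · rw [(herr hIh).saSNorm_rpow hα, Lp_norm_rpow hα0, Lp_norm_rpow hα0]
    congr 1
    · refine (integral_congr_ae (hARh.fun_comp fun z => ‖z‖ ^ α)).trans ?_
      refine (integral_densityMeasure_eq hf hfpos _).trans ?_
      exact integral_congr_ae (ae_of_all _ fun θ => mul_comm _ _)
    · refine (integral_congr_ae (hTh.fun_comp fun z => ‖z‖ ^ α)).trans ?_
      refine (integral_densityMeasure_eq hg hgpos _).trans ?_
      exact integral_congr_ae (ae_of_all _ fun θ => mul_comm _ _)
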